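/- **Theorem 2.1.** Let $(\mathcal X,d,\mu)$ be a space of homogeneous type: $(\mathcal X,d)$ is a metric space, $\mu$ is a Borel measure for which every ball $B(x,r)=\{y: d(x,y)<r\}$, $x\in\mathcal X$, $0<r<\infty$, has positive finite measure, and there is $A_1\in[1,\infty)$ with $\mu(B(x,2r))\le A_1\,\mu(B(x,r))$ for all $x$ and $r$. Let $\mathcal D$ be any (possibly empty) collection of balls, $p\in(0,1]$ and $q\in[1,\infty]\cap(p,\infty]$. All functions are complex-valued; $B$ denotes a ball and $f_B=\mu(B)^{-1}\int_B f\,d\mu$. *Morrey–Campanato space.* $\mathcal E^{1/p-1,1}_{\mathcal D}(\mathcal X)$ is the space of functions $f$ that are integrable on every ball and satisfy $$\|f\|_{\mathcal E^{1/p-1,1}_{\mathcal D}}=\sup_{B\notin\mathcal D}\frac1{\mu(B)^{1/p}}\int_B|f-f_B|\,d\mu+\sup_{B\in\mathcal D}\frac1{\mu(B)^{1/p}}\int_B|f|\,d\mu<\infty .$$ *Atoms.* A $(p,q)$-atom is a function $a$ supported in some ball $B$ with $\|a\|_{L^q}\le\mu(B)^{1/q-1/p}$ and $\int a\,d\mu=0$.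 A $(p,q)_{\mathcal D}$-atom is a function $b$ supported in some ball $B\in\mathcal D$ with $\|b\|_{L^q}\le\mu(B)^{1/q-1/p}$. *Lipschitz space.* For $\alpha>0$, $\mathrm{Lip}_{\mathcal D}(\alpha;\mathcal X)$ is the space of measurable functions $\varphi$ for which there is $c\ge 0$ such that $|\varphi(x)-\varphi(y)|\le c\,\mu(B)^\alpha$ for all balls $B\notin\mathcal D$ and all $x,y\in B$, and $\|\varphi\|_{L^\infty(B)}\le c\,\mu(B)^\alpha$ for all $B\in\mathcal D$; its norm is the least such $c$. *Hardy space.* Let $V=L^1(\mathcal X)$ if $p=1$, and let $V$ be the normed dual of $\mathrm{Lip}_{\mathcal D}(1/p-1;\mathcal X)$ if $p<1$, where a function $g$ is identified with the functional $\varphi\mapsto\int\varphi g\,d\mu$ whenever this is defined and bounded. $H^{p,q}_{\mathcal D}(\mathcal X)$ is the set of all $h\in V$ of the form $h=\sum_j\lambda_ja_j+\sum_k\nu_kb_k$ (convergence in $V$), where each sum is countable, finite or empty, the $a_j$ are $(p,q)$-atoms, the $b_k$ are $(p,q)_{\mathcal D}$-atoms, $\lambda_j,\nu_k\in\mathbb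 C$ and $\sum_j|\lambda_j|^p+\sum_k|\nu_k|^p<\infty$. Its quasi-norm is $\|h\|_{H^{p,q}_{\mathcal D}}=\inf\big(\sum_j|\lambda_j|^p+\sum_k|\nu_k|^p\big)^{1/p}$, the infimum being over all such decompositions. The dual $(H^{p,q}_{\mathcal D}(\mathcal X))^*$ consists of the linear functionals $\ell$ on $H^{p,q}_{\mathcal D}(\mathcal X)$ with $|\ell(h)|\le c\,\|h\|_{H^{p,q}_{\mathcal D}}$ for some $c\ge0$ and all $h$; the norm of $\ell$ is the least such $c$. *Claim.* $(H^{p,q}_{\mathcal D}(\mathcal X))^*=\mathcal E^{1/p-1,1}_{\mathcal D}(\mathcal X)$ with equivalent norms. Precisely, for every $f\in\mathcal E^{1/p-1,1}_{\mathcal D}(\mathcal X)$ there is exactly one $\ell_f\in(H^{p,q}_{\mathcal D}(\mathcal X))^*$ such that $$\ell_f(g)=\int_{\mathcal X}f g\,d\mu$$ for all bounded functions $g$ with bounded support that belong to $H^{p,q}_{\mathcal D}(\mathcal X)$. The map $f\mapsto\ell_f$ is linear and maps $\mathcal E^{1/p-1,1}_{\mathcal D}(\mathcal X)$ onto $(H^{p,q}_{\mathcal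 D}(\mathcal X))^*$, and $$C^{-1}\|f\|_{\mathcal E^{1/p-1,1}_{\mathcal D}}\le\|\ell_f\|_{(H^{p,q}_{\mathcal D})^*}\le C\,\|f\|_{\mathcal E^{1/p-1,1}_{\mathcal D}},$$ where $C>0$ depends on $\mathcal X,\mu,p,q$ only, not on $f$ or $\mathcal D$. (In particular $\ell_f=0$ exactly when $\|f\|_{\mathcal E^{1/p-1,1}_{\mathcal D}}=0$; such $f$ are identified with $0$.) -/

import Mathlib

open MeasureTheory Filter Topology
open scoped ENNReal

namespace LocHardy

/-- A ball `B(x, r)`, `0 < r < ∞`; a ball comes with its centre and its radius. -/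
structure Ball (X : Type*) where
  center : X
  radius : ℝ
  radius_pos : 0 < radius

/-- The underlying point set `{y | d(x, y) < r}` of a ball. -/
def Ball.set {X : Type*} [MetricSpace X] (B : Ball X) : Set X :=
  Metric.ball B.center B.radius

/-- `(X, d, μ)` is a space of homogeneous type: all balls have positive and finite measure, and
`μ` is doubling. -/
structure IsHomogeneousType {X : Type*} [MetricSpace X] [MeasurableSpace X]
    (μ : Measure X) : Prop where
  pos : ∀ (x : X) (r : ℝ), 0 < r → 0 < μ (Metric.ball x r)
  finite : ∀ (x : X) (r : ℝ), 0 < r → μ (Metric.ball x r) < ∞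
  doubling : ∃ A : ℝ, 1 ≤ A ∧ ∀ (x : X) (r : ℝ), 0 < r →
    μ (Metric.ball x (2 * r)) ≤ ENNReal.ofReal A * μ (Metric.ball x r)

noncomputable section

section MorreyCampanato

variable {X : Type*} [MetricSpace X] [MeasurableSpace X]

/-- The `[0, ∞]`-valued norm of the localized Morrey-Campanato space `ℰ^{α,1}_D`:
`sup_{B ∉ D} μ(B)^{-(1+α)} ∫_B |f - f_B| dμ + sup_{B ∈ D} μ(B)^{-(1+α)} ∫_B |f| dμ`. -/
def mcENorm (μ : Measure X) (D : Set (Ball X)) (α : ℝ) (f : X → ℂ) : ℝ≥0∞ :=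
  (⨆ B ∈ Dᶜ, (∫⁻ y in B.set, ‖f y - ⨍ z in B.set, f z ∂μ‖ₑ ∂μ) / μ B.set ^ (1 + α)) +
  ⨆ B ∈ D, (∫⁻ y in B.set, ‖f y‖ₑ ∂μ) / μ B.set ^ (1 + α)

theorem mcENorm_add (μ : Measure X) (D : Set (Ball X)) (α : ℝ) (f g : X → ℂ)
    (hf : ∀ B : Ball X, IntegrableOn f B.set μ) (hg : ∀ B : Ball X, IntegrableOn g B.set μ) :
    mcENorm μ D α (f + g) ≤ mcENorm μ D α f + mcENorm μ D α g := by
  unfold mcENorm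
  rw [add_add_add_comm]
  refine add_le_add ?_ ?_
  · refine iSup₂_le fun B hB => ?_
    refine le_trans ?_ (add_le_add
      (le_iSup₂ (f := fun (B : Ball X) (_ : B ∈ Dᶜ) =>
        (∫⁻ y in B.set, ‖f y - ⨍ z in B.set, f z ∂μ‖ₑ ∂μ) / μ B.set ^ (1 + α)) B hB)
      (le_iSup₂ (f := fun (B : Ball X) (_ : B ∈ Dᶜ) =>
        (∫⁻ y in B.set, ‖g y - ⨍ z in B.set, g z ∂μ‖ₑ ∂μ) / μ B.set ^ (1 + α)) B hB))
    rw [← ENNReal.add_div]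
    refine ENNReal.div_le_div_right ?_ _
    have hav : (⨍ z in B.set, (f + g) z ∂μ)
        = (⨍ z in B.set, f z ∂μ) + ⨍ z in B.set, g z ∂μ := by
      simp only [setAverage_eq, Pi.add_apply]
      rw [integral_add (hf B) (hg B), smul_add]
    rw [hav]
    by_cases hfin : ∫⁻ y in B.set, ‖f y - ⨍ z in B.set, f z ∂μ‖ₑ ∂μ = ∞
    · rw [hfin]; simp
    refine le_trans (lintegral_mono fun y => ?_) (le_of_eq (lintegral_add_left' ?_ _))
    · rw [Pi.add_apply, add_sub_add_comm]
      exact enorm_add_le _ _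
    · exact ((hf B).aestronglyMeasurable.sub aestronglyMeasurable_const).enorm
  · refine iSup₂_le fun B hB => ?_
    refine le_trans ?_ (add_le_add
      (le_iSup₂ (f := fun (B : Ball X) (_ : B ∈ D) =>
        (∫⁻ y in B.set, ‖f y‖ₑ ∂μ) / μ B.set ^ (1 + α)) B hB)
      (le_iSup₂ (f := fun (B : Ball X) (_ : B ∈ D) =>
        (∫⁻ y in B.set, ‖g y‖ₑ ∂μ) / μ B.set ^ (1 + α)) B hB))
    rw [← ENNReal.add_div]
    refine ENNReal.div_le_div_right ?_ _
    refine le_trans (lintegral_mono fun y => ?_) (le_of_eq (lintegral_add_left' ?_ _))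
    · exact enorm_add_le _ _
    · exact (hf B).aestronglyMeasurable.enorm

theorem mcENorm_smul_le (μ : Measure X) (D : Set (Ball X)) (α : ℝ) (c : ℂ) (f : X → ℂ) :
    mcENorm μ D α (c • f) ≤ ‖c‖ₑ * mcENorm μ D α f := by
  unfold mcENorm
  rw [mul_add]
  refine add_le_add ?_ ?_
  · refine iSup₂_le fun B hB => ?_
    refine le_trans ?_ (mul_le_mul_right
      (le_iSup₂ (f := fun (B : Ball X) (_ : B ∈ Dᶜ) =>
        (∫⁻ y in B.set, ‖f y - ⨍ z in B.set, f z ∂μ‖ₑ ∂μ) / μ B.set ^ (1 + α)) B hB) _)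
    have hav : (⨍ z in B.set, (c • f) z ∂μ) = c * ⨍ z in B.set, f z ∂μ := by
      simp only [setAverage_eq, Pi.smul_apply, smul_eq_mul]
      rw [integral_const_mul, mul_smul_comm]
    rw [hav, ← mul_div_assoc, ← lintegral_const_mul' _ _ enorm_ne_top]
    refine ENNReal.div_le_div_right (lintegral_mono fun y => ?_) _
    rw [Pi.smul_apply, smul_eq_mul, ← mul_sub, enorm_mul]
  · refine iSup₂_le fun B hB => ?_
    refine le_trans ?_ (mul_le_mul_right
      (le_iSup₂ (f := fun (B : Ball X) (_ : B ∈ D) =>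
        (∫⁻ y in B.set, ‖f y‖ₑ ∂μ) / μ B.set ^ (1 + α)) B hB) _)
    rw [← mul_div_assoc, ← lintegral_const_mul' _ _ enorm_ne_top]
    refine ENNReal.div_le_div_right (lintegral_mono fun y => ?_) _
    rw [Pi.smul_apply, smul_eq_mul, enorm_mul]

/-- The localized Morrey-Campanato space `ℰ^{α,1}_D(X)`: functions which are integrable on every
ball and whose norm is finite. -/
def morreyCampanato (μ : Measure X) (D : Set (Ball X)) (α : ℝ) : Submodule ℂ (X → ℂ) where
  carrier := {f | (∀ B : Ball X, IntegrableOn f B.set μ) ∧ mcENorm μ D α f < ∞}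
  zero_mem' := ⟨fun _ => integrableOn_zero, by simp [mcENorm]⟩
  add_mem' := fun {f g} hf hg => ⟨fun B => (hf.1 B).add (hg.1 B),
    lt_of_le_of_lt (mcENorm_add μ D α f g hf.1 hg.1) (ENNReal.add_lt_top.2 ⟨hf.2, hg.2⟩)⟩
  smul_mem' := fun c f hf => ⟨fun B => (hf.1 B).smul c,
    lt_of_le_of_lt (mcENorm_smul_le μ D α c f) (ENNReal.mul_lt_top enorm_lt_top hf.2)⟩

/-- The (semi)norm of `ℰ^{α,1}_D(X)`, as a real number. -/
def mcNorm (μ : Measure X) (D : Set (Ball X)) (α : ℝ) (f : X → ℂ) : ℝ :=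
  (mcENorm μ D α f).toReal

end MorreyCampanato

section Lipschitz

variable {X : Type*} [MetricSpace X] [MeasurableSpace X]

/-- `C` is an admissible constant for `f` in the definition of `Lip_D(α; X)`. -/
structure IsLipBound (μ : Measure X) (D : Set (Ball X)) (α : ℝ) (f : X → ℂ) (C : ℝ) : Prop where
  nonneg : 0 ≤ C
  osc : ∀ B : Ball X, B ∉ D → ∀ x ∈ B.set, ∀ y ∈ B.set, ‖f x - f y‖ ≤ C * μ.real B.set ^ α
  size : ∀ B : Ball X, B ∈ D → ∀ᵐ x ∂(μ.restrict B.set), ‖f x‖ ≤ C * μ.real B.set ^ α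

theorem IsLipBound.zero (μ : Measure X) (D : Set (Ball X)) (α : ℝ) :
    IsLipBound μ D α 0 0 :=
  ⟨le_rfl, by simp, by simp⟩

theorem IsLipBound.add {μ : Measure X} {D : Set (Ball X)} {α : ℝ} {f g : X → ℂ} {C C' : ℝ}
    (hf : IsLipBound μ D α f C) (hg : IsLipBound μ D α g C') :
    IsLipBound μ D α (f + g) (C + C') := by
  refine ⟨add_nonneg hf.nonneg hg.nonneg, fun B hB x hx y hy => ?_, fun B hB => ?_⟩
  · rw [Pi.add_apply, Pi.add_apply, add_sub_add_comm, add_mul]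
    exact (norm_add_le _ _).trans (add_le_add (hf.osc B hB x hx y hy) (hg.osc B hB x hx y hy))
  · filter_upwards [hf.size B hB, hg.size B hB] with x h1 h2
    rw [Pi.add_apply, add_mul]
    exact (norm_add_le _ _).trans (add_le_add h1 h2)

theorem IsLipBound.smul {μ : Measure X} {D : Set (Ball X)} {α : ℝ} {f : X → ℂ} {C : ℝ} (c : ℂ)
    (hf : IsLipBound μ D α f C) : IsLipBound μ D α (c • f) (‖c‖ * C) := by
  refine ⟨mul_nonneg (norm_nonneg _) hf.nonneg, fun B hB x hx y hy => ?_, fun B hB => ?_⟩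
  · rw [Pi.smul_apply, Pi.smul_apply, ← smul_sub, norm_smul, mul_assoc]
    exact mul_le_mul_of_nonneg_left (hf.osc B hB x hx y hy) (norm_nonneg _)
  · filter_upwards [hf.size B hB] with x h1
    rw [Pi.smul_apply, norm_smul, mul_assoc]
    exact mul_le_mul_of_nonneg_left h1 (norm_nonneg _)

/-- The localized Lipschitz space `Lip_D(α; X)` as a space of functions. -/
def lipSubmodule (μ : Measure X) (D : Set (Ball X)) (α : ℝ) : Submodule ℂ (X → ℂ) where
  carrier := {f | AEStronglyMeasurable f μ ∧ ∃ C, IsLipBound μ D α f C}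
  zero_mem' := ⟨aestronglyMeasurable_zero, 0, IsLipBound.zero μ D α⟩
  add_mem' := fun hf hg => ⟨hf.1.add hg.1, by
    obtain ⟨_, C, hC⟩ := hf
    obtain ⟨_, C', hC'⟩ := hg
    exact ⟨_, hC.add hC'⟩⟩
  smul_mem' := fun c f hf => ⟨hf.1.const_smul c, by
    obtain ⟨_, C, hC⟩ := hf
    exact ⟨_, hC.smul c⟩⟩

/-- The localized Lipschitz space `Lip_D(α; X)`, to be endowed with its own norm (a type synonym,
so that it does not inherit the product topology from the space of all functions). -/
def LipD (μ : Measure X) (D : Set (Ball X)) (α : ℝ) : Type _ := lipSubmodule μ D α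

variable {μ : Measure X} {D : Set (Ball X)} {α : ℝ}

instance : AddCommGroup (LipD μ D α) :=
  inferInstanceAs (AddCommGroup (lipSubmodule μ D α))

instance : Module ℂ (LipD μ D α) :=
  inferInstanceAs (Module ℂ (lipSubmodule μ D α))

/-- The function underlying an element of `Lip_D(α; X)`. -/
def LipD.fn (φ : LipD μ D α) : X → ℂ := φ.1

/-- The norm of `Lip_D(α; X)`: the least admissible constant. -/
instance : Norm (LipD μ D α) := ⟨fun φ => sInf {C | IsLipBound μ D α φ.fn C}⟩

theorem LipD.bddBelow (f : X → ℂ) : BddBelow {C | IsLipBound μ D α f C} :=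
  ⟨0, fun _ hC => hC.nonneg⟩

theorem LipD.norm_le {φ : LipD μ D α} {C : ℝ} (h : IsLipBound μ D α φ.fn C) : ‖φ‖ ≤ C :=
  csInf_le (LipD.bddBelow _) h

theorem LipD.exists_lt (φ : LipD μ D α) {ε : ℝ} (hε : 0 < ε) :
    ∃ C, IsLipBound μ D α φ.fn C ∧ C < ‖φ‖ + ε :=
  Real.lt_sInf_add_pos φ.2.2 hε

theorem LipD.norm_nonneg' (φ : LipD μ D α) : 0 ≤ ‖φ‖ :=
  Real.sInf_nonneg fun _ hC => hC.nonneg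

theorem LipD.norm_smul_le' (c : ℂ) (φ : LipD μ D α) : ‖c • φ‖ ≤ ‖c‖ * ‖φ‖ := by
  refine le_of_forall_pos_le_add fun ε hε => ?_
  obtain ⟨C, hC, hlt⟩ := φ.exists_lt (show 0 < ε / (‖c‖ + 1) by positivity)
  have h1 : ‖c • φ‖ ≤ ‖c‖ * C := LipD.norm_le (φ := c • φ) (hC.smul c)
  have h2 : ‖c‖ * C ≤ ‖c‖ * (‖φ‖ + ε / (‖c‖ + 1)) :=
    mul_le_mul_of_nonneg_left hlt.le (norm_nonneg _)
  have h3 : ‖c‖ * (ε / (‖c‖ + 1)) ≤ ε := by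
    rw [← mul_div_assoc, div_le_iff₀ (by positivity)]
    nlinarith [norm_nonneg c]
  linarith

theorem LipD.core : SeminormedSpace.Core ℂ (LipD μ D α) where
  norm_nonneg := LipD.norm_nonneg'
  norm_smul c φ := by
    refine le_antisymm (LipD.norm_smul_le' c φ) ?_
    rcases eq_or_ne c 0 with rfl | hc
    · simpa using LipD.norm_nonneg' ((0 : ℂ) • φ)
    · have h := LipD.norm_smul_le' c⁻¹ (c • φ)
      rw [smul_smul, inv_mul_cancel₀ hc, one_smul, norm_inv] at h
      rwa [le_inv_mul_iff₀ (norm_pos_iff.2 hc)] at h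
  norm_triangle φ ψ := by
    refine le_of_forall_pos_le_add fun ε hε => ?_
    obtain ⟨C, hC, hlt⟩ := φ.exists_lt (half_pos hε)
    obtain ⟨C', hC', hlt'⟩ := ψ.exists_lt (half_pos hε)
    have h1 : ‖φ + ψ‖ ≤ C + C' := LipD.norm_le (φ := φ + ψ) (hC.add hC')
    linarith

instance : SeminormedAddCommGroup (LipD μ D α) := SeminormedAddCommGroup.ofCore LipD.core

instance : NormedSpace ℂ (LipD μ D α) where
  norm_smul_le := LipD.norm_smul_le'

end Lipschitz

section Atoms

variable {X : Type*} [MetricSpace X] [MeasurableSpace X]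

/-- `a` is supported in the ball `B`, lies in `L^q`, and `‖a‖_q ≤ μ(B)^{1/q - 1/p}`
(with `1/∞ = 0`). -/
structure IsSizedOn (μ : Measure X) (p : ℝ) (q : ℝ≥0∞) (B : Ball X) (a : X → ℂ) : Prop where
  supp : Function.support a ⊆ B.set
  memLp : MemLp a q μ
  size : eLpNorm a q μ ≤ μ B.set ^ ((q⁻¹).toReal - 1 / p)

/-- `(p, q)`-atoms: supported in some ball, with vanishing mean. -/
def IsAtom (μ : Measure X) (p : ℝ) (q : ℝ≥0∞) (a : X → ℂ) : Prop :=
  ∃ B : Ball X, IsSizedOn μ p q B a ∧ ∫ x, a x ∂μ = 0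

/-- `(p, q)_D`-atoms: supported in a ball of `D`, no cancellation. -/
def IsLocAtom (μ : Measure X) (D : Set (Ball X)) (p : ℝ) (q : ℝ≥0∞) (b : X → ℂ) : Prop :=
  ∃ B ∈ D, IsSizedOn μ p q B b

/-- Essentially bounded functions with bounded support, `L^∞_b(X)`. -/
def IsBddBddSupp (μ : Measure X) (g : X → ℂ) : Prop :=
  MemLp g ∞ μ ∧ Bornology.IsBounded (Function.support g)

end Atoms

section Hardy

variable {X : Type*} [MetricSpace X] [MeasurableSpace X]
variable {V : Type*} [AddCommGroup V] [Module ℂ V] [TopologicalSpace V]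

/-- In the topological vector space `V`, where `rep v a` says that `v` is the element of `V` given
by the function `a`, the element `F` is the sum `∑ⱼ lamⱼ aⱼ + ∑ₖ nuₖ bₖ` with `(p, q)`-atoms `aⱼ`,
`(p, q)_D`-atoms `bₖ` and `∑ⱼ |lamⱼ|^p + ∑ₖ |nuₖ|^p < ∞`. Terms with a vanishing coefficient are
void, so that finite or empty sums are allowed (needed when `D` is empty). -/
structure IsAtomicDecomp (μ : Measure X) (D : Set (Ball X)) (p : ℝ) (q : ℝ≥0∞)
    (rep : V → (X → ℂ) → Prop) (F : V) (lam nu : ℕ → ℂ) : Prop where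
  summable_lam : Summable fun j => ‖lam j‖ ^ p
  summable_nu : Summable fun k => ‖nu k‖ ^ p
  exists_atoms : ∃ (a b : ℕ → V) (s t : V),
    (∀ j, lam j ≠ 0 → ∃ a₀, IsAtom μ p q a₀ ∧ rep (a j) a₀) ∧
    (∀ k, nu k ≠ 0 → ∃ b₀, IsLocAtom μ D p q b₀ ∧ rep (b k) b₀) ∧
    HasSum (fun j => lam j • a j) s ∧ HasSum (fun k => nu k • b k) t ∧ F = s + t

/-- Merging two sequences into one. -/
def merge {S : Type*} (u v : ℕ → S) : ℕ → S :=
  Sum.elim u v ∘ Equiv.natSumNatEquivNat.symm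

theorem merge_forall {S T : Type*} {P : S → T → Prop} {u v : ℕ → S} {w z : ℕ → T}
    (h1 : ∀ j, P (u j) (w j)) (h2 : ∀ j, P (v j) (z j)) (j : ℕ) :
    P (merge u v j) (merge w z j) := by
  unfold merge
  simp only [Function.comp_apply]
  rcases Equiv.natSumNatEquivNat.symm j with i | i
  · exact h1 i
  · exact h2 i

theorem hasSum_merge {W : Type*} [AddCommMonoid W] [TopologicalSpace W] [ContinuousAdd W]
    {u v : ℕ → W} {s t : W} (hu : HasSum u s) (hv : HasSum v t) :
    HasSum (merge u v) (s + t) := by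
  refine (Equiv.hasSum_iff (Equiv.natSumNatEquivNat.symm) (f := Sum.elim u v)).2 ?_
  exact HasSum.sum (by simpa using hu) (by simpa using hv)

theorem comp_merge {S T : Type*} (φ : S → T) (u v : ℕ → S) :
    (fun j => φ (merge u v j)) = merge (fun j => φ (u j)) (fun j => φ (v j)) := by
  funext j
  unfold merge
  simp only [Function.comp_apply]
  rcases Equiv.natSumNatEquivNat.symm j with i | i <;> rfl

theorem smul_merge {W : Type*} [AddCommGroup W] [Module ℂ W] (u v : ℕ → ℂ) (w z : ℕ → W) :
    (fun j => merge u v j • merge w z j) =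
      merge (fun j => u j • w j) (fun j => v j • z j) := by
  funext j
  unfold merge
  simp only [Function.comp_apply]
  rcases Equiv.natSumNatEquivNat.symm j with i | i <;> rfl

/-- The elements of `V` with an atomic decomposition; a localized atomic Hardy space inside the
ambient space `V`. -/
def atomicHardy [IsTopologicalAddGroup V] [ContinuousConstSMul ℂ V] (μ : Measure X)
    (D : Set (Ball X)) (p : ℝ) (hp : 0 < p) (q : ℝ≥0∞) (rep : V → (X → ℂ) → Prop) :
    Submodule ℂ V where
  carrier := {F | ∃ lam nu, IsAtomicDecomp μ D p q rep F lam nu}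
  zero_mem' := by
    refine ⟨0, 0, ?_, ?_, 0, 0, 0, 0, by simp, by simp, ?_, ?_, by simp⟩
    · simp [Real.zero_rpow hp.ne']
    · simp [Real.zero_rpow hp.ne']
    · simp
    · simp
  add_mem' := by
    rintro F G ⟨l, n, h1, h2, a, b, s, t, ha, hb, hs, ht, rfl⟩
      ⟨l', n', h1', h2', a', b', s', t', ha', hb', hs', ht', rfl⟩
    refine ⟨merge l l', merge n n', ?_, ?_, merge a a', merge b b', s + s', t + t', ?_, ?_, ?_, ?_,
      by abel⟩
    · rw [comp_merge (fun z : ℂ => ‖z‖ ^ p)]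
      exact (hasSum_merge h1.hasSum h1'.hasSum).summable
    · rw [comp_merge (fun z : ℂ => ‖z‖ ^ p)]
      exact (hasSum_merge h2.hasSum h2'.hasSum).summable
    · exact merge_forall (P := fun c v => c ≠ 0 → ∃ a₀, IsAtom μ p q a₀ ∧ rep v a₀) ha ha'
    · exact merge_forall (P := fun c v => c ≠ 0 → ∃ b₀, IsLocAtom μ D p q b₀ ∧ rep v b₀) hb hb'
    · rw [smul_merge]; exact hasSum_merge hs hs'
    · rw [smul_merge]; exact hasSum_merge ht ht'
  smul_mem' := by
    rintro c F ⟨l, n, h1, h2, a, b, s, t, ha, hb, hs, ht, rfl⟩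
    refine ⟨fun j => c * l j, fun k => c * n k, ?_, ?_, a, b, c • s, c • t,
      fun j hj => ha j (right_ne_zero_of_mul hj), fun k hk => hb k (right_ne_zero_of_mul hk),
      ?_, ?_, smul_add _ _ _⟩
    · simp only [norm_mul, Real.mul_rpow (norm_nonneg _) (norm_nonneg _)]
      exact h1.mul_left _
    · simp only [norm_mul, Real.mul_rpow (norm_nonneg _) (norm_nonneg _)]
      exact h2.mul_left _
    · simpa only [mul_smul] using hs.const_smul c
    · simpa only [mul_smul] using ht.const_smul c

/-- The quasi-norm of the atomic Hardy space: the infimum of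
`(∑ⱼ |lamⱼ|^p + ∑ₖ |nuₖ|^p)^{1/p}` over all atomic decompositions. -/
def hardyNorm (μ : Measure X) (D : Set (Ball X)) (p : ℝ) (q : ℝ≥0∞)
    (rep : V → (X → ℂ) → Prop) (F : V) : ℝ :=
  sInf {c | ∃ lam nu, IsAtomicDecomp μ D p q rep F lam nu ∧
    c = ((∑' j, ‖lam j‖ ^ p) + ∑' k, ‖nu k‖ ^ p) ^ (1 / p)}

theorem hardyNorm_nonneg (μ : Measure X) (D : Set (Ball X)) (p : ℝ) (q : ℝ≥0∞)
    (rep : V → (X → ℂ) → Prop) (F : V) : 0 ≤ hardyNorm μ D p q rep F := by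
  refine Real.sInf_nonneg ?_
  rintro c ⟨lam, nu, -, rfl⟩
  have h1 : 0 ≤ ∑' j, ‖lam j‖ ^ p := tsum_nonneg fun j => by positivity
  have h2 : 0 ≤ ∑' j, ‖nu j‖ ^ p := tsum_nonneg fun j => by positivity
  positivity

/-- The dual of the atomic Hardy space: the linear functionals which are bounded with respect to
the quasi-norm. -/
def hardyDual [IsTopologicalAddGroup V] [ContinuousConstSMul ℂ V] (μ : Measure X)
    (D : Set (Ball X)) (p : ℝ) (hp : 0 < p) (q : ℝ≥0∞) (rep : V → (X → ℂ) → Prop) :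
    Submodule ℂ (Module.Dual ℂ (atomicHardy μ D p hp q rep)) where
  carrier := {l | ∃ C : ℝ, ∀ h, ‖l h‖ ≤ C * hardyNorm μ D p q rep (h : V)}
  zero_mem' := ⟨0, by simp⟩
  add_mem' := by
    rintro l m ⟨C, hC⟩ ⟨C', hC'⟩
    refine ⟨C + C', fun h => ?_⟩
    rw [LinearMap.add_apply, add_mul]
    exact (norm_add_le _ _).trans (add_le_add (hC h) (hC' h))
  smul_mem' := by
    rintro c l ⟨C, hC⟩
    refine ⟨‖c‖ * C, fun h => ?_⟩
    rw [LinearMap.smul_apply, norm_smul, mul_assoc]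
    exact mul_le_mul_of_nonneg_left (hC h) (norm_nonneg _)

/-- The operator norm of a bounded functional on the atomic Hardy space. -/
def hardyDualNorm [IsTopologicalAddGroup V] [ContinuousConstSMul ℂ V] {μ : Measure X}
    {D : Set (Ball X)} {p : ℝ} {hp : 0 < p} {q : ℝ≥0∞} {rep : V → (X → ℂ) → Prop}
    (l : hardyDual μ D p hp q rep) : ℝ :=
  sInf {C | 0 ≤ C ∧ ∀ h, ‖l.1 h‖ ≤ C * hardyNorm μ D p q rep (h : V)}

/-- The element `v` of `L¹(X)` is (the class of) the function `a`. -/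
def repL1 (μ : Measure X) (v : Lp ℂ 1 μ) (a : X → ℂ) : Prop := v =ᵐ[μ] a

/-- The element `F` of `(Lip_D(α; X))*` is the functional `φ ↦ ∫ φ a dμ` given by the
function `a`. -/
def repLip (μ : Measure X) (D : Set (Ball X)) (α : ℝ) (F : StrongDual ℂ (LipD μ D α))
    (a : X → ℂ) : Prop :=
  ∀ φ : LipD μ D α, F φ = ∫ x, φ.fn x * a x ∂μ

end Hardy

end

end LocHardy

namespace LocHardy

/-! The proof is carried out in an abstract ambient space `V`. It uses only that functions act
linearly and injectively enough (`IsAmbient`) and that an integrable function `a` on a ball `B`,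
with mean zero or with `B ∈ D`, has norm at most `‖a‖₁ μ(B)^{1/p-1}` in `V`. Both `L¹` and the dual
of `LipD` have this property.

From functionals to functions of controlled norm. A bounded function on `B` with the right
cancellation is a multiple of an atom, with quasi-norm at most `‖g‖_∞ μ(B)^{1/p}`. Testing against
the conjugate sign of `f - f_B`, recentred to mean zero, or against the conjugate sign of `f` when
`B ∈ D`, gives `‖f‖ ≤ 3 ‖ℓ‖` (`mcENorm_le_of_testing`).

From functions to functionals. Boundedness on atoms alone does not make a functional well defined on
sums of atoms. So `ℓ_f` is obtained as a pointwise limit of continuous functionals `L N` on `V` that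
are uniformly bounded on atoms and converge there. Each `L N` may be summed along any decomposition,
and since `p ≤ 1` the coefficients lie in `ℓ¹` and dominate the series. Hence the limit exists, is
linear, and obeys the bound given by every decomposition (`exists_dual_of_tendsto`). For `p < 1`,
`f` agrees a.e. with a Lipschitz function (`exists_isLipBound`), and evaluation at it serves for
every `N`. For `p = 1`, the `L N` are pairings with truncations of `f`; their uniform bound on atoms
comes from the John-Nirenberg inequality (`IsMCBound.measure_lt_le`), where `q > 1` enters.

Surjectivity. Duality of `L^q` over balls would not produce a function when `q = ∞`. Instead, every
bounded functional is shown to be order continuous, for all `q` at once. A Calderón-Zygmund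
decomposition at height `lam` writes the indicator of a small set `E` as a sum of mean-zero
functions on balls of total measure at most a constant times `μ(E)/lam`, plus an error of size at
most a constant times `lam` (`exists_atomic_split`). Thus `E ↦ ℓ(1_E)`, suitably recentred, is an
absolutely continuous complex measure on each ball, and the Radon-Nikodym theorem yields `f`
(`exists_density`, `IsAmbient.exists_function`).

Uniqueness. Tails of atomic decompositions tend to zero in quasi-norm, and for `q < ∞` atoms are
approximated by bounded functions with the same cancellation (`IsAmbient.dual_eq_zero`). -/

theorem norm_setAverage_sub_mul_le {X E : Type*} [MeasurableSpace X] {μ : Measure X}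
    [NormedAddCommGroup E] [NormedSpace ℝ E]
    [CompleteSpace E] {f : X → E} {s t : Set X} (hst : s ⊆ t) (hf : IntegrableOn f t μ)
    (ht : μ t < ∞) (c : E) :
    ‖(⨍ z in s, f z ∂μ) - c‖ * μ.real s ≤ ∫ z in t, ‖f z - c‖ ∂μ := by
  have hs : μ s < ∞ := (measure_mono hst).trans_lt ht
  have hc : ∀ {u : Set X}, μ u < ∞ → IntegrableOn (fun _ => c) u μ := fun hu =>
    integrableOn_const hu.ne
  have h1 : μ.real s • ((⨍ z in s, f z ∂μ) - c) = ∫ z in s, (f z - c) ∂μ := by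
    rw [integral_sub (hf.mono_set hst) (hc hs), smul_sub, measure_smul_setAverage _ hs.ne]
    simp
  have h2 : ‖(⨍ z in s, f z ∂μ) - c‖ * μ.real s = ‖∫ z in s, (f z - c) ∂μ‖ := by
    rw [← h1, norm_smul, Real.norm_of_nonneg measureReal_nonneg, mul_comm]
  rw [h2]
  refine (norm_integral_le_integral_norm _).trans (setIntegral_mono_set ?_ ?_ hst.eventuallyLE)
  · exact (hf.sub (hc ht)).norm
  · exact ae_of_all _ fun _ => norm_nonneg _

/-! ### Doubling measures: countability, differentiation, stopping-time coverings -/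

section Doubling

variable {X : Type*} [MetricSpace X] [MeasurableSpace X]

/-- The doubling condition with constant `A`, in terms of the real-valued measure. -/
structure IsDoublingWith (μ : Measure X) (A : ℝ) : Prop where
  one_le : 1 ≤ A
  pos : ∀ (x : X) (r : ℝ), 0 < r → 0 < μ.real (Metric.ball x r)
  lt_top : ∀ (x : X) (r : ℝ), μ (Metric.ball x r) < ∞
  le : ∀ (x : X) (r : ℝ), 0 < r → μ.real (Metric.ball x (2 * r)) ≤ A * μ.real (Metric.ball x r)

theorem IsHomogeneousType.exists_isDoublingWith {μ : Measure X} (hμ : IsHomogeneousType μ) :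
    ∃ A, IsDoublingWith μ A := by
  obtain ⟨A, hA, h⟩ := hμ.doubling
  have hfin : ∀ (x : X) (r : ℝ), μ (Metric.ball x r) < ∞ := fun x r => by
    rcases le_or_gt r 0 with hr | hr
    · simp [Metric.ball_eq_empty.2 hr]
    · exact hμ.finite x r hr
  refine ⟨A, hA, fun x r hr => ENNReal.toReal_pos (hμ.pos x r hr).ne' (hfin x r).ne, hfin,
    fun x r hr => ?_⟩
  have h1 := ENNReal.toReal_mono (ENNReal.mul_ne_top ENNReal.ofReal_ne_top (hfin x r).ne) (h x r hr)
  rwa [ENNReal.toReal_mul, ENNReal.toReal_ofReal (by linarith)] at h1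

namespace IsDoublingWith

variable {μ : Measure X} {A : ℝ}

theorem pos' (h : IsDoublingWith μ A) : 0 < A := lt_of_lt_of_le one_pos h.one_le

theorem real_mono (h : IsDoublingWith μ A) {s : Set X} {x : X} {r : ℝ}
    (hs : s ⊆ Metric.ball x r) : μ.real s ≤ μ.real (Metric.ball x r) :=
  measureReal_mono hs (h.lt_top x r).ne

theorem le_pow (h : IsDoublingWith μ A) (x : X) {r : ℝ} (hr : 0 < r) (n : ℕ) :
    μ.real (Metric.ball x (2 ^ n * r)) ≤ A ^ n * μ.real (Metric.ball x r) := by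
  induction n with
  | zero => simp
  | succ n ih =>
    rw [pow_succ', mul_assoc, pow_succ', mul_assoc]
    exact (h.le x _ (by positivity)).trans (mul_le_mul_of_nonneg_left ih h.pos'.le)

theorem real_le (h : IsDoublingWith μ A) {s : Set X} {x : X} {r : ℝ} (hr : 0 < r) (n : ℕ)
    (hs : s ⊆ Metric.ball x (2 ^ n * r)) : μ.real s ≤ A ^ n * μ.real (Metric.ball x r) :=
  (h.real_mono hs).trans (h.le_pow x hr n)

theorem measure_pos (h : IsDoublingWith μ A) (x : X) {r : ℝ} (hr : 0 < r) :
    0 < μ (Metric.ball x r) := by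
  have := h.pos x r hr
  rw [Measure.real, ENNReal.toReal_pos_iff] at this
  exact this.1

theorem measure_lt_top_of_subset (h : IsDoublingWith μ A) {s : Set X} {x : X} {r : ℝ}
    (hs : s ⊆ Metric.ball x r) : μ s < ∞ := (measure_mono hs).trans_lt (h.lt_top x r)

theorem measure_closedBall_lt_top (h : IsDoublingWith μ A) (x : X) (r : ℝ) :
    μ (Metric.closedBall x r) < ∞ :=
  h.measure_lt_top_of_subset (Metric.closedBall_subset_ball (lt_add_one r))

theorem real_closedBall_le (h : IsDoublingWith μ A) (x : X) {r : ℝ} (hr : 0 < r) :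
    μ.real (Metric.closedBall x r) ≤ A * μ.real (Metric.ball x r) :=
  (h.real_mono (Metric.closedBall_subset_ball (by linarith : r < 2 * r))).trans (h.le x r hr)

theorem sigmaFinite (h : IsDoublingWith μ A) : SigmaFinite μ := by
  rcases isEmpty_or_nonempty X with hX | ⟨⟨x⟩⟩
  · exact ⟨⟨⟨fun _ => ∅, fun _ => trivial, fun _ => by simp, by ext y; exact hX.elim y⟩⟩⟩
  · exact ⟨⟨⟨fun n => Metric.ball x n, fun _ => trivial, fun _ => h.lt_top _ _,
      Metric.iUnion_ball_nat x⟩⟩⟩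

theorem isLocallyFiniteMeasure (h : IsDoublingWith μ A) : IsLocallyFiniteMeasure μ :=
  ⟨fun x => ⟨Metric.ball x 1, Metric.ball_mem_nhds x one_pos, h.lt_top x 1⟩⟩

theorem isUnifLocDoublingMeasure (h : IsDoublingWith μ A) : IsUnifLocDoublingMeasure μ := by
  refine ⟨⟨(A ^ 2).toNNReal, ?_⟩⟩
  filter_upwards [self_mem_nhdsWithin] with r hr x
  have hr : 0 < r := hr
  have h1 : μ.real (Metric.closedBall x (2 * r)) ≤ A ^ 2 * μ.real (Metric.closedBall x r) :=
    (h.real_le hr 2 (Metric.closedBall_subset_ball (by linarith))).trans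
      (mul_le_mul_of_nonneg_left (measureReal_mono Metric.ball_subset_closedBall
        (h.measure_closedBall_lt_top x r).ne) (by positivity))
  rw [← ENNReal.ofReal_toReal (h.measure_closedBall_lt_top x (2 * r)).ne,
    ← ENNReal.ofReal_toReal (h.measure_closedBall_lt_top x r).ne]
  refine (ENNReal.ofReal_le_ofReal h1).trans_eq ?_
  rw [ENNReal.ofReal_mul (by positivity)]
  rfl

/-- A σ-finite measure admits only countably many disjoint measurable sets of positive measure. This
replaces a separability assumption on `X`, and separability is then deduced from it. -/
theorem countable_of_disjoint_ball [BorelSpace X] (h : IsDoublingWith μ A) {u : Set X} {r : X → ℝ}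
    (hr : ∀ x ∈ u, 0 < r x) (hu : u.PairwiseDisjoint fun x => Metric.ball x (r x)) :
    u.Countable := by
  have := h.sigmaFinite
  have h1 := Measure.countable_meas_pos_of_disjoint_iUnion (μ := μ)
    (As := fun x : u => Metric.ball (x : X) (r x)) (fun _ => Metric.isOpen_ball.measurableSet)
    (fun x y hxy => hu x.2 y.2 (fun he => hxy (Subtype.ext he)))
  have h2 : {i : u | 0 < μ (Metric.ball (i : X) (r i))} = Set.univ :=
    Set.eq_univ_of_forall fun x => h.measure_pos _ (hr _ x.2)
  rw [h2, Set.countable_univ_iff] at h1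
  exact Set.countable_coe_iff.1 h1

/-- A Vitali family of disjoint balls of radius `ε / 5` is countable, and its fivefold enlargements
cover `X`, so the centres are `ε`-dense. -/
theorem secondCountableTopology [BorelSpace X] (h : IsDoublingWith μ A) :
    SecondCountableTopology X := by
  refine Metric.secondCountable_of_almost_dense_set fun ε hε => ?_
  obtain ⟨u, -, hu, hcov⟩ := Vitali.exists_disjoint_subfamily_covering_enlargement_closedBall
    (Set.univ : Set X) (fun x => x) (fun _ => ε / 5) (ε / 5) (fun _ _ => le_rfl) 5 (by norm_num)
  refine ⟨u, h.countable_of_disjoint_ball (r := fun _ => ε / 5) (fun _ _ => by positivity)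
    (hu.mono fun x => Metric.ball_subset_closedBall), fun x => ?_⟩
  obtain ⟨b, hb, hxb⟩ := hcov x trivial
  refine ⟨b, hb, ?_⟩
  have := hxb (Metric.mem_closedBall_self (by positivity))
  rw [Metric.mem_closedBall] at this
  linarith

end IsDoublingWith

variable {μ : Measure X} {A : ℝ}

theorem locallyIntegrable_of_integrableOn_ball {E : Type*} [NormedAddCommGroup E] {f : X → E}
    (hf : ∀ (x : X) (r : ℝ), 0 < r → IntegrableOn f (Metric.ball x r) μ) :
    LocallyIntegrable f μ :=
  fun x => ⟨Metric.ball x 1, Metric.ball_mem_nhds x one_pos, hf x 1 one_pos⟩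

/-- **Lebesgue differentiation** along open balls in a doubling space. -/
theorem IsDoublingWith.ae_tendsto_setAverage_ball [BorelSpace X] (h : IsDoublingWith μ A)
    {E : Type*} [NormedAddCommGroup E] [NormedSpace ℝ E] [CompleteSpace E] {f : X → E}
    (hf : ∀ (x : X) (r : ℝ), 0 < r → IntegrableOn f (Metric.ball x r) μ) :
    ∀ᵐ x ∂μ, Tendsto (fun r => ⨍ y in Metric.ball x r, f y ∂μ) (𝓝[>] 0) (𝓝 (f x)) := by
  have := h.isLocallyFiniteMeasure
  have := h.isUnifLocDoublingMeasure
  have := h.secondCountableTopology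
  filter_upwards [IsUnifLocDoublingMeasure.ae_tendsto_average_norm_sub μ
    (locallyIntegrable_of_integrableOn_ball hf) 1] with x hx
  have h1 := hx (fun _ : ℝ => x) (fun r => r) tendsto_id (by
    filter_upwards [self_mem_nhdsWithin] with r hr
    exact Metric.mem_closedBall_self (by simpa using le_of_lt hr))
  rw [tendsto_iff_norm_sub_tendsto_zero]
  refine squeeze_zero' (Eventually.of_forall fun _ => norm_nonneg _) ?_
    (by simpa using h1.const_mul A)
  filter_upwards [self_mem_nhdsWithin] with r hr
  have hr : 0 < r := hr
  have hsub : Metric.closedBall x r ⊆ Metric.ball x (2 * r) :=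
    Metric.closedBall_subset_ball (by linarith)
  -- Differentiation is known along closed balls. Passing to open balls costs the ratio of the two
  -- measures, which is at most `A`.
  have h2 := norm_setAverage_sub_mul_le Metric.ball_subset_closedBall
    ((hf x (2 * r) (by linarith)).mono_set hsub) (h.measure_closedBall_lt_top x r) (f x)
  rw [setAverage_eq μ (fun y => ‖f y - f x‖), smul_eq_mul]
  have hp := h.pos x r hr
  have hq : 0 < μ.real (Metric.closedBall x r) :=
    hp.trans_le (measureReal_mono Metric.ball_subset_closedBall
        (h.measure_closedBall_lt_top x r).ne)
  set I := ∫ y in Metric.closedBall x r, ‖f y - f x‖ ∂μ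
  have hI : 0 ≤ I := integral_nonneg fun _ => norm_nonneg _
  have hle := h.real_closedBall_le x hr
  rw [← le_div_iff₀ hp] at h2
  refine h2.trans ?_
  rw [div_le_iff₀ hp, mul_assoc, mul_assoc, inv_mul_eq_div, mul_div_assoc', le_div_iff₀ hq]
  nlinarith [mul_le_mul_of_nonneg_left hle hI]

/-- A **Calderón-Zygmund stopping time covering**: the points of `S` where `w` exceeds `lam` are
covered by dilates of disjoint balls on which `w` has average above `lam`, while the average over
the dilates is at most `lam`. -/
theorem IsDoublingWith.exists_stopping_balls [BorelSpace X] [Nonempty X] (h : IsDoublingWith μ A)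
    {w : X → ℝ} (hw : ∀ (x : X) (r : ℝ), 0 < r → IntegrableOn w (Metric.ball x r) μ)
    {S : Set X} {ρ lam : ℝ} (hρ : 0 < ρ)
    (hS : ∀ x ∈ S, ∫ y in Metric.ball x ρ, w y ∂μ ≤ lam * μ.real (Metric.ball x ρ)) :
    ∃ (T : Set ℕ) (c : ℕ → X) (r : ℕ → ℝ),
      (∀ n ∈ T, c n ∈ S ∧ 0 < r n ∧ 8 * r n ≤ ρ ∧
        lam * μ.real (Metric.ball (c n) (r n)) < ∫ y in Metric.ball (c n) (r n), w y ∂μ ∧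
        ∫ y in Metric.ball (c n) (8 * r n), w y ∂μ ≤
          lam * μ.real (Metric.ball (c n) (8 * r n))) ∧
      (T.PairwiseDisjoint fun n => Metric.ball (c n) (r n)) ∧
      ∀ᵐ x ∂μ, x ∈ S → lam < w x → ∃ n ∈ T, x ∈ Metric.ball (c n) (8 * r n) := by
  classical
  -- Candidate radii are `ρ / 8 ^ k`; `rad x` is the largest one over which the average of `w`
  -- exceeds `lam`.
  let bad : X → ℕ → Prop := fun x k =>
    lam * μ.real (Metric.ball x (ρ / 8 ^ k)) < ∫ y in Metric.ball x (ρ / 8 ^ k), w y ∂μ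
  let t : Set X := {x | x ∈ S ∧ ∃ k, bad x k}
  let rad : X → ℝ := fun x => if hx : ∃ k, bad x k then ρ / 8 ^ (Nat.find hx) else 0
  have hrad : ∀ x ∈ t, 0 < rad x ∧ 8 * rad x ≤ ρ ∧
      lam * μ.real (Metric.ball x (rad x)) < ∫ y in Metric.ball x (rad x), w y ∂μ ∧
      ∫ y in Metric.ball x (8 * rad x), w y ∂μ ≤ lam * μ.real (Metric.ball x (8 * rad x)) := by
    rintro x ⟨hxS, hx⟩
    have hr : rad x = ρ / 8 ^ (Nat.find hx) := dif_pos hx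
    have hspec : bad x (Nat.find hx) := Nat.find_spec hx
    -- The scale `ρ` itself is good by `hS`, so a preceding scale exists. It is `8 * rad x`, and by
    -- minimality the average there is at most `lam`.
    obtain ⟨k, hk⟩ : ∃ k, Nat.find hx = k + 1 := by
      refine Nat.exists_eq_succ_of_ne_zero fun h0 => ?_
      rw [h0] at hspec
      have := hS x hxS
      simp only [bad, pow_zero, div_one] at hspec
      linarith
    have h8 : 8 * rad x = ρ / 8 ^ k := by
      rw [hr, hk, pow_succ]
      field_simp
    have hmin : ¬ bad x k := Nat.find_min hx (by omega)
    refine ⟨by rw [hr]; positivity, ?_, by rw [hr]; exact hspec, by rw [h8]; exact not_lt.1 hmin⟩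
    rw [h8]
    exact div_le_self hρ.le (one_le_pow₀ (by norm_num))
  -- The ratio of scales is `8` because the fivefold closed balls of the Vitali lemma must fit into
  -- the parent open balls; being `2 ^ 3`, it costs `A ^ 3` in measure.
  obtain ⟨u, hut, hu, hcov⟩ := Vitali.exists_disjoint_subfamily_covering_enlargement_closedBall
    t (fun x => x) rad ρ (fun x hx => by linarith [(hrad x hx).1, (hrad x hx).2.1]) 5 (by norm_num)
  have hu' : u.PairwiseDisjoint fun x => Metric.ball x (rad x) :=
    hu.mono fun x => Metric.ball_subset_closedBall
  have hcount := h.countable_of_disjoint_ball (fun x hx => (hrad x (hut hx)).1) hu'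
  obtain ⟨e, he⟩ := hcount.exists_injective_nat
  let c : ℕ → X := Function.extend e (fun i : u => (i : X)) (fun _ => Classical.arbitrary X)
  have hc : ∀ i : u, c (e i) = i := fun i => he.extend_apply _ _ i
  refine ⟨Set.range e, c, fun n => rad (c n), ?_, ?_, ?_⟩
  · rintro _ ⟨i, rfl⟩
    simp only [hc]
    exact ⟨(hut i.2).1, hrad i (hut i.2)⟩
  · rintro _ ⟨i, rfl⟩ _ ⟨j, rfl⟩ hij
    have hne : (i : X) ≠ j := fun hij' => hij (by rw [Subtype.ext hij'])
    simpa only [Function.onFun, hc] using hu' i.2 j.2 hne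
  · filter_upwards [h.ae_tendsto_setAverage_ball hw] with x hx hxS hlt
    have hlim : Tendsto (fun k : ℕ => ρ / 8 ^ k) atTop (𝓝[>] 0) := by
      refine tendsto_nhdsWithin_iff.2 ⟨?_, Eventually.of_forall fun k => by
        simp only [Set.mem_Ioi]; positivity⟩
      have := (tendsto_pow_atTop_nhds_zero_of_lt_one (r := (1 / 8 : ℝ)) (by norm_num)
        (by norm_num)).const_mul ρ
      simpa [div_eq_mul_inv] using this
    obtain ⟨k, hk⟩ := ((hx.comp hlim).eventually_const_lt hlt).exists
    have hkpos := h.pos x (ρ / 8 ^ k) (by positivity)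
    have hxt : x ∈ t := by
      refine ⟨hxS, k, ?_⟩
      simp only [Function.comp_apply, setAverage_eq, smul_eq_mul] at hk
      rwa [lt_inv_mul_iff₀ hkpos, mul_comm] at hk
    obtain ⟨b, hb, hxb⟩ := hcov x hxt
    refine ⟨e ⟨b, hb⟩, ⟨_, rfl⟩, ?_⟩
    simp only [hc]
    have hpos := (hrad b (hut hb)).1
    exact Metric.closedBall_subset_ball (by linarith)
      (hxb (Metric.mem_closedBall_self (hrad x hxt).1.le))

end Doubling

/-! ### From mean oscillation to Lipschitz bounds -/

section Oscillation

variable {X : Type*} [MetricSpace X] [MeasurableSpace X]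

/-- `M` bounds the mean oscillation of `f` over all balls, and its mean size over the balls of
`D`, in the scaling of `ℰ^{α,1}_D`. -/
structure IsMCBound (μ : Measure X) (D : Set (Ball X)) (α : ℝ) (f : X → ℂ) (M : ℝ) : Prop where
  nonneg : 0 ≤ M
  integrableOn : ∀ (x : X) (r : ℝ), 0 < r → IntegrableOn f (Metric.ball x r) μ
  osc : ∀ (x : X) (r : ℝ), 0 < r →
    ∫ y in Metric.ball x r, ‖f y - ⨍ z in Metric.ball x r, f z ∂μ‖ ∂μ ≤
      M * μ.real (Metric.ball x r) ^ (1 + α)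
  size : ∀ B ∈ D, ∫ y in B.set, ‖f y‖ ∂μ ≤ M * μ.real B.set ^ (1 + α)

variable {μ : Measure X} {A : ℝ} {D : Set (Ball X)} {α : ℝ} {f : X → ℂ} {M : ℝ}

namespace IsMCBound

theorem norm_average_sub_average_le (hf : IsMCBound μ D α f M) (h : IsDoublingWith μ A)
    {x y : X} {s r c : ℝ} (hs : 0 < s) (hsub : Metric.ball y s ⊆ Metric.ball x r)
    (hc : μ.real (Metric.ball x r) ≤ c * μ.real (Metric.ball y s)) (hr : 0 < r) :
    ‖(⨍ z in Metric.ball y s, f z ∂μ) - ⨍ z in Metric.ball x r, f z ∂μ‖ ≤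
      c * M * μ.real (Metric.ball x r) ^ α := by
  have hp := h.pos y s hs
  have hpr := h.pos x r hr
  have h1 := (norm_setAverage_sub_mul_le hsub (hf.integrableOn x r hr) (h.lt_top x r)
    (⨍ z in Metric.ball x r, f z ∂μ)).trans (hf.osc x r hr)
  rw [← le_div_iff₀ hp] at h1
  refine h1.trans ?_
  rw [div_le_iff₀ hp, Real.rpow_add hpr, Real.rpow_one]
  have h2 : 0 ≤ M * μ.real (Metric.ball x r) ^ α := mul_nonneg hf.nonneg (by positivity)
  nlinarith [mul_le_mul_of_nonneg_left hc h2]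

/-- Averages over concentric balls differ by at most the oscillation at the larger scale. -/
theorem norm_average_concentric_le (hf : IsMCBound μ D α f M) (h : IsDoublingWith μ A)
    (hα : 0 < α) (x : X) {s r : ℝ} (hs : 0 < s) (hsr : s ≤ r) :
    ‖(⨍ z in Metric.ball x s, f z ∂μ) - ⨍ z in Metric.ball x r, f z ∂μ‖ ≤
      2 * A / (1 - (1 / 2 : ℝ) ^ α) * M * μ.real (Metric.ball x r) ^ α := by
  have hA := h.pos'
  set θ : ℝ := (1 / 2 : ℝ) ^ α with hθ
  have hθ0 : 0 < θ := by positivity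
  have hθ1 : θ < 1 := Real.rpow_lt_one (by norm_num) (by norm_num) hα
  set K := 2 * A / (1 - θ) with hK
  -- `K` is the fixed point of the recursion below: one comparison costs `2 * A`, and the remaining
  -- error shrinks by `θ` each time the measure halves.
  have hKeq : K = 2 * A + K * θ := by
    rw [hK]
    field_simp [(sub_pos.2 hθ1).ne']
    ring
  have hK0 : 0 ≤ K := div_nonneg (by positivity) (sub_pos.2 hθ1).le
  have hK2 : 2 * A ≤ K := by nlinarith
  obtain ⟨n, hn⟩ : ∃ n : ℕ, r ≤ 2 ^ n * s := by
    obtain ⟨n, hn⟩ := pow_unbounded_of_one_lt (r / s) (one_lt_two)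
    exact ⟨n, ((div_lt_iff₀ hs).1 hn).le⟩
  induction n generalizing r with
  | zero =>
    have : s = r := le_antisymm hsr (by simpa using hn)
    subst this
    simp only [sub_self, norm_zero]
    have := hf.nonneg
    positivity
  | succ n ih =>
    have hr : 0 < r := hs.trans_le hsr
    have hp := h.pos x r hr
    have hM := hf.nonneg
    by_cases hcase : μ.real (Metric.ball x r) ≤ 2 * A * μ.real (Metric.ball x s)
    · refine (hf.norm_average_sub_average_le h hs (Metric.ball_subset_ball hsr) hcase hr).trans ?_
      gcongr
    · push Not at hcase
      -- Halving the radius need not shrink the measure by a definite factor, so a sum over dyadic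
      -- radii may fail to converge. The next ball is instead the first dyadic one with at most half
      -- the measure. By doubling, its measure is still comparable to that of the large ball, with
      -- constant `2 * A`.
      have hex : ∃ i : ℕ, μ.real (Metric.ball x (r / 2 ^ i)) ≤ μ.real (Metric.ball x r) / 2 := by
        refine ⟨n + 1, ?_⟩
        have h1 : r / 2 ^ (n + 1) ≤ s := by
          rw [div_le_iff₀ (by positivity), mul_comm]; exact hn
        have h2 := h.real_mono (Metric.ball_subset_ball (x := x) h1)
        nlinarith [h.one_le, measureReal_nonneg (μ := μ) (s := Metric.ball x s)]
      classical
      obtain ⟨i, hi⟩ : ∃ i, Nat.find hex = i + 1 := by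
        refine Nat.exists_eq_succ_of_ne_zero fun h0 => ?_
        have := Nat.find_spec hex
        rw [h0] at this
        simp only [pow_zero, div_one] at this
        linarith
      have hsp := Nat.find_spec hex
      rw [hi] at hsp
      have hprev : μ.real (Metric.ball x r) / 2 < μ.real (Metric.ball x (r / 2 ^ i)) :=
        not_le.1 (Nat.find_min hex (by omega))
      have hdouble : μ.real (Metric.ball x (r / 2 ^ i)) ≤
          A * μ.real (Metric.ball x (r / 2 ^ (i + 1))) := by
        have := h.le x (r / 2 ^ (i + 1)) (by positivity)
        rwa [show 2 * (r / 2 ^ (i + 1)) = r / 2 ^ i by rw [pow_succ]; field_simp] at this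
      set r' := r / 2 ^ (i + 1) with hr'
      have hr'0 : 0 < r' := by positivity
      have hr'r : r' ≤ r / 2 := by
        rw [hr']
        refine div_le_div_of_nonneg_left hr.le (by norm_num) ?_
        calc (2 : ℝ) = 2 ^ 1 := by norm_num
          _ ≤ 2 ^ (i + 1) := pow_le_pow_right₀ (by norm_num) (by omega)
      have hcmp : μ.real (Metric.ball x r) ≤ 2 * A * μ.real (Metric.ball x r') := by linarith
      -- Otherwise `hcmp` would make the measures of the two original balls comparable, against
      -- `hcase`.
      have hsr' : s ≤ r' := by
        by_contra hlt
        have := h.real_mono (Metric.ball_subset_ball (x := x) (not_le.1 hlt).le)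
        nlinarith
      have h1 := ih hsr' (by rw [pow_succ'] at hn; linarith)
      have h2 := hf.norm_average_sub_average_le h hr'0
        (Metric.ball_subset_ball (x := x) (by linarith)) hcmp hr
      have h3 : μ.real (Metric.ball x r') ^ α ≤ θ * μ.real (Metric.ball x r) ^ α := by
        rw [hθ, ← Real.mul_rpow (by norm_num) hp.le]
        exact Real.rpow_le_rpow measureReal_nonneg (by linarith) hα.le
      have h4 : K * M * μ.real (Metric.ball x r') ^ α ≤
          K * M * (θ * μ.real (Metric.ball x r) ^ α) :=
        mul_le_mul_of_nonneg_left h3 (by positivity)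
      calc _ ≤ K * M * μ.real (Metric.ball x r') ^ α + 2 * A * M * μ.real (Metric.ball x r) ^ α :=
            (norm_sub_le_norm_sub_add_norm_sub _ _ _).trans (add_le_add h1 h2)
        _ ≤ K * M * (θ * μ.real (Metric.ball x r) ^ α) + 2 * A * M * μ.real (Metric.ball x r) ^ α :=
            by linarith
        _ = (2 * A + K * θ) * M * μ.real (Metric.ball x r) ^ α := by ring
        _ = _ := by rw [← hKeq]

end IsMCBound

theorem IsDoublingWith.tendsto_measureReal_ball [BorelSpace X] (h : IsDoublingWith μ A) {x : X}
    (hx : μ {x} = 0) : Tendsto (fun n : ℕ => μ.real (Metric.ball x (1 / (n + 1)))) atTop (𝓝 0) := by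
  have h1 := tendsto_measure_iInter_atTop (μ := μ)
    (s := fun n : ℕ => Metric.ball x (1 / ((n : ℝ) + 1)))
    (fun n => Metric.isOpen_ball.measurableSet.nullMeasurableSet)
    (fun m n hmn => Metric.ball_subset_ball (one_div_le_one_div_of_le (by positivity)
      (by exact_mod_cast Nat.add_le_add_right hmn 1))) ⟨0, (h.lt_top _ _).ne⟩
  have h2 : ⋂ n : ℕ, Metric.ball x (1 / ((n : ℝ) + 1)) = {x} := by
    ext y
    simp only [Set.mem_iInter, Metric.mem_ball, Set.mem_singleton_iff]
    refine ⟨fun hy => ?_, fun hy n => by rw [hy, dist_self]; positivity⟩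
    by_contra hne
    obtain ⟨n, hn⟩ := exists_nat_one_div_lt (dist_pos.2 hne)
    exact lt_asymm hn (hy n)
  rw [h2, hx] at h1
  exact (ENNReal.tendsto_toReal ENNReal.zero_ne_top).comp h1

/-- For `α > 0`, functions in `ℰ^{α,1}_D` agree almost everywhere with functions in `Lip_D(α)`. -/
theorem IsDoublingWith.exists_isLipBound [BorelSpace X] (h : IsDoublingWith μ A) (hα : 0 < α) :
    ∃ K : ℝ, 0 ≤ K ∧ ∀ (D : Set (Ball X)) (f : X → ℂ) (M : ℝ), IsMCBound μ D α f M →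
      ∃ g : X → ℂ, f =ᵐ[μ] g ∧ IsLipBound μ D α g (K * M) := by
  have hA := h.pos'
  set K₀ := 2 * A / (1 - (1 / 2 : ℝ) ^ α) with hK₀
  have hK₀0 : 0 ≤ K₀ := div_nonneg (by positivity)
    (sub_pos.2 (Real.rpow_lt_one (by norm_num) (by norm_num) hα)).le
  set K₁ := (A ^ 2 + K₀) * (A ^ 2) ^ α with hK₁
  have hK₁0 : 0 ≤ K₁ := by positivity
  refine ⟨2 * K₁ + 1, by positivity, fun D f M hf => ?_⟩
  have hM := hf.nonneg
  let avg : X → ℝ → ℂ := fun x r => ⨍ z in Metric.ball x r, f z ∂μ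
  let ρ : ℕ → ℝ := fun n => 1 / ((n : ℝ) + 1)
  have hρ0 : ∀ n, 0 < ρ n := fun n => by positivity
  have hρlim : Tendsto ρ atTop (𝓝 0) := tendsto_one_div_add_atTop_nhds_zero_nat
  have hρ : Tendsto ρ atTop (𝓝[>] 0) :=
    tendsto_nhdsWithin_iff.2 ⟨hρlim, Eventually.of_forall hρ0⟩
  have hae := h.ae_tendsto_setAverage_ball hf.integrableOn
  -- Averages converge at every point, not only almost everywhere. A point where differentiation
  -- fails belongs to a null set, so small balls around it have measure tending to zero and the
  -- averages are Cauchy. The limit is therefore a representative for which the oscillation bound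
  -- holds pointwise.
  have hex : ∀ x, ∃ c, Tendsto (fun n => avg x (ρ n)) atTop (𝓝 c) := fun x => by
    by_cases hx : Tendsto (fun r => ⨍ y in Metric.ball x r, f y ∂μ) (𝓝[>] 0) (𝓝 (f x))
    · exact ⟨f x, hx.comp hρ⟩
    · have hx0 : μ {x} = 0 := measure_mono_null (Set.singleton_subset_iff.2 hx) hae
      have hlim := (((h.tendsto_measureReal_ball hx0).rpow_const
        (Or.inr hα.le)).const_mul (K₀ * M))
      rw [Real.zero_rpow hα.ne', mul_zero] at hlim
      have hanti : ∀ n m : ℕ, n ≤ m → ρ m ≤ ρ n := fun n m hnm =>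
        one_div_le_one_div_of_le (by positivity) (by exact_mod_cast Nat.add_le_add_right hnm 1)
      refine cauchySeq_tendsto_of_complete (cauchySeq_of_le_tendsto_0' _ (fun n m hnm => ?_) hlim)
      rw [dist_comm, dist_eq_norm]
      exact hf.norm_average_concentric_le h hα x (hρ0 m) (hanti n m hnm)
  choose g hg using hex
  have hfg : f =ᵐ[μ] g := by
    filter_upwards [hae] with x hx
    exact tendsto_nhds_unique (hx.comp hρ) (hg x)
  have hgavg : ∀ x r, 0 < r → ‖g x - avg x r‖ ≤ K₀ * M * μ.real (Metric.ball x r) ^ α :=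
    fun x r hr => by
      refine le_of_tendsto ((hg x).sub_const (avg x r)).norm ?_
      filter_upwards [hρlim.eventually_le_const hr] with n hn
      exact hf.norm_average_concentric_le h hα x (hρ0 n) hn
  -- Pass from `g x` to the average over the ball of radius `2 * r` about `x`, then to the average
  -- over the smaller ball about `z` inside it. Two uses give the oscillation, and one use plus the
  -- bound on the average gives the size; hence the constant `2 * K₁ + 1`.
  have hkey : ∀ z r x, 0 < r → x ∈ Metric.ball z r →
      ‖g x - avg z r‖ ≤ K₁ * M * μ.real (Metric.ball z r) ^ α := fun z r x hr hx => by
    rw [Metric.mem_ball] at hx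
    have h1 : Metric.ball z r ⊆ Metric.ball x (2 * r) :=
      Metric.ball_subset_ball' (by rw [dist_comm]; linarith)
    have h2 : μ.real (Metric.ball x (2 * r)) ≤ A ^ 2 * μ.real (Metric.ball z r) :=
      h.real_le hr 2 (Metric.ball_subset_ball' (by linarith))
    have h3 := hf.norm_average_sub_average_le h hr h1 h2 (by positivity)
    have h4 := hgavg x (2 * r) (by positivity)
    have h5 : μ.real (Metric.ball x (2 * r)) ^ α ≤
        (A ^ 2) ^ α * μ.real (Metric.ball z r) ^ α := by
      rw [← Real.mul_rpow (by positivity) measureReal_nonneg]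
      exact Real.rpow_le_rpow measureReal_nonneg h2 hα.le
    rw [norm_sub_rev] at h3
    calc _ ≤ K₀ * M * μ.real (Metric.ball x (2 * r)) ^ α +
            A ^ 2 * M * μ.real (Metric.ball x (2 * r)) ^ α :=
          (norm_sub_le_norm_sub_add_norm_sub _ _ _).trans (add_le_add h4 h3)
      _ = (A ^ 2 + K₀) * M * μ.real (Metric.ball x (2 * r)) ^ α := by ring
      _ ≤ (A ^ 2 + K₀) * M * ((A ^ 2) ^ α * μ.real (Metric.ball z r) ^ α) :=
          mul_le_mul_of_nonneg_left h5 (by positivity)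
      _ = _ := by rw [hK₁]; ring
  refine ⟨g, hfg, by positivity, fun B _ x hx y hy => ?_, fun B hB => ?_⟩
  · have h1 := hkey _ _ _ B.radius_pos hx
    have h2 := hkey _ _ _ B.radius_pos hy
    rw [norm_sub_rev] at h2
    have h3 : 0 ≤ M * μ.real B.set ^ α := by positivity
    refine (norm_sub_le_norm_sub_add_norm_sub _ (avg B.center B.radius) _).trans
      ((add_le_add h1 h2).trans ?_)
    change K₁ * M * μ.real B.set ^ α + K₁ * M * μ.real B.set ^ α ≤ _
    nlinarith
  · refine (ae_restrict_iff' Metric.isOpen_ball.measurableSet).2 (ae_of_all _ fun x hx => ?_)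
    have h1 := hkey _ _ _ B.radius_pos hx
    have hp := h.pos B.center _ B.radius_pos
    have h2 : ‖avg B.center B.radius‖ ≤ M * μ.real B.set ^ α := by
      have h3 := (norm_setAverage_sub_mul_le subset_rfl
        (hf.integrableOn _ _ B.radius_pos) (h.lt_top B.center B.radius) 0)
      simp only [sub_zero] at h3
      have h4 := h3.trans (hf.size B hB)
      rw [Ball.set, Real.rpow_add hp, Real.rpow_one] at h4
      refine le_of_mul_le_mul_right (h4.trans_eq ?_) hp
      rw [Ball.set]; ring
    have h3 : 0 ≤ M * μ.real B.set ^ α := by positivity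
    have h4 : 0 ≤ K₁ * (M * μ.real B.set ^ α) := by positivity
    have h5 : ‖g x‖ ≤ ‖g x - avg B.center B.radius‖ + ‖avg B.center B.radius‖ := by
      simpa using norm_sub_le_norm_sub_add_norm_sub (g x) (avg B.center B.radius) 0
    change _ ≤ K₁ * M * μ.real B.set ^ α at h1
    nlinarith

end Oscillation

/-! ### The John-Nirenberg inequality and pairing with atoms for `p = 1` -/

section JohnNirenberg

variable {X : Type*} [MetricSpace X] [MeasurableSpace X]
variable {μ : Measure X} {A : ℝ} {D : Set (Ball X)} {f : X → ℂ} {M : ℝ}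

/-- Each dilate costs `A ^ 3`, each stopping ball has measure at most `1 / lam` times its integral
of `w`, and the integrals add up because the stopping balls are disjoint. -/
theorem IsDoublingWith.tsum_measure_dilate_le [BorelSpace X] (h : IsDoublingWith μ A) {w : X → ℝ}
    {U : Set X} (hw : IntegrableOn w U μ) (hw0 : ∀ x, 0 ≤ w x) {lam : ℝ} (hlam : 0 < lam)
    {T : Set ℕ} {c : ℕ → X} {r : ℕ → ℝ}
    (hr : ∀ n ∈ T, 0 < r n) (hU : ∀ n ∈ T, Metric.ball (c n) (r n) ⊆ U)
    (hT : ∀ n ∈ T, lam * μ.real (Metric.ball (c n) (r n)) ≤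
      ∫ y in Metric.ball (c n) (r n), w y ∂μ)
    (hdisj : T.PairwiseDisjoint fun n => Metric.ball (c n) (r n)) :
    ∑' n : T, μ (Metric.ball (c n) (8 * r n)) ≤
      ENNReal.ofReal (A ^ 3 / lam * ∫ y in U, w y ∂μ) := by
  have hA := h.pos'
  have h1 : ∀ n : T, μ (Metric.ball (c n) (8 * r n)) ≤ ENNReal.ofReal (A ^ 3 / lam) *
      ∫⁻ y in Metric.ball (c n) (r n), ENNReal.ofReal (w y) ∂μ := fun n => by
    rw [← ofReal_integral_eq_lintegral_ofReal (hw.mono_set (hU n n.2)) (ae_of_all _ hw0),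
      ← ENNReal.ofReal_mul (by positivity), ← ENNReal.ofReal_toReal (h.lt_top (c n) (8 * r n)).ne]
    refine ENNReal.ofReal_le_ofReal ?_
    have h2 : μ.real (Metric.ball (c n) (8 * r n)) ≤ A ^ 3 * μ.real (Metric.ball (c n) (r n)) :=
      h.real_le (hr n n.2) 3 (by norm_num)
    refine h2.trans ?_
    rw [div_mul_eq_mul_div, le_div_iff₀ hlam, mul_assoc, mul_comm _ lam]
    exact mul_le_mul_of_nonneg_left (hT n n.2) (by positivity)
  refine (ENNReal.tsum_le_tsum h1).trans ?_
  rw [ENNReal.tsum_mul_left, ← lintegral_iUnion (s := fun n : T => Metric.ball (c n) (r n))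
    (fun n => Metric.isOpen_ball.measurableSet)
    (fun m n hmn => hdisj m.2 n.2 (fun he => hmn (Subtype.ext he))),
    ENNReal.ofReal_mul (by positivity), ofReal_integral_eq_lintegral_ofReal hw (ae_of_all _ hw0)]
  exact mul_le_mul_right (lintegral_mono_set (Set.iUnion_subset fun (n : T) => hU n n.2)) _

/-- The **John-Nirenberg inequality** in a doubling space. -/
theorem IsMCBound.measure_lt_le [BorelSpace X] (h : IsDoublingWith μ A)
    (hf : IsMCBound μ D 0 f M) (hM : 0 < M) (k : ℕ) : ∀ (z : X) (R : ℝ), 0 < R →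
      μ {y | y ∈ Metric.ball z R ∧
        2 * (1 + A) * A ^ 4 * M * k < ‖f y - ⨍ u in Metric.ball z R, f u ∂μ‖} ≤
        ENNReal.ofReal ((1 / 2) ^ k) * μ (Metric.ball z R) := by
  have hA := h.pos'
  -- The average of `w` over the doubled ball is at most `(1 + A) * M`. This height is large enough
  -- to start the stopping time on balls of radius `R`, and makes the total measure of the dilates
  -- at most half that of the original ball.
  set lam := 2 * (1 + A) * A ^ 4 * M with hlam
  have hlam0 : 0 < lam := by positivity
  induction k with
  | zero =>
    intro z R _
    simp only [pow_zero, ENNReal.ofReal_one, one_mul]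
    exact measure_mono fun y hy => hy.1
  | succ k ih =>
    intro z R hR
    have : Nonempty X := ⟨z⟩
    set b := ⨍ u in Metric.ball z R, f u ∂μ with hb
    let w : X → ℝ := fun y => ‖f y - b‖
    have hw : ∀ (x : X) (r : ℝ), 0 < r → IntegrableOn w (Metric.ball x r) μ := fun x r hr =>
      ((hf.integrableOn x r hr).sub (integrableOn_const (h.lt_top x r).ne)).norm
    have hw0 : ∀ x, 0 ≤ w x := fun x => norm_nonneg _
    have h2R : 0 < 2 * R := by positivity
    have hμ2 : μ.real (Metric.ball z (2 * R)) ≤ A * μ.real (Metric.ball z R) := h.le z R hR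
    have hW : ∫ y in Metric.ball z (2 * R), w y ∂μ ≤
        (1 + A) * M * μ.real (Metric.ball z (2 * R)) := by
      set b' := ⨍ u in Metric.ball z (2 * R), f u ∂μ with hb'
      have h1 : ‖b - b'‖ ≤ A * M := by
        have := hf.norm_average_sub_average_le h hR
          (Metric.ball_subset_ball (x := z) (by linarith : R ≤ 2 * R)) hμ2 h2R
        simpa using this
      have h2 := hf.osc z (2 * R) h2R
      rw [add_zero, Real.rpow_one] at h2
      have hi : IntegrableOn (fun y => ‖f y - b'‖) (Metric.ball z (2 * R)) μ :=
        ((hf.integrableOn _ _ h2R).sub (integrableOn_const (h.lt_top z (2 * R)).ne)).norm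
      have hic : IntegrableOn (fun _ => A * M) (Metric.ball z (2 * R)) μ :=
        integrableOn_const (h.lt_top z (2 * R)).ne
      have h3 : ∫ y in Metric.ball z (2 * R), w y ∂μ ≤
          ∫ y in Metric.ball z (2 * R), (‖f y - b'‖ + A * M) ∂μ := by
        refine integral_mono (hw _ _ h2R) (hi.add hic) fun y => ?_
        refine (norm_sub_le_norm_sub_add_norm_sub _ b' _).trans ?_
        rw [norm_sub_rev b' b]
        exact add_le_add le_rfl h1
      rw [integral_add hi hic, setIntegral_const, smul_eq_mul] at h3
      nlinarith
    have hS : ∀ x ∈ Metric.ball z R, ∫ y in Metric.ball x R, w y ∂μ ≤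
        lam * μ.real (Metric.ball x R) := fun x hx => by
      rw [Metric.mem_ball] at hx
      have h1 : ∫ y in Metric.ball x R, w y ∂μ ≤ ∫ y in Metric.ball z (2 * R), w y ∂μ :=
        setIntegral_mono_set (hw _ _ h2R) (ae_of_all _ hw0)
          (Metric.ball_subset_ball' (by linarith)).eventuallyLE
      have h2 : μ.real (Metric.ball z (2 * R)) ≤ A ^ 2 * μ.real (Metric.ball x R) :=
        h.real_le hR 2 (Metric.ball_subset_ball' (by rw [dist_comm]; linarith))
      refine h1.trans (hW.trans ((mul_le_mul_of_nonneg_left h2 (by positivity)).trans ?_))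
      rw [← mul_assoc]
      refine mul_le_mul_of_nonneg_right ?_ measureReal_nonneg
      have h3 : A ^ 2 ≤ 2 * A ^ 4 := by nlinarith [one_le_pow₀ h.one_le (n := 2), sq_nonneg A]
      have h4 : 0 < (1 + A) * M := by positivity
      rw [hlam]
      nlinarith
    obtain ⟨T, c, r, hT, hdisj, hcov⟩ := h.exists_stopping_balls hw hR hS
    have hsub : ∀ n ∈ T, ∀ s, s ≤ R → Metric.ball (c n) s ⊆ Metric.ball z (2 * R) :=
      fun n hn s hs => Metric.ball_subset_ball' (by
        have := Metric.mem_ball.1 (hT n hn).1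
        linarith)
    have hsum : ∑' n : T, μ (Metric.ball (c n) (8 * r n)) ≤
        ENNReal.ofReal (1 / 2) * μ (Metric.ball z R) := by
      refine (h.tsum_measure_dilate_le (hw z (2 * R) h2R) hw0 hlam0 (fun n hn => (hT n hn).2.1)
        (fun n hn => hsub n hn _ ?_) (fun n hn => (hT n hn).2.2.2.1.le) hdisj).trans ?_
      · linarith [(hT n hn).2.1, (hT n hn).2.2.1]
      · rw [← ENNReal.ofReal_toReal (h.lt_top z R).ne, ← ENNReal.ofReal_mul (by norm_num)]
        refine ENNReal.ofReal_le_ofReal ?_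
        change _ ≤ 1 / 2 * μ.real (Metric.ball z R)
        rw [div_mul_eq_mul_div, div_le_iff₀ hlam0, hlam]
        have h1 : A ^ 3 * ∫ y in Metric.ball z (2 * R), w y ∂μ ≤
            A ^ 3 * ((1 + A) * M * (A * μ.real (Metric.ball z R))) :=
          mul_le_mul_of_nonneg_left (hW.trans (mul_le_mul_of_nonneg_left hμ2 (by positivity)))
            (by positivity)
        refine h1.trans_eq ?_
        ring
    -- On a stopping dilate the mean of `f` is within `lam` of `b`. A deviation above `lam * (k +
    -- 1)` from `b` is thus a deviation above `lam * k` from the new mean, and the induction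
    -- hypothesis applies on each dilate.
    have hincl : {y | y ∈ Metric.ball z R ∧ lam * ((k + 1 : ℕ) : ℝ) < ‖f y - b‖} ≤ᵐ[μ]
        (⋃ n : T, {y | y ∈ Metric.ball (c n) (8 * r n) ∧
          lam * k < ‖f y - ⨍ u in Metric.ball (c n) (8 * r n), f u ∂μ‖} : Set X) := by
      filter_upwards [hcov] with y hy hyE
      obtain ⟨hyB, hlt⟩ := hyE
      push_cast at hlt
      have hk : 0 ≤ lam * k := by positivity
      obtain ⟨n, hn, hyn⟩ := hy hyB (by change _ < ‖f y - b‖; nlinarith)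
      refine Set.mem_iUnion.2 ⟨⟨n, hn⟩, hyn, ?_⟩
      have h8 : 0 < 8 * r n := by linarith [(hT n hn).2.1]
      have h1 := (norm_setAverage_sub_mul_le subset_rfl (hf.integrableOn (c n) _ h8)
        (h.lt_top (c n) (8 * r n)) b).trans (hT n hn).2.2.2.2
      have h2 := le_of_mul_le_mul_right h1 (h.pos _ _ h8)
      have h3 := norm_sub_le_norm_sub_add_norm_sub (f y)
        (⨍ u in Metric.ball (c n) (8 * r n), f u ∂μ) b
      nlinarith
    calc _ ≤ μ (⋃ n : T, {y | y ∈ Metric.ball (c n) (8 * r n) ∧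
          lam * k < ‖f y - ⨍ u in Metric.ball (c n) (8 * r n), f u ∂μ‖}) := measure_mono_ae hincl
      _ ≤ ∑' n : T, ENNReal.ofReal ((1 / 2) ^ k) * μ (Metric.ball (c n) (8 * r n)) :=
        (measure_iUnion_le _).trans (ENNReal.tsum_le_tsum fun n =>
          ih _ _ (by linarith [(hT n n.2).2.1]))
      _ ≤ ENNReal.ofReal ((1 / 2) ^ k) * (ENNReal.ofReal (1 / 2) * μ (Metric.ball z R)) := by
        rw [ENNReal.tsum_mul_left]
        exact mul_le_mul_right hsum _
      _ = _ := by rw [← mul_assoc, ← ENNReal.ofReal_mul (by positivity), pow_succ]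

/-- A discrete layer-cake bound: the number of `k` with `lam * k < t` is the ceiling of `t / lam`.
-/
theorem ofReal_le_tsum_ite {lam t : ℝ} (hlam : 0 < lam) :
    ENNReal.ofReal t ≤ ENNReal.ofReal lam * ∑' k : ℕ, if lam * k < t then (1 : ℝ≥0∞) else 0 := by
  have h1 : (⌈t / lam⌉₊ : ℝ≥0∞) ≤ ∑' k : ℕ, if lam * k < t then (1 : ℝ≥0∞) else 0 := by
    refine le_trans (le_of_eq ?_) (ENNReal.sum_le_tsum (Finset.range ⌈t / lam⌉₊))
    rw [Finset.sum_congr rfl (g := fun _ => (1 : ℝ≥0∞))]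
    · simp
    · intro k hk
      rw [Finset.mem_range, Nat.lt_ceil, lt_div_iff₀ hlam, mul_comm] at hk
      rw [if_pos hk]
  refine le_trans ?_ (mul_le_mul_right h1 _)
  rw [← ENNReal.ofReal_natCast, ← ENNReal.ofReal_mul hlam.le]
  refine ENNReal.ofReal_le_ofReal ?_
  rw [mul_comm, ← div_le_iff₀ hlam]
  exact Nat.le_ceil _

theorem lintegral_enorm_le_eLpNorm_mul {Y : Type*} [MeasurableSpace Y] {ν : Measure Y} {q : ℝ≥0∞}
    (hq : 1 ≤ q) {a : Y → ℂ} (ha : AEStronglyMeasurable a ν) :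
    ∫⁻ y, ‖a y‖ₑ ∂ν ≤ eLpNorm a q ν * ν Set.univ ^ (1 - (q⁻¹).toReal) := by
  have := eLpNorm_le_eLpNorm_mul_rpow_measure_univ hq ha
  rwa [eLpNorm_one_eq_lintegral_enorm, ENNReal.toReal_one, div_one, one_div,
    ← ENNReal.toReal_inv] at this

theorem toReal_inv_lt_one {q : ℝ≥0∞} (hq : 1 < q) : (q⁻¹).toReal < 1 := by
  have h1 : q⁻¹ < 1 := ENNReal.inv_lt_one.2 hq
  have := (ENNReal.toReal_lt_toReal h1.ne_top ENNReal.one_ne_top).2 h1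
  simpa using this

/-- Slice by the level sets of the oscillation. Hölder's inequality on the `k`-th one gains the
factor `2 ^ (-k (1 - 1/q))`, and the geometric series converges because `q > 1`. The endpoint `q =
∞` needs no separate treatment. -/
theorem IsDoublingWith.exists_lintegral_osc_mul_le [BorelSpace X] (h : IsDoublingWith μ A)
    {q : ℝ≥0∞} (hq : 1 < q) :
    ∃ K : ℝ, 0 ≤ K ∧ ∀ (D : Set (Ball X)) (f : X → ℂ) (M : ℝ), 0 < M → IsMCBound μ D 0 f M →
      ∀ (B : Ball X) (a : X → ℂ), IsSizedOn μ 1 q B a →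
        ∫⁻ y in B.set, ‖f y - ⨍ z in B.set, f z ∂μ‖ₑ * ‖a y‖ₑ ∂μ ≤ ENNReal.ofReal (K * M) := by
  have hA := h.pos'
  set θ : ℝ := 1 - (q⁻¹).toReal with hθ
  have hθ0 : 0 < θ := sub_pos.2 (toReal_inv_lt_one hq)
  set s : ℝ≥0∞ := ENNReal.ofReal (1 / 2) ^ θ with hs
  have hs1 : s < 1 := ENNReal.rpow_lt_one (by
    rw [← ENNReal.ofReal_one]; exact (ENNReal.ofReal_lt_ofReal_iff one_pos).2 (by norm_num)) hθ0
  have hgeo : (1 - s)⁻¹ ≠ ∞ := ENNReal.inv_ne_top.2 (tsub_pos_of_lt hs1).ne'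
  refine ⟨2 * (1 + A) * A ^ 4 * (1 - s)⁻¹.toReal, by positivity, fun D f M hM hf B a ha => ?_⟩
  have hJN := hf.measure_lt_le h hM
  set lam := 2 * (1 + A) * A ^ 4 * M with hlam
  have hlam0 : 0 < lam := by positivity
  set b := ⨍ z in B.set, f z ∂μ with hb
  have hBm : MeasurableSet B.set := Metric.isOpen_ball.measurableSet
  have hB0 : μ B.set ≠ 0 := (h.measure_pos _ B.radius_pos).ne'
  have hBt : μ B.set ≠ ∞ := (h.lt_top _ _).ne
  set ν := μ.restrict B.set with hν
  let F : ℕ → Set X := fun k => {y | lam * k < ‖f y - b‖}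
  have hfm : AEStronglyMeasurable (fun y => ‖f y - b‖) ν :=
    ((hf.integrableOn _ _ B.radius_pos).aestronglyMeasurable.sub aestronglyMeasurable_const).norm
  have hF : ∀ k, NullMeasurableSet (F k) ν := fun k =>
    nullMeasurableSet_lt aemeasurable_const hfm.aemeasurable
  have ham : AEStronglyMeasurable a ν := ha.memLp.1.restrict
  have hpt : ∀ y, ‖f y - b‖ₑ * ‖a y‖ₑ ≤
      ENNReal.ofReal lam * ∑' k : ℕ, (F k).indicator (fun y => ‖a y‖ₑ) y := fun y => by
    have h1 : ∀ k : ℕ, (F k).indicator (fun y => ‖a y‖ₑ) y =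
        (if lam * k < ‖f y - b‖ then (1 : ℝ≥0∞) else 0) * ‖a y‖ₑ := fun k => by
      simp only [F, Set.indicator_apply, Set.mem_ofPred_eq]
      split_ifs <;> simp
    rw [tsum_congr h1, ENNReal.tsum_mul_right, ← mul_assoc, ← ofReal_norm]
    exact mul_le_mul_left (ofReal_le_tsum_ite hlam0) _
  -- The powers of `μ B.set` from the size of the atom and from the measure of the level set cancel,
  -- leaving only the geometric decay.
  have hlevel : ∀ k, ∫⁻ y, (F k).indicator (fun y => ‖a y‖ₑ) y ∂ν ≤ s ^ k := fun k => by
    rw [lintegral_indicator₀ (hF k)]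
    refine (lintegral_enorm_le_eLpNorm_mul hq.le ham.restrict).trans ?_
    have h1 : eLpNorm a q (ν.restrict (F k)) ≤ μ B.set ^ (-θ) := by
      refine (eLpNorm_mono_measure a (Measure.restrict_le_self.trans
        Measure.restrict_le_self)).trans (ha.size.trans_eq ?_)
      congr 1
      rw [hθ]; ring
    have h2 : (ν.restrict (F k)) Set.univ ≤ ENNReal.ofReal ((1 / 2) ^ k) * μ B.set := by
      rw [Measure.restrict_apply_univ, hν, Measure.restrict_apply' hBm]
      refine le_trans (measure_mono fun y hy => ?_) (hJN k B.center B.radius B.radius_pos)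
      exact ⟨hy.2, hy.1⟩
    refine (mul_le_mul' h1 (ENNReal.rpow_le_rpow h2 hθ0.le)).trans_eq ?_
    rw [ENNReal.mul_rpow_of_nonneg _ _ hθ0.le, mul_left_comm, ← ENNReal.rpow_add _ _ hB0 hBt,
      neg_add_cancel, ENNReal.rpow_zero, mul_one, hs, ENNReal.ofReal_pow (by norm_num),
      ← ENNReal.rpow_natCast, ← ENNReal.rpow_mul, mul_comm, ENNReal.rpow_mul,
      ENNReal.rpow_natCast]
  calc _ ≤ ∫⁻ y, ENNReal.ofReal lam * ∑' k : ℕ, (F k).indicator (fun y => ‖a y‖ₑ) y ∂ν :=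
        lintegral_mono hpt
    _ = ENNReal.ofReal lam * ∑' k : ℕ, ∫⁻ y, (F k).indicator (fun y => ‖a y‖ₑ) y ∂ν := by
        rw [lintegral_const_mul' _ _ ENNReal.ofReal_ne_top,
          lintegral_tsum fun k => ham.enorm.indicator₀ (hF k)]
    _ ≤ ENNReal.ofReal lam * ∑' k : ℕ, s ^ k := by
        exact mul_le_mul_right (ENNReal.tsum_le_tsum hlevel) _
    _ = ENNReal.ofReal (2 * (1 + A) * A ^ 4 * (1 - s)⁻¹.toReal * M) := by
        rw [ENNReal.tsum_geometric, ← ENNReal.ofReal_toReal hgeo, ← ENNReal.ofReal_mul hlam0.le,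
          ENNReal.toReal_ofReal ENNReal.toReal_nonneg]
        congr 1
        rw [hlam]; ring

end JohnNirenberg

/-! ### Sized functions, the ambient space, and elementary decompositions -/

theorem support_sub_subset {X : Type*} {s : Set X} {a b : X → ℂ} (ha : Function.support a ⊆ s)
    (hb : Function.support b ⊆ s) : Function.support (a - b) ⊆ s :=
  (Function.support_sub a b).trans (Set.union_subset ha hb)

section Ambient

variable {X : Type*} [MetricSpace X] [MeasurableSpace X]
variable {μ : Measure X} {A : ℝ} {D : Set (Ball X)} {p : ℝ} {q : ℝ≥0∞}

/-- Integrable functions supported in some ball. -/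
def IsIntBdd (μ : Measure X) (a : X → ℂ) : Prop :=
  Integrable a μ ∧ ∃ B : Ball X, Function.support a ⊆ B.set

/-- The cancellation condition for a function supported in `B`. -/
def Cancels (μ : Measure X) (D : Set (Ball X)) (B : Ball X) (a : X → ℂ) : Prop :=
  ∫ x, a x ∂μ = 0 ∨ B ∈ D

/-- `a` is supported in `B` and is at most `c` times as large in `L^q` as an atom. -/
structure HasSize (μ : Measure X) (p : ℝ) (q : ℝ≥0∞) (B : Ball X) (c : ℝ) (a : X → ℂ) : Prop where
  supp : Function.support a ⊆ B.set
  memLp : MemLp a q μ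
  size : eLpNorm a q μ ≤ ENNReal.ofReal c * μ B.set ^ ((q⁻¹).toReal - 1 / p)

theorem IsIntBdd.smul {a : X → ℂ} (c : ℂ) (ha : IsIntBdd μ a) : IsIntBdd μ (c • a) :=
  ⟨ha.1.smul c, ha.2.imp fun _ hB => (Function.support_const_smul_subset c a).trans hB⟩

theorem MemLp.integrable_of_support [BorelSpace X] (h : IsDoublingWith μ A) (hq : 1 ≤ q)
    {B : Ball X} {a : X → ℂ} (ha : MemLp a q μ) (hs : Function.support a ⊆ B.set) :
    Integrable a μ := by
  have : IsFiniteMeasure (μ.restrict B.set) := ⟨by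
    rw [Measure.restrict_apply_univ]; exact h.lt_top _ _⟩
  rw [← integrableOn_iff_integrable_of_support_subset hs]
  exact (ha.restrict B.set).integrable hq

theorem HasSize.integrable [BorelSpace X] (h : IsDoublingWith μ A) (hq : 1 ≤ q)
    {B : Ball X} {c : ℝ} {a : X → ℂ} (ha : HasSize μ p q B c a) : Integrable a μ :=
  MemLp.integrable_of_support h hq ha.memLp ha.supp

theorem HasSize.isIntBdd [BorelSpace X] (h : IsDoublingWith μ A) (hq : 1 ≤ q)
    {B : Ball X} {c : ℝ} {a : X → ℂ} (ha : HasSize μ p q B c a) : IsIntBdd μ a :=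
  ⟨ha.integrable h hq, B, ha.supp⟩

theorem IsSizedOn.hasSize {B : Ball X} {a : X → ℂ} (ha : IsSizedOn μ p q B a) :
    HasSize μ p q B 1 a :=
  ⟨ha.supp, ha.memLp, by simpa using ha.size⟩

theorem HasSize.add (hq : 1 ≤ q) {B : Ball X} {c c' : ℝ} (hc : 0 ≤ c) (hc' : 0 ≤ c')
    {a b : X → ℂ} (ha : HasSize μ p q B c a) (hb : HasSize μ p q B c' b) :
    HasSize μ p q B (c + c') (a + b) := by
  refine ⟨(Function.support_add a b).trans (Set.union_subset ha.supp hb.supp),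
    ha.memLp.add hb.memLp, (eLpNorm_add_le ha.memLp.1 hb.memLp.1 hq).trans ?_⟩
  rw [ENNReal.ofReal_add hc hc', add_mul]
  exact add_le_add ha.size hb.size

theorem HasSize.mono {B : Ball X} {c c' : ℝ} (hcc : c ≤ c') {a : X → ℂ}
    (ha : HasSize μ p q B c a) : HasSize μ p q B c' a :=
  ⟨ha.supp, ha.memLp, ha.size.trans (mul_le_mul_left (ENNReal.ofReal_le_ofReal hcc) _)⟩

theorem HasSize.inv_smul {B : Ball X} {c : ℝ} (hc : 0 < c) {a : X → ℂ}
    (ha : HasSize μ p q B c a) : IsSizedOn μ p q B ((c : ℂ)⁻¹ • a) := by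
  refine ⟨(Function.support_const_smul_subset _ _).trans ha.supp, ha.memLp.const_smul _, ?_⟩
  rw [eLpNorm_const_smul]
  refine (mul_le_mul_right ha.size _).trans_eq ?_
  have h1 : ‖(c : ℂ)⁻¹‖ₑ = (ENNReal.ofReal c)⁻¹ := by
    rw [enorm_inv (by exact_mod_cast hc.ne'), ← ofReal_norm, Complex.norm_real,
      Real.norm_of_nonneg hc.le]
  rw [h1, ← mul_assoc, ENNReal.inv_mul_cancel (by simpa using hc) ENNReal.ofReal_ne_top, one_mul]

theorem HasSize.lintegral_le [BorelSpace X] (h : IsDoublingWith μ A) (hq : 1 ≤ q)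
    {B : Ball X} {c : ℝ} {a : X → ℂ} (ha : HasSize μ p q B c a) :
    ∫⁻ x, ‖a x‖ₑ ∂μ ≤ ENNReal.ofReal c * μ B.set ^ (1 - 1 / p) := by
  have hB0 : μ B.set ≠ 0 := (h.measure_pos _ B.radius_pos).ne'
  have hBt : μ B.set ≠ ∞ := (h.lt_top _ _).ne
  have h1 : ∫⁻ x, ‖a x‖ₑ ∂μ = ∫⁻ x in B.set, ‖a x‖ₑ ∂μ := by
    rw [setLIntegral_eq_of_support_subset]
    intro x hx
    exact ha.supp (by simpa using hx)
  rw [h1]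
  refine (lintegral_enorm_le_eLpNorm_mul hq ha.memLp.1.restrict).trans ?_
  rw [Measure.restrict_apply_univ]
  refine (mul_le_mul_left ((eLpNorm_mono_measure a Measure.restrict_le_self).trans ha.size)
    _).trans_eq ?_
  rw [mul_assoc, ← ENNReal.rpow_add _ _ hB0 hBt]
  congr 2
  ring

/-- Hölder's inequality on `B`. The left side is exactly the norm bound provided by
`IsAmbient.exists_rep`, so atoms have norm at most one in the ambient space, whatever `q` is. -/
theorem HasSize.integral_norm_mul_le [BorelSpace X] (h : IsDoublingWith μ A) (hq : 1 ≤ q)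
    {B : Ball X} {c : ℝ} (hc : 0 ≤ c) {a : X → ℂ} (ha : HasSize μ p q B c a) :
    (∫ x, ‖a x‖ ∂μ) * μ.real B.set ^ (1 / p - 1) ≤ c := by
  have hp := h.pos B.center _ B.radius_pos
  have h1 : ∫ x, ‖a x‖ ∂μ ≤ c * μ.real B.set ^ (1 - 1 / p) := by
    rw [integral_norm_eq_lintegral_enorm (ha.integrable h hq).1]
    refine (ENNReal.toReal_mono ?_ (ha.lintegral_le h hq)).trans_eq ?_
    · exact ENNReal.mul_ne_top ENNReal.ofReal_ne_top (ENNReal.rpow_ne_top_of_ne_zero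
        (h.measure_pos _ B.radius_pos).ne' (h.lt_top _ _).ne)
    · rw [ENNReal.toReal_mul, ENNReal.toReal_ofReal hc, ← ENNReal.toReal_rpow]
      rfl
  refine (mul_le_mul_of_nonneg_right h1 (by positivity)).trans_eq ?_
  rw [mul_assoc, Ball.set, ← Real.rpow_add hp]
  simp

/-- Bounded functions supported in a ball are multiples of atoms. -/
theorem hasSize_of_ae_bound [BorelSpace X] (h : IsDoublingWith μ A) {B : Ball X} {c : ℝ}
    {a : X → ℂ} (hs : Function.support a ⊆ B.set) (ha : AEStronglyMeasurable a μ)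
    (hb : ∀ᵐ x ∂μ, ‖a x‖ ≤ c) : HasSize μ p q B (c * μ.real B.set ^ (1 / p)) a := by
  have hB0 : μ B.set ≠ 0 := (h.measure_pos _ B.radius_pos).ne'
  have hBt : μ B.set ≠ ∞ := (h.lt_top _ _).ne
  have h1 : eLpNorm a q μ ≤ μ B.set ^ (q⁻¹).toReal * ENNReal.ofReal c := by
    rw [← eLpNorm_restrict_eq_of_support_subset hs, ENNReal.toReal_inv]
    refine (eLpNorm_le_of_ae_bound (ae_restrict_of_ae hb)).trans_eq ?_
    rw [Measure.restrict_apply_univ]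
  refine ⟨hs, ⟨ha, h1.trans_lt (ENNReal.mul_lt_top (ENNReal.rpow_lt_top_of_nonneg
    ENNReal.toReal_nonneg hBt) ENNReal.ofReal_lt_top)⟩, h1.trans_eq ?_⟩
  rw [ENNReal.ofReal_mul' (by positivity), Measure.real,
    ENNReal.toReal_rpow, ENNReal.ofReal_toReal (ENNReal.rpow_ne_top_of_ne_zero hB0 hBt),
    mul_assoc, ← ENNReal.rpow_add _ _ hB0 hBt, mul_comm]
  congr 2
  ring

/-- The properties of the ambient space of a Hardy space which the duality argument needs. -/
structure IsAmbient {V : Type*} [NormedAddCommGroup V] [NormedSpace ℂ V] (μ : Measure X)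
    (D : Set (Ball X)) (p : ℝ) (rep : V → (X → ℂ) → Prop) : Prop where
  add : ∀ {v w : V} {a b : X → ℂ}, IsIntBdd μ a → IsIntBdd μ b → rep v a → rep w b →
    rep (v + w) (a + b)
  smul : ∀ (c : ℂ) {v : V} {a : X → ℂ}, IsIntBdd μ a → rep v a → rep (c • v) (c • a)
  unique : ∀ {v w : V} {a : X → ℂ}, rep v a → rep w a → v = w
  exists_rep : ∀ (B : Ball X) (a : X → ℂ), Integrable a μ → Function.support a ⊆ B.set →
    Cancels μ D B a → ∃ v, rep v a ∧ ‖v‖ ≤ (∫ x, ‖a x‖ ∂μ) * μ.real B.set ^ (1 / p - 1)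

variable {V : Type*} [NormedAddCommGroup V] [NormedSpace ℂ V] {rep : V → (X → ℂ) → Prop}

theorem hardyNorm_le {F : V} {lam nu : ℕ → ℂ} (hF : IsAtomicDecomp μ D p q rep F lam nu) :
    hardyNorm μ D p q rep F ≤ ((∑' j, ‖lam j‖ ^ p) + ∑' k, ‖nu k‖ ^ p) ^ (1 / p) := by
  refine csInf_le ⟨0, ?_⟩ ⟨lam, nu, hF, rfl⟩
  rintro c ⟨lam, nu, -, rfl⟩
  have h1 : 0 ≤ ∑' j, ‖lam j‖ ^ p := tsum_nonneg fun j => by positivity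
  have h2 : 0 ≤ ∑' j, ‖nu j‖ ^ p := tsum_nonneg fun j => by positivity
  positivity

namespace IsAmbient

theorem sub (hV : IsAmbient μ D p rep) {v w : V} {a b : X → ℂ} (ha : IsIntBdd μ a)
    (hb : IsIntBdd μ b) (hv : rep v a) (hw : rep w b) : rep (v - w) (a - b) := by
  have := hV.add ha (hb.smul (-1)) hv (hV.smul (-1) hb hw)
  rwa [neg_one_smul, neg_one_smul, ← sub_eq_add_neg, ← sub_eq_add_neg] at this

theorem rep_zero [Nonempty X] (hV : IsAmbient μ D p rep) : rep (0 : V) 0 := by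
  obtain ⟨v, hv, hn⟩ := hV.exists_rep ⟨Classical.arbitrary X, 1, one_pos⟩ 0 (integrable_zero _ _ _)
    (by simp) (Or.inl (by simp))
  have : v = 0 := by simpa using hn
  rwa [← this]

theorem norm_le (hV : IsAmbient μ D p rep) {B : Ball X} {a : X → ℂ} (ha : Integrable a μ)
    (hs : Function.support a ⊆ B.set) (hc : Cancels μ D B a) {v : V} (hv : rep v a) :
    ‖v‖ ≤ (∫ x, ‖a x‖ ∂μ) * μ.real B.set ^ (1 / p - 1) := by
  obtain ⟨w, hw, hn⟩ := hV.exists_rep B a ha hs hc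
  rwa [hV.unique hv hw]

variable [BorelSpace X]

/-- A single normalised term suffices; it is placed among the atoms when the integral vanishes and
among the local atoms when `B ∈ D`. -/
theorem isAtomicDecomp_atom (hp : 0 < p) (h : IsDoublingWith μ A) (hq : 1 ≤ q)
    (hV : IsAmbient μ D p rep) {B : Ball X} {c : ℝ} (hc : 0 < c) {a : X → ℂ}
    (ha : HasSize μ p q B c a) (hcan : Cancels μ D B a) {v : V} (hv : rep v a) :
    ∃ lam nu, IsAtomicDecomp μ D p q rep v lam nu ∧
      ((∑' j, ‖lam j‖ ^ p) + ∑' k, ‖nu k‖ ^ p) ^ (1 / p) = c := by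
  have hc' : (c : ℂ) ≠ 0 := by exact_mod_cast hc.ne'
  have hrep : rep ((c : ℂ)⁻¹ • v) ((c : ℂ)⁻¹ • a) := hV.smul _ (ha.isIntBdd h hq) hv
  have hsz := ha.inv_smul hc
  have h0 : HasSum (fun j => ‖(Pi.single 0 (c : ℂ) : ℕ → ℂ) j‖ ^ p) (c ^ p) := by
    have := hasSum_single (f := fun j => ‖(Pi.single 0 (c : ℂ) : ℕ → ℂ) j‖ ^ p) 0
      (fun j hj => by simp [Pi.single_eq_of_ne hj, hp.ne'])
    simpa [abs_of_pos hc] using this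
  have h0' : HasSum (fun j => ‖(0 : ℕ → ℂ) j‖ ^ p) 0 := by
    simp [hp.ne']
  have hcp : (c ^ p) ^ (1 / p) = c := by
    rw [← Real.rpow_mul hc.le, mul_one_div_cancel hp.ne', Real.rpow_one]
  have hv0 : HasSum (fun j => (Pi.single 0 (c : ℂ) : ℕ → ℂ) j • ((c : ℂ)⁻¹ • v)) v := by
    have := hasSum_single (f := fun j => (Pi.single 0 (c : ℂ) : ℕ → ℂ) j • ((c : ℂ)⁻¹ • v)) 0
      (fun j hj => by simp [Pi.single_eq_of_ne hj])
    simpa [smul_smul, hc'] using this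
  have hv0' : HasSum (fun j => (0 : ℕ → ℂ) j • (0 : V)) 0 := by simp
  rcases hcan with hcan | hcan
  · refine ⟨Pi.single 0 c, 0, ⟨h0.summable, h0'.summable, fun _ => (c : ℂ)⁻¹ • v, fun _ => 0, v, 0,
      fun j _ => ⟨_, ⟨B, hsz, ?_⟩, hrep⟩, fun k hk => absurd rfl hk, hv0, hv0', by simp⟩, ?_⟩
    · simp [integral_const_mul, hcan]
    · rw [h0.tsum_eq, h0'.tsum_eq, add_zero, hcp]
  · refine ⟨0, Pi.single 0 c, ⟨h0'.summable, h0.summable, fun _ => 0, fun _ => (c : ℂ)⁻¹ • v, 0, v,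
      fun k hk => absurd rfl hk, fun j _ => ⟨_, ⟨B, hcan, hsz⟩, hrep⟩, hv0', hv0, by simp⟩, ?_⟩
    rw [h0.tsum_eq, h0'.tsum_eq, zero_add, hcp]

theorem mem_atomicHardy (hp : 0 < p) (h : IsDoublingWith μ A) (hq : 1 ≤ q)
    (hV : IsAmbient μ D p rep) {B : Ball X} {c : ℝ} (hc : 0 < c) {a : X → ℂ}
    (ha : HasSize μ p q B c a) (hcan : Cancels μ D B a) {v : V} (hv : rep v a) :
    v ∈ atomicHardy μ D p hp q rep := by
  obtain ⟨lam, nu, hd, -⟩ := hV.isAtomicDecomp_atom hp h hq hc ha hcan hv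
  exact ⟨lam, nu, hd⟩

theorem hardyNorm_le_of_hasSize (hp : 0 < p) (h : IsDoublingWith μ A) (hq : 1 ≤ q)
    (hV : IsAmbient μ D p rep) {B : Ball X} {c : ℝ} (hc : 0 < c) {a : X → ℂ}
    (ha : HasSize μ p q B c a) (hcan : Cancels μ D B a) {v : V} (hv : rep v a) :
    hardyNorm μ D p q rep v ≤ c := by
  obtain ⟨lam, nu, hd, hs⟩ := hV.isAtomicDecomp_atom hp h hq hc ha hcan hv
  exact (LocHardy.hardyNorm_le hd).trans_eq hs

/-- A series of multiples of atoms with cancellation has an atomic decomposition. -/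
theorem isAtomicDecomp_of_hasSum (hp : 0 < p) (h : IsDoublingWith μ A) (hq : 1 ≤ q)
    (hV : IsAmbient μ D p rep) {c : ℕ → ℝ} (hc0 : ∀ n, 0 ≤ c n) {v : ℕ → V} {F : V}
    (hv0 : ∀ n, c n = 0 → v n = 0)
    (hv : ∀ n, c n ≠ 0 → ∃ (B : Ball X) (a : X → ℂ), HasSize μ p q B (c n) a ∧
      ∫ x, a x ∂μ = 0 ∧ rep (v n) a)
    (hsum : HasSum v F) (hc : Summable fun n => c n ^ p) :
    IsAtomicDecomp μ D p q rep F (fun n => (c n : ℂ)) 0 := by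
  have hn : ∀ n, ‖(c n : ℂ)‖ = c n := fun n => by
    rw [Complex.norm_real, Real.norm_of_nonneg (hc0 n)]
  refine ⟨by simpa only [hn] using hc, by simp [hp.ne', summable_zero], fun n => (c n : ℂ)⁻¹ • v n,
    fun _ => 0, F, 0, fun n hcn => ?_, fun k hk => absurd rfl hk, ?_, by simp, by simp⟩
  · have hcn' : c n ≠ 0 := by exact_mod_cast hcn
    obtain ⟨B, a, ha, hi, hr⟩ := hv n hcn'
    refine ⟨_, ⟨B, ha.inv_smul (lt_of_le_of_ne (hc0 n) hcn'.symm), ?_⟩,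
      hV.smul _ (ha.isIntBdd h hq) hr⟩
    simp [integral_const_mul, hi]
  · convert hsum using 1
    funext n
    by_cases hcn : c n = 0
    · simp [hv0 n hcn]
    · rw [smul_smul, mul_inv_cancel₀ (by exact_mod_cast hcn), one_smul]

end IsAmbient

end Ambient

/-! ### Summability of coefficients for `p ≤ 1` -/

theorem summable_of_summable_rpow {p : ℝ} (hp : 0 < p) (hp1 : p ≤ 1) {x : ℕ → ℝ}
    (hx : ∀ n, 0 ≤ x n) (hs : Summable fun n => x n ^ p) {S : ℝ} (hS : ∑' n, x n ^ p ≤ S) :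
    Summable x ∧ ∑' n, x n ≤ S ^ (1 / p - 1) * ∑' n, x n ^ p := by
  have he : 0 ≤ 1 / p - 1 := by
    rw [sub_nonneg, le_div_iff₀ hp]; linarith
  have h1 : ∀ n, x n ≤ S ^ (1 / p - 1) * x n ^ p := fun n => by
    have h2 : x n ^ p ≤ S := (hs.le_tsum n fun m _ => Real.rpow_nonneg (hx m) p).trans hS
    have h3 : x n = (x n ^ p) ^ (1 / p - 1) * x n ^ p := by
      conv_lhs => rw [← Real.rpow_one (x n), ← mul_one_div_cancel hp.ne', Real.rpow_mul (hx n)]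
      conv_lhs => rw [show 1 / p = (1 / p - 1) + 1 by ring]
      rw [Real.rpow_add_of_nonneg (Real.rpow_nonneg (hx n) p) he zero_le_one, Real.rpow_one]
    calc x n = (x n ^ p) ^ (1 / p - 1) * x n ^ p := h3
      _ ≤ _ := mul_le_mul_of_nonneg_right
        (Real.rpow_le_rpow (Real.rpow_nonneg (hx n) p) h2 he) (Real.rpow_nonneg (hx n) p)
  have h4 := Summable.of_nonneg_of_le hx h1 (hs.mul_left _)
  refine ⟨h4, ?_⟩
  rw [← tsum_mul_left]
  exact h4.tsum_le_tsum h1 (hs.mul_left _)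

theorem summable_of_summable_norm_rpow {p : ℝ} (hp : 0 < p) (hp1 : p ≤ 1) {x : ℕ → ℂ}
    (hs : Summable fun n => ‖x n‖ ^ p) : Summable fun n => ‖x n‖ :=
  (summable_of_summable_rpow hp hp1 (fun n => norm_nonneg (x n)) hs le_rfl).1

/-- The inclusion of `ℓ^p` in `ℓ¹` for the two sequences taken together. The preceding bound is
applied to both with the common majorant `S`, so that the two estimates add up with constant one. -/
theorem tsum_norm_add_tsum_norm_le {p : ℝ} (hp : 0 < p) (hp1 : p ≤ 1) {x y : ℕ → ℂ}
    (hx : Summable fun n => ‖x n‖ ^ p) (hy : Summable fun n => ‖y n‖ ^ p) :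
    ∑' n, ‖x n‖ + ∑' n, ‖y n‖ ≤ (∑' n, ‖x n‖ ^ p + ∑' n, ‖y n‖ ^ p) ^ (1 / p) := by
  have he : 0 ≤ 1 / p - 1 := by
    rw [sub_nonneg, le_div_iff₀ hp]; linarith
  have h1 : 0 ≤ ∑' j, ‖x j‖ ^ p := tsum_nonneg fun j => by positivity
  have h2 : 0 ≤ ∑' j, ‖y j‖ ^ p := tsum_nonneg fun j => by positivity
  set S := ∑' n, ‖x n‖ ^ p + ∑' n, ‖y n‖ ^ p with hS
  have h3 := (summable_of_summable_rpow hp hp1 (fun n => norm_nonneg (x n)) hx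
    (by linarith : _ ≤ S)).2
  have h4 := (summable_of_summable_rpow hp hp1 (fun n => norm_nonneg (y n)) hy
    (by linarith : _ ≤ S)).2
  have h5 : S ^ (1 / p) = S ^ (1 / p - 1) * S := by
    conv_lhs => rw [show 1 / p = (1 / p - 1) + 1 by ring]
    rw [Real.rpow_add_of_nonneg (by positivity) he zero_le_one, Real.rpow_one]
  rw [h5]
  nlinarith

/-! ### Functionals on the Hardy space as limits of functionals on the ambient space -/

section Limits

variable {X : Type*} [MetricSpace X] [MeasurableSpace X]
variable {μ : Measure X} {D : Set (Ball X)} {p : ℝ} {q : ℝ≥0∞} {hp : 0 < p}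
variable {V : Type*} [NormedAddCommGroup V] [NormedSpace ℂ V] {rep : V → (X → ℂ) → Prop}

/-- A sequence of continuous functionals on the ambient space which is bounded on atoms and
converges on atoms induces a bounded functional on the Hardy space. -/
theorem exists_dual_of_tendsto (hp1 : p ≤ 1) (L : ℕ → V →L[ℂ] ℂ) {R : ℝ} (hR : 0 ≤ R)
    (lim : (X → ℂ) → ℂ)
    (hbound : ∀ (v : V) (a : X → ℂ), IsAtom μ p q a ∨ IsLocAtom μ D p q a → rep v a →
      ∀ N, ‖L N v‖ ≤ R)
    (hlim : ∀ (v : V) (a : X → ℂ), IsAtom μ p q a ∨ IsLocAtom μ D p q a ∨ IsBddBddSupp μ a →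
      rep v a → Tendsto (fun N => L N v) atTop (𝓝 (lim a))) :
    ∃ l : hardyDual μ D p hp q rep, (∀ x, ‖l.1 x‖ ≤ R * hardyNorm μ D p q rep (x : V)) ∧
      ∀ (x : atomicHardy μ D p hp q rep) (g : X → ℂ), IsBddBddSupp μ g → rep x g →
        l.1 x = lim g := by
  -- A vector with vanishing coefficient need not represent any atom, hence the case distinction.
  have hterm : ∀ {c : ℂ} {v : V} {P : (X → ℂ) → Prop},
      (∀ a, P a → IsAtom μ p q a ∨ IsLocAtom μ D p q a) →
      (c ≠ 0 → ∃ a, P a ∧ rep v a) →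
      (∀ N, ‖L N (c • v)‖ ≤ R * ‖c‖) ∧ ∃ z, Tendsto (fun N => L N (c • v)) atTop (𝓝 z) := by
    intro c v P hP hv
    by_cases hc : c = 0
    · subst hc
      simp only [zero_smul, map_zero, norm_zero, mul_zero, le_refl, implies_true, true_and]
      exact ⟨0, tendsto_const_nhds⟩
    · obtain ⟨a, ha, hr⟩ := hv hc
      refine ⟨fun N => ?_, c * lim a, ?_⟩
      · rw [map_smul, norm_smul, mul_comm]
        exact mul_le_mul_of_nonneg_right (hbound v a (hP a ha) hr N) (norm_nonneg _)
      · simp only [map_smul, smul_eq_mul]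
        exact (hlim v a ((hP a ha).imp_right Or.inl) hr).const_mul c
  have hmain : ∀ x : V, ∀ lam nu, IsAtomicDecomp μ D p q rep x lam nu →
      (∃ z, Tendsto (fun N => L N x) atTop (𝓝 z)) ∧
      ∀ N, ‖L N x‖ ≤ R * ((∑' j, ‖lam j‖ ^ p) + ∑' k, ‖nu k‖ ^ p) ^ (1 / p) := by
    rintro x lam nu ⟨hlam, hnu, a, b, s, t, ha, hb, hs, ht, rfl⟩
    have h1 := fun j => hterm (fun _ h => Or.inl h) (ha j)
    have h2 := fun k => hterm (fun _ h => Or.inr h) (hb k)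
    have hs1 := (summable_of_summable_norm_rpow hp hp1 hlam).mul_left R
    have hs2 := (summable_of_summable_norm_rpow hp hp1 hnu).mul_left R
    have hLs : ∀ N, L N s = ∑' j, L N (lam j • a j) := fun N => ((L N).hasSum hs).tsum_eq.symm
    have hLt : ∀ N, L N t = ∑' k, L N (nu k • b k) := fun N => ((L N).hasSum ht).tsum_eq.symm
    constructor
    · choose z hz using fun j => (h1 j).2
      choose z' hz' using fun k => (h2 k).2
      refine ⟨∑' j, z j + ∑' k, z' k, ?_⟩
      simp only [map_add, hLs, hLt]
      -- The limit in `N` passes under the sum, with majorant `R * ‖lam j‖`, summable because `p ≤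
      -- 1`.
      exact (tendsto_tsum_of_dominated_convergence hs1 hz
        (Eventually.of_forall fun N j => (h1 j).1 N)).add
        (tendsto_tsum_of_dominated_convergence hs2 hz'
        (Eventually.of_forall fun N j => (h2 j).1 N))
    · intro N
      rw [map_add, hLs, hLt]
      refine (norm_add_le _ _).trans ((add_le_add
        (tsum_of_norm_bounded hs1.hasSum fun j => (h1 j).1 N)
        (tsum_of_norm_bounded hs2.hasSum fun k => (h2 k).1 N)).trans ?_)
      rw [tsum_mul_left, tsum_mul_left, ← mul_add]
      exact mul_le_mul_of_nonneg_left (tsum_norm_add_tsum_norm_le hp hp1 hlam hnu) hR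
  have hex : ∀ x : atomicHardy μ D p hp q rep, ∃ z, Tendsto (fun N => L N x) atTop (𝓝 z) :=
    fun x => by
      obtain ⟨lam, nu, hd⟩ := x.2
      exact (hmain x lam nu hd).1
  choose G hG using hex
  -- The limit depends on the element of `V` only and not on a decomposition of it, so linearity is
  -- inherited from the `L N`.
  let l : Module.Dual ℂ (atomicHardy μ D p hp q rep) :=
    { toFun := G
      map_add' := fun x y => tendsto_nhds_unique (hG (x + y)) (by
        simpa only [Submodule.coe_add, map_add] using (hG x).add (hG y))
      map_smul' := fun c x => tendsto_nhds_unique (hG (c • x)) (by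
        simpa only [Submodule.coe_smul, map_smul, RingHom.id_apply, smul_eq_mul]
          using (hG x).const_mul c) }
  have hl : ∀ x, ‖l x‖ ≤ R * hardyNorm μ D p q rep (x : V) := fun x => by
    have hle : ∀ lam nu, IsAtomicDecomp μ D p q rep (x : V) lam nu →
        ‖l x‖ ≤ R * ((∑' j, ‖lam j‖ ^ p) + ∑' k, ‖nu k‖ ^ p) ^ (1 / p) := fun lam nu hd =>
      le_of_tendsto' (hG x).norm (hmain x lam nu hd).2
    obtain ⟨lam, nu, hd⟩ := x.2
    rcases hR.eq_or_lt with hR0 | hR0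
    · have := hle lam nu hd
      rw [← hR0, zero_mul] at this ⊢
      exact this
    · rw [← div_le_iff₀' hR0]
      refine le_csInf ⟨_, lam, nu, hd, rfl⟩ ?_
      rintro c ⟨lam', nu', hd', rfl⟩
      rw [div_le_iff₀' hR0]
      exact hle lam' nu' hd'
  exact ⟨⟨l, R, hl⟩, hl, fun x g hg hr => tendsto_nhds_unique (hG x)
    (hlim x g (Or.inr (Or.inr hg)) hr)⟩

end Limits

/-! ### Bounded functions determine a functional on the Hardy space -/

section Density

variable {X : Type*} [MetricSpace X] [MeasurableSpace X] [BorelSpace X]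
variable {μ : Measure X} {A : ℝ} {D : Set (Ball X)} {p : ℝ} {q : ℝ≥0∞}

/-- For `q < ∞`, atoms are approximated by bounded functions with the same cancellation. -/
theorem HasSize.exists_bounded_approx (h : IsDoublingWith μ A) (hq : 1 ≤ q) (hq' : q ≠ ∞)
    {B : Ball X} {c : ℝ} {a : X → ℂ} (ha : HasSize μ p q B c a) (hcan : Cancels μ D B a)
    {ε : ℝ} (hε : 0 < ε) :
    ∃ g : X → ℂ, Function.support g ⊆ B.set ∧ MemLp g ∞ μ ∧ Cancels μ D B g ∧
      Cancels μ D B (a - g) ∧ HasSize μ p q B ε (a - g) := by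
  have hB0 : μ B.set ≠ 0 := (h.measure_pos _ B.radius_pos).ne'
  have hBt : μ B.set ≠ ∞ := (h.lt_top _ _).ne
  have hBm : MeasurableSet B.set := Metric.isOpen_ball.measurableSet
  have hBp : 0 < μ.real B.set := h.pos B.center _ B.radius_pos
  obtain ⟨s, hs, hsq⟩ := ha.memLp.exists_simpleFunc_eLpNorm_sub_lt hq'
    (ε := ENNReal.ofReal (ε / 2) * μ B.set ^ ((q⁻¹).toReal - 1 / p)) (by
      refine mul_ne_zero (by simpa using hε) ?_
      exact (ENNReal.rpow_pos (pos_iff_ne_zero.2 hB0) hBt).ne')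
  set g₁ : X → ℂ := B.set.indicator s with hg₁
  have hsupp₁ : Function.support g₁ ⊆ B.set := Set.support_indicator_subset
  have hmem₁ : MemLp g₁ ∞ μ := (s.memLp_top μ).indicator hBm
  have heq : a - g₁ = B.set.indicator (a - ⇑s) := by
    funext x
    by_cases hx : x ∈ B.set
    · simp [hg₁, hx]
    · have : a x = 0 := by
        by_contra h0
        exact hx (ha.supp h0)
      simp [hg₁, hx, this]
  have hsz₁ : HasSize μ p q B (ε / 2) (a - g₁) := by
    refine ⟨support_sub_subset ha.supp hsupp₁, ha.memLp.sub (hsq.indicator hBm), ?_⟩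
    rw [heq]
    exact (eLpNorm_indicator_le _).trans hs.le
  by_cases hD : B ∈ D
  · exact ⟨g₁, hsupp₁, hmem₁, Or.inr hD, Or.inr hD, hsz₁.mono (by linarith)⟩
  have ha0 : ∫ x, a x ∂μ = 0 := hcan.resolve_right hD
  have hai := ha.integrable h hq
  have hgi : Integrable g₁ μ := MemLp.integrable_of_support h le_top hmem₁ hsupp₁
  set m : ℂ := ∫ x, g₁ x ∂μ with hm
  -- Truncation to a simple function destroys the mean; subtracting a constant on `B` restores it.
  -- Since `a` has mean zero, the constant is controlled by the `L¹` norm of `a - g₁`, so the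
  -- correction is no larger than the error already made.
  set k : X → ℂ := B.set.indicator (fun _ => m / μ.real B.set) with hk
  have hksupp : Function.support k ⊆ B.set := Set.support_indicator_subset
  have hkmem : MemLp k ∞ μ := (memLp_top_const _).indicator hBm
  have hki : Integrable k μ := MemLp.integrable_of_support h le_top hkmem hksupp
  have hkint : ∫ x, k x ∂μ = m := by
    rw [hk, integral_indicator hBm, setIntegral_const, Complex.real_smul]
    exact mul_div_cancel₀ _ (by exact_mod_cast hBp.ne')
  have hmle : ‖m‖ ≤ ∫ x, ‖(a - g₁) x‖ ∂μ := by
    have h1 : ∫ x, (a - g₁) x ∂μ = -m := by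
      simp only [Pi.sub_apply]
      rw [integral_sub hai hgi, ha0, zero_sub]
    rw [← norm_neg, ← h1]
    exact norm_integral_le_integral_norm _
  have hksz : HasSize μ p q B (ε / 2) k := by
    refine (hasSize_of_ae_bound h hksupp hkmem.1 (c := ‖m‖ / μ.real B.set)
      (ae_of_all _ fun x => ?_)).mono ?_
    · by_cases hx : x ∈ B.set
      · simp [hk, hx, abs_of_pos hBp]
      · simp only [hk, hx, not_false_eq_true, Set.indicator_of_notMem, norm_zero]
        positivity
    · refine le_trans ?_ (hsz₁.integral_norm_mul_le h hq (by positivity))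
      rw [div_mul_eq_mul_div, mul_div_assoc, ← Real.rpow_sub_one hBp.ne']
      exact mul_le_mul_of_nonneg_right hmle (by positivity)
  have hdiff : a - (g₁ - k) = (a - g₁) + k := by abel
  have hg0 : ∫ x, (g₁ - k) x ∂μ = 0 := by
    simp only [Pi.sub_apply]
    rw [integral_sub hgi hki, hkint, sub_self]
  refine ⟨g₁ - k, support_sub_subset hsupp₁ hksupp, hmem₁.sub hkmem, Or.inl hg0, Or.inl ?_, ?_⟩
  · have : ∫ x, (a - (g₁ - k)) x ∂μ = ∫ x, a x ∂μ - ∫ x, (g₁ - k) x ∂μ :=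
      integral_sub hai (hgi.sub hki)
    rw [this, ha0, hg0, sub_zero]
  · rw [hdiff]
    exact (hsz₁.add hq (by positivity) (by positivity) hksz).mono (by linarith)

variable {V : Type*} [NormedAddCommGroup V] [NormedSpace ℂ V] {rep : V → (X → ℂ) → Prop}
variable {hp : 0 < p}

/-- The error of a bounded approximation is itself a small multiple of an atom, hence small in
quasi-norm. For `q = ∞` there is nothing to approximate. -/
theorem IsAmbient.dual_apply_eq_zero_of_hasSize (h : IsDoublingWith μ A) (hq : 1 ≤ q)
    (hV : IsAmbient μ D p rep) (l : hardyDual μ D p hp q rep)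
    (hl : ∀ (x : atomicHardy μ D p hp q rep) (B : Ball X) (g : X → ℂ),
      Function.support g ⊆ B.set → MemLp g ∞ μ → Cancels μ D B g → rep x g → l.1 x = 0)
    {B : Ball X} {c : ℝ} {a : X → ℂ} (ha : HasSize μ p q B c a) (hcan : Cancels μ D B a)
    (x : atomicHardy μ D p hp q rep) (hx : rep x a) : l.1 x = 0 := by
  by_cases hq' : q = ∞
  · subst hq'
    exact hl x B a ha.supp ha.memLp hcan hx
  obtain ⟨C, hC⟩ := l.2
  by_contra hne
  have hpos : 0 < ‖l.1 x‖ := norm_pos_iff.2 hne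
  -- With this accuracy the functional is bounded by `|C| * ε`, which is less than `‖l.1 x‖`, a
  -- contradiction.
  set ε := ‖l.1 x‖ / (2 * (|C| + 1)) with hε
  have hε0 : 0 < ε := by positivity
  obtain ⟨g, hgs, hgm, hgc, hgc', hgsz⟩ := ha.exists_bounded_approx h hq hq' hcan hε0
  have hgi := MemLp.integrable_of_support h le_top hgm hgs
  obtain ⟨w, hw, -⟩ := hV.exists_rep B g hgi hgs hgc
  have hrep := hV.sub (ha.isIntBdd h hq) ⟨hgi, B, hgs⟩ hx hw
  have hmem := hV.mem_atomicHardy hp h hq hε0 hgsz hgc' hrep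
  have hwmem : w ∈ atomicHardy μ D p hp q rep := by
    have := (atomicHardy μ D p hp q rep).sub_mem x.2 hmem
    rwa [sub_sub_cancel] at this
  have h1 := hl ⟨w, hwmem⟩ B g hgs hgm hgc hw
  have h2 : l.1 x = l.1 ⟨x - w, hmem⟩ := by
    have : (⟨x - w, hmem⟩ : atomicHardy μ D p hp q rep) = x - ⟨w, hwmem⟩ := rfl
    rw [this, map_sub, h1, sub_zero]
  have h3 := hC ⟨x - w, hmem⟩
  have h4 := hV.hardyNorm_le_of_hasSize hp h hq hε0 hgsz hgc' hrep
  have h5 : ‖l.1 x‖ ≤ |C| * ε := by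
    rw [h2]
    refine h3.trans ?_
    exact (mul_le_mul_of_nonneg_right (le_abs_self C) (hardyNorm_nonneg _ _ _ _ _ _)).trans
      (mul_le_mul_of_nonneg_left h4 (abs_nonneg C))
  rw [hε, ← mul_div_assoc, le_div_iff₀ (by positivity)] at h5
  nlinarith [abs_nonneg C]

/-- A bounded functional on the Hardy space is determined by its values on bounded functions. -/
theorem IsAmbient.dual_eq_zero (h : IsDoublingWith μ A) (hq : 1 ≤ q)
    (hV : IsAmbient μ D p rep) (l : hardyDual μ D p hp q rep)
    (hl : ∀ (x : atomicHardy μ D p hp q rep) (B : Ball X) (g : X → ℂ),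
      Function.support g ⊆ B.set → MemLp g ∞ μ → Cancels μ D B g → rep x g → l.1 x = 0) :
    l = 0 := by
  obtain ⟨C, hC⟩ := l.2
  refine Subtype.ext (LinearMap.ext fun x => ?_)
  change l.1 x = 0
  obtain ⟨lam, nu, hlam, hnu, a, b, s, t, ha, hb, hs, ht, hst⟩ := x.2
  -- The kernel of `l` viewed inside `V`, where the atoms and the partial sums live.
  let K : Submodule ℂ V := (LinearMap.ker l.1).map (atomicHardy μ D p hp q rep).subtype
  have hK : ∀ {v : V} {B : Ball X} {a₀ : X → ℂ}, IsSizedOn μ p q B a₀ → Cancels μ D B a₀ →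
      rep v a₀ → v ∈ K := fun {v B a₀} h1 h2 h3 => by
    have hm := hV.mem_atomicHardy hp h hq one_pos h1.hasSize h2 h3
    exact ⟨⟨v, hm⟩, hV.dual_apply_eq_zero_of_hasSize h hq l hl h1.hasSize h2 ⟨v, hm⟩ h3, rfl⟩
  have hKa : ∀ j, lam j • a j ∈ K := fun j => by
    by_cases hj : lam j = 0
    · rw [hj, zero_smul]; exact K.zero_mem
    · obtain ⟨a₀, ⟨B, h1, h2⟩, h3⟩ := ha j hj
      exact K.smul_mem _ (hK h1 (Or.inl h2) h3)
  have hKb : ∀ k, nu k • b k ∈ K := fun k => by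
    by_cases hk : nu k = 0
    · rw [hk, zero_smul]; exact K.zero_mem
    · obtain ⟨b₀, ⟨B, h1, h2⟩, h3⟩ := hb k hk
      exact K.smul_mem _ (hK h2 (Or.inr h1) h3)
  let P : ℕ → V := fun n => ∑ j ∈ Finset.range n, lam j • a j + ∑ k ∈ Finset.range n, nu k • b k
  have hP : ∀ n, P n ∈ K := fun n =>
    K.add_mem (K.sum_mem fun j _ => hKa j) (K.sum_mem fun k _ => hKb k)
  -- Removing a partial sum leaves an element decomposed with the tail coefficients. Convergence in
  -- `V` alone would not suffice; it is the tail of the `ℓ^p` sums that makes the quasi-norm small.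
  have hdec : ∀ n, IsAtomicDecomp μ D p q rep (x - P n) (fun j => lam (j + n))
      (fun k => nu (k + n)) := fun n => by
    refine ⟨(summable_nat_add_iff n).2 hlam, (summable_nat_add_iff n).2 hnu, fun j => a (j + n),
      fun k => b (k + n), s - ∑ j ∈ Finset.range n, lam j • a j,
      t - ∑ k ∈ Finset.range n, nu k • b k, fun j => ha (j + n), fun k => hb (k + n), ?_, ?_, ?_⟩
    · exact (hasSum_nat_add_iff' (f := fun j => lam j • a j) n).2 hs
    · exact (hasSum_nat_add_iff' (f := fun k => nu k • b k) n).2 ht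
    · rw [hst]; simp only [P]; abel
  have hle : ∀ n, ‖l.1 x‖ ≤ |C| *
      ((∑' j, ‖lam (j + n)‖ ^ p) + ∑' k, ‖nu (k + n)‖ ^ p) ^ (1 / p) := fun n => by
    obtain ⟨y, hy, hyP⟩ := hP n
    have h1 : l.1 x = l.1 (x - y) := by
      rw [map_sub, LinearMap.mem_ker.1 hy, sub_zero]
    have h2 : ((x - y : atomicHardy μ D p hp q rep) : V) = x - P n := by
      rw [← hyP]; rfl
    rw [h1]
    refine (hC (x - y)).trans ((mul_le_mul_of_nonneg_right (le_abs_self C)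
      (hardyNorm_nonneg _ _ _ _ _ _)).trans (mul_le_mul_of_nonneg_left ?_ (abs_nonneg C)))
    rw [h2]
    exact hardyNorm_le (hdec n)
  have hlim : Tendsto (fun n => |C| *
      ((∑' j, ‖lam (j + n)‖ ^ p) + ∑' k, ‖nu (k + n)‖ ^ p) ^ (1 / p)) atTop (𝓝 0) := by
    have h1 := ((tendsto_sum_nat_add fun j => ‖lam j‖ ^ p).add
      (tendsto_sum_nat_add fun j => ‖nu j‖ ^ p)).rpow_const (p := 1 / p) (Or.inr (by positivity))
    have h2 := h1.const_mul |C|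
    rwa [add_zero, Real.zero_rpow (by positivity), mul_zero] at h2
  exact norm_le_zero_iff.1 (ge_of_tendsto' hlim hle)

end Density

/-! ### Essentially bounded functions and the Radon-Nikodym theorem -/

theorem exists_ae_norm_le {X : Type*} [MeasurableSpace X] {μ : Measure X} {g : X → ℂ}
    (hg : MemLp g ∞ μ) : ∃ c : ℝ, 0 < c ∧ ∀ᵐ x ∂μ, ‖g x‖ ≤ c := by
  have ht := hg.2
  rw [eLpNorm_exponent_top] at ht
  refine ⟨(eLpNormEssSup g μ).toReal + 1, by positivity, ?_⟩
  filter_upwards [ae_le_eLpNormEssSup (f := g) (μ := μ)] with x hx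
  have := ENNReal.toReal_mono ht.ne hx
  rw [toReal_enorm] at this
  linarith

/-- The essential values lie in a compact disc, which finitely many `ε`-balls around points of a
dense sequence cover; rounding to the nearest of these points gives the simple function. -/
theorem exists_simpleFunc_ae_norm_sub_le {X : Type*} [MeasurableSpace X] {μ : Measure X} {g : X → ℂ}
    (hg : MemLp g ∞ μ) {ε : ℝ} (hε : 0 < ε) :
    ∃ s : SimpleFunc X ℂ, ∀ᵐ x ∂μ, ‖g x - s x‖ ≤ ε := by
  obtain ⟨c, -, hc⟩ := exists_ae_norm_le hg
  let e : ℕ → ℂ := TopologicalSpace.denseSeq ℂ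
  have hcov : Metric.closedBall (0 : ℂ) c ⊆ ⋃ k, Metric.ball (e k) ε := fun z _ => by
    obtain ⟨k, hk⟩ := (TopologicalSpace.denseRange_denseSeq ℂ).exists_dist_lt z hε
    exact Set.mem_iUnion.2 ⟨k, hk⟩
  obtain ⟨t, ht⟩ := (isCompact_closedBall (0 : ℂ) c).elim_finite_subcover _
    (fun k => Metric.isOpen_ball) hcov
  obtain ⟨N, hN⟩ := t.bddAbove
  refine ⟨(SimpleFunc.nearestPt e N).comp (hg.1.mk g) hg.1.stronglyMeasurable_mk.measurable, ?_⟩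
  filter_upwards [hc, hg.1.ae_eq_mk] with x hx hxe
  obtain ⟨k, hk, hxk⟩ := Set.mem_iUnion₂.1 (ht (by simpa using hx : g x ∈ Metric.closedBall 0 c))
  have h1 := SimpleFunc.edist_nearestPt_le e (g x) (hN hk)
  rw [edist_dist, edist_dist, ENNReal.ofReal_le_ofReal_iff dist_nonneg] at h1
  rw [SimpleFunc.coe_comp, Function.comp_apply, ← hxe, ← dist_eq_norm, dist_comm]
  exact h1.trans (by rw [dist_comm]; exact (Metric.mem_ball.1 hxk).le)

/-- The **Radon-Nikodym theorem** for complex measures. -/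
theorem exists_integrable_of_complexMeasure {X : Type*} [MeasurableSpace X] (μ : Measure X)
    [SigmaFinite μ] (m : ComplexMeasure X) (hm : ∀ E, MeasurableSet E → μ E = 0 → m E = 0) :
    ∃ f : X → ℂ, Integrable f μ ∧ ∀ E, MeasurableSet E → m E = ∫ x in E, f x ∂μ := by
  have key : ∀ s : SignedMeasure X, (∀ E, MeasurableSet E → μ E = 0 → s E = 0) →
      ∃ f : X → ℝ, Integrable f μ ∧ ∀ E, MeasurableSet E → s E = ∫ x in E, f x ∂μ := fun s hs => by
    have hac : s ≪ᵥ μ.toENNRealVectorMeasure := VectorMeasure.AbsolutelyContinuous.mk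
      fun E hE h0 => hs E hE (by rwa [Measure.toENNRealVectorMeasure_apply_measurable hE] at h0)
    refine ⟨s.rnDeriv μ, SignedMeasure.integrable_rnDeriv s μ, fun E hE => ?_⟩
    conv_lhs => rw [← (SignedMeasure.absolutelyContinuous_iff_withDensityᵥ_rnDeriv_eq s μ).1 hac]
    exact withDensityᵥ_apply (SignedMeasure.integrable_rnDeriv s μ) hE
  obtain ⟨f, hf, hfE⟩ := key (ComplexMeasure.re m) fun E hE h0 => by
    change (m E).re = 0
    rw [hm E hE h0, Complex.zero_re]
  obtain ⟨g, hg, hgE⟩ := key (ComplexMeasure.im m) fun E hE h0 => by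
    change (m E).im = 0
    rw [hm E hE h0, Complex.zero_im]
  refine ⟨fun x => (f x : ℂ) + g x * Complex.I, hf.ofReal.add (hg.ofReal.mul_const _),
    fun E hE => ?_⟩
  have h1 : IntegrableOn (fun x => (f x : ℂ)) E μ := hf.ofReal.integrableOn
  have h2 : IntegrableOn (fun x => (g x : ℂ) * Complex.I) E μ :=
    (hg.ofReal.mul_const _).integrableOn
  change _ = ∫ x in E, ((f x : ℂ) + g x * Complex.I) ∂μ
  rw [integral_add h1 h2, integral_mul_const, integral_complex_ofReal, integral_complex_ofReal,
    ← hfE E hE, ← hgE E hE]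
  exact (Complex.re_add_im (m E)).symm

/-! ### Order continuous functionals are given by densities -/

section Representation

variable {X : Type*} [MetricSpace X] [MeasurableSpace X] {μ : Measure X} {A : ℝ}

theorem IsBddBddSupp.add {f g : X → ℂ} (hf : IsBddBddSupp μ f) (hg : IsBddBddSupp μ g) :
    IsBddBddSupp μ (f + g) :=
  ⟨hf.1.add hg.1, (hf.2.union hg.2).subset (Function.support_add f g)⟩

theorem IsBddBddSupp.smul {f : X → ℂ} (c : ℂ) (hf : IsBddBddSupp μ f) : IsBddBddSupp μ (c • f) :=
  ⟨hf.1.const_smul c, hf.2.subset (Function.support_const_smul_subset c f)⟩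

theorem IsBddBddSupp.sub {f g : X → ℂ} (hf : IsBddBddSupp μ f) (hg : IsBddBddSupp μ g) :
    IsBddBddSupp μ (f - g) := by
  have := hf.add (hg.smul (-1))
  rwa [neg_one_smul, ← sub_eq_add_neg] at this

theorem isBddBddSupp_of_ball {f : X → ℂ} (hf : MemLp f ∞ μ) {z : X} {R : ℝ}
    (hs : Function.support f ⊆ Metric.ball z R) : IsBddBddSupp μ f :=
  ⟨hf, Metric.isBounded_ball.subset hs⟩

theorem isBddBddSupp_indicator {E : Set X} (hE : MeasurableSet E) {z : X} {R : ℝ}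
    (hs : E ⊆ Metric.ball z R) : IsBddBddSupp μ (E.indicator 1 : X → ℂ) :=
  isBddBddSupp_of_ball ((memLp_top_const (1 : ℂ)).indicator hE)
    (Set.support_indicator_subset.trans hs)

variable {Λ : (X → ℂ) → ℂ}

theorem apply_indicator_biUnion {z : X} {R : ℝ}
    (hadd : ∀ f g, IsBddBddSupp μ f → IsBddBddSupp μ g → Λ (f + g) = Λ f + Λ g)
    (hΛ0 : Λ 0 = 0) {s : Finset ℕ} {E : ℕ → Set X} (hE : ∀ i ∈ s, MeasurableSet (E i))
    (hd : (s : Set ℕ).PairwiseDisjoint E) (hU : ∀ i ∈ s, E i ⊆ Metric.ball z R) :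
    Λ ((⋃ i ∈ s, E i).indicator 1) = ∑ i ∈ s, Λ ((E i).indicator 1) := by
  classical
  induction s using Finset.induction_on with
  | empty =>
    simp only [Finset.notMem_empty, Set.iUnion_of_empty, Set.iUnion_empty, Set.indicator_empty',
      Finset.sum_empty]
    exact hΛ0
  | insert i s hi ih =>
    have hE' : ∀ j ∈ s, MeasurableSet (E j) := fun j hj => hE j (Finset.mem_insert_of_mem hj)
    have hU' : ∀ j ∈ s, E j ⊆ Metric.ball z R := fun j hj => hU j (Finset.mem_insert_of_mem hj)
    have hdis : Disjoint (E i) (⋃ j ∈ s, E j) := by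
      rw [Set.disjoint_iUnion₂_right]
      exact fun j hj => hd (Finset.mem_insert_self i s) (Finset.mem_insert_of_mem hj)
        fun hij => hi (hij ▸ hj)
    rw [Finset.sum_insert hi, ← ih hE' (hd.subset (by simp)) hU', Finset.set_biUnion_insert,
      Set.indicator_union_of_disjoint hdis]
    exact hadd _ _ (isBddBddSupp_indicator (hE i (Finset.mem_insert_self i s))
      (hU i (Finset.mem_insert_self i s))) (isBddBddSupp_indicator
      (Finset.measurableSet_biUnion s hE') (Set.iUnion₂_subset hU'))

/-- The set function induced by a linear functional on bounded functions, restricted to `U`, is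
σ-additive if the functional is order continuous. -/
theorem hasSum_apply_indicator [BorelSpace X] (h : IsDoublingWith μ A) {z : X} {R : ℝ}
    (hadd : ∀ f g, IsBddBddSupp μ f → IsBddBddSupp μ g → Λ (f + g) = Λ f + Λ g)
    (hΛ0 : Λ 0 = 0)
    (hoc : ∀ ε : ℝ, 0 < ε → ∃ δ : ℝ, 0 < δ ∧ ∀ E : Set X, MeasurableSet E →
      E ⊆ Metric.ball z R → μ.real E < δ → ‖Λ (E.indicator 1)‖ ≤ ε)
    {E : ℕ → Set X} (hE : ∀ i, MeasurableSet (E i)) (hd : Pairwise (Function.onFun Disjoint E))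
    (hU : ∀ i, E i ⊆ Metric.ball z R) :
    HasSum (fun i => Λ ((E i).indicator 1)) (Λ ((⋃ i, E i).indicator 1)) := by
  have hsub : ⋃ i, E i ⊆ Metric.ball z R := Set.iUnion_subset hU
  have hfin := fun s : Finset ℕ => apply_indicator_biUnion hadd hΛ0 (s := s)
    (fun i _ => hE i) (fun i _ j _ hij => hd hij) (fun i _ => hU i)
  have hmeas : HasSum (fun i => μ.real (E i)) (μ.real (⋃ i, E i)) := by
    have h1 := measure_iUnion (μ := μ) hd hE
    have h2 := h.measure_lt_top_of_subset hsub
    have h3 := ENNReal.hasSum_toReal (h1 ▸ h2.ne)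
    rwa [← ENNReal.tsum_toReal_eq fun i => (h.measure_lt_top_of_subset (hU i)).ne, ← h1] at h3
  rw [HasSum, Metric.tendsto_nhds]
  intro ε hε
  obtain ⟨δ, hδ, hδE⟩ := hoc (ε / 2) (by positivity)
  filter_upwards [Metric.tendsto_nhds.1 hmeas δ hδ] with s hs
  have hms : MeasurableSet (⋃ i ∈ s, E i) := Finset.measurableSet_biUnion s fun j _ => hE j
  have hss : ⋃ i ∈ s, E i ⊆ ⋃ i, E i := Set.iUnion₂_subset fun j _ => Set.subset_iUnion E j
  -- By finite additivity the error after finitely many sets is `Λ` of the indicator of this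
  -- remainder, whose measure is the tail of a convergent series; order continuity makes it small.
  have hmr : MeasurableSet ((⋃ i, E i) \ ⋃ i ∈ s, E i) := (MeasurableSet.iUnion hE).diff hms
  have h1 : Λ ((⋃ i, E i).indicator 1) =
      Λ ((⋃ i ∈ s, E i).indicator 1) + Λ (((⋃ i, E i) \ ⋃ i ∈ s, E i).indicator 1) := by
    rw [← hadd _ _ (isBddBddSupp_indicator hms (hss.trans hsub))
      (isBddBddSupp_indicator hmr (Set.sdiff_subset.trans hsub)), add_comm]
    congr 1
    exact (congrArg (fun E : Set X => E.indicator (1 : X → ℂ))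
      (Set.sdiff_union_of_subset hss).symm).trans
      (Set.indicator_union_of_disjoint Set.disjoint_sdiff_left _)
  rw [dist_comm, dist_eq_norm, h1, ← hfin, add_sub_cancel_left]
  refine (hδE _ hmr (Set.sdiff_subset.trans hsub) ?_).trans_lt (by linarith)
  have h2 : μ.real (⋃ i ∈ s, E i) = ∑ i ∈ s, μ.real (E i) :=
    measureReal_biUnion_finset (fun i _ j _ hij => hd hij) (fun i _ => hE i)
      (fun i _ => (h.measure_lt_top_of_subset (hU i)).ne)
  rw [measureReal_sdiff hss hms (h.measure_lt_top_of_subset hsub).ne, h2]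
  rw [dist_comm, Real.dist_eq] at hs
  exact (le_abs_self _).trans_lt hs

/-- Order continuity supplies both requirements of the Radon-Nikodym theorem for `E ↦ Λ (1_{E ∩
U})`: σ-additivity, and absolute continuity because null sets satisfy the smallness condition for
every `ε`. -/
theorem exists_density_on [BorelSpace X] (h : IsDoublingWith μ A) {z : X} {R : ℝ}
    (hadd : ∀ f g, IsBddBddSupp μ f → IsBddBddSupp μ g → Λ (f + g) = Λ f + Λ g)
    (hΛ0 : Λ 0 = 0)
    (hoc : ∀ ε : ℝ, 0 < ε → ∃ δ : ℝ, 0 < δ ∧ ∀ E : Set X, MeasurableSet E →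
      E ⊆ Metric.ball z R → μ.real E < δ → ‖Λ (E.indicator 1)‖ ≤ ε)
    {U : Set X} (hU : MeasurableSet U) (hUs : U ⊆ Metric.ball z R) :
    ∃ f : X → ℂ, Integrable f μ ∧ ∀ E, MeasurableSet E →
      Λ ((E ∩ U).indicator 1) = ∫ x in E, f x ∂μ := by
  classical
  have := h.sigmaFinite
  let m : ComplexMeasure X :=
    { measureOf' := fun E => if MeasurableSet E then Λ ((E ∩ U).indicator 1) else 0
      empty' := by
        rw [if_pos MeasurableSet.empty, Set.empty_inter, Set.indicator_empty']
        exact hΛ0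
      not_measurable' := fun E hE => if_neg hE
      m_iUnion' := fun E hE hd => by
        simp only [hE, MeasurableSet.iUnion hE, if_true]
        rw [Set.iUnion_inter]
        exact hasSum_apply_indicator h hadd hΛ0 hoc (fun i => (hE i).inter hU)
          (fun i j hij => (hd hij).mono Set.inter_subset_left Set.inter_subset_left)
          (fun i => Set.inter_subset_right.trans hUs) }
  have hm : ∀ E, MeasurableSet E → m E = Λ ((E ∩ U).indicator 1) := fun E hE => if_pos hE
  obtain ⟨f, hf, hfE⟩ := exists_integrable_of_complexMeasure μ m fun E hE h0 => by
    rw [hm E hE]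
    refine norm_le_zero_iff.1 (le_of_forall_pos_le_add fun ε hε => ?_)
    obtain ⟨δ, hδ, hδE⟩ := hoc ε hε
    rw [zero_add]
    refine hδE _ (hE.inter hU) (Set.inter_subset_right.trans hUs) ?_
    rwa [Measure.real, measure_mono_null Set.inter_subset_left h0, ENNReal.toReal_zero]
  exact ⟨f, hf, fun E hE => by rw [← hm E hE, hfE E hE]⟩

/-- An order continuous functional on bounded functions with bounded support is given by a
function which is integrable on balls. -/
theorem exists_density [BorelSpace X] (h : IsDoublingWith μ A) (z : X)
    (hadd : ∀ f g, IsBddBddSupp μ f → IsBddBddSupp μ g → Λ (f + g) = Λ f + Λ g)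
    (hsmul : ∀ (c : ℂ) f, IsBddBddSupp μ f → Λ (c • f) = c * Λ f)
    (hbd : ∀ R : ℝ, 0 < R → ∃ C : ℝ, ∀ (g : X → ℂ) (c : ℝ), IsBddBddSupp μ g →
      Function.support g ⊆ Metric.ball z R → 0 < c → (∀ᵐ x ∂μ, ‖g x‖ ≤ c) → ‖Λ g‖ ≤ C * c)
    (hoc : ∀ R : ℝ, 0 < R → ∀ ε : ℝ, 0 < ε → ∃ δ : ℝ, 0 < δ ∧ ∀ E : Set X, MeasurableSet E →
      E ⊆ Metric.ball z R → μ.real E < δ → ‖Λ (E.indicator 1)‖ ≤ ε) :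
    ∃ f : X → ℂ, (∀ B : Ball X, IntegrableOn f B.set μ) ∧
      ∀ g, IsBddBddSupp μ g → Λ g = ∫ x, f x * g x ∂μ := by
  have hb0 : IsBddBddSupp μ (0 : X → ℂ) := ⟨MemLp.zero, by simp⟩
  have hΛ0 : Λ 0 = 0 := by simpa using hsmul 0 0 hb0
  -- The space is cut into disjoint annuli so that the densities can be glued without checking
  -- compatibility. Radii start at `n + 1`, so that the first set is a genuine ball.
  let S : ℕ → Set X := disjointed fun n : ℕ => Metric.ball z ((n : ℝ) + 1)
  have hSm : ∀ n, MeasurableSet (S n) :=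
    MeasurableSet.disjointed fun n => Metric.isOpen_ball.measurableSet
  have hSs : ∀ n, S n ⊆ Metric.ball z ((n : ℝ) + 1) := fun n => disjointed_subset _ n
  have hSd : Pairwise (Function.onFun Disjoint S) := disjoint_disjointed _
  have hmono : Monotone fun n : ℕ => Metric.ball z ((n : ℝ) + 1) := fun m n hmn =>
    Metric.ball_subset_ball (by exact_mod_cast Nat.add_le_add_right hmn 1)
  have hSU : ∀ n : ℕ, ⋃ k ∈ Finset.range (n + 1), S k = Metric.ball z ((n : ℝ) + 1) := fun n => by
    have h1 := biUnion_range_succ_disjointed (fun n : ℕ => Metric.ball z ((n : ℝ) + 1)) n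
    rw [hmono.partialSups_eq] at h1
    exact h1
  choose F hFi hF using fun n : ℕ => exists_density_on h hadd hΛ0
    (hoc ((n : ℝ) + 1) (by positivity)) (hSm n) (hSs n)
  let f : X → ℂ := fun x => ∑' n, (S n).indicator (F n) x
  have hfS : ∀ n, ∀ x ∈ S n, f x = F n x := fun n x hx => by
    change ∑' k, (S k).indicator (F k) x = F n x
    rw [tsum_eq_single n, Set.indicator_of_mem hx]
    exact fun k hk => Set.indicator_of_notMem
      (fun hxk => Set.disjoint_left.1 (hSd hk) hxk hx) _
  have hfSi : ∀ n, IntegrableOn f (S n) μ := fun n =>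
    (hFi n).integrableOn.congr_fun (fun x hx => (hfS n x hx).symm) (hSm n)
  have hfi : ∀ n : ℕ, IntegrableOn f (Metric.ball z ((n : ℝ) + 1)) μ := fun n => by
    rw [← hSU n]
    exact integrableOn_finset_iUnion.2 fun k _ => hfSi k
  have hfB : ∀ B : Ball X, IntegrableOn f B.set μ := fun B => by
    obtain ⟨n, hn⟩ := exists_nat_ge (B.radius + dist B.center z)
    exact (hfi n).mono_set (Metric.ball_subset_ball' (by linarith))
  have hind : ∀ (n : ℕ) (E : Set X), MeasurableSet E → E ⊆ Metric.ball z ((n : ℝ) + 1) →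
      Λ (E.indicator 1) = ∫ x, f x * E.indicator 1 x ∂μ := fun n E hE hEs => by
    have h1 : ∫ x, f x * E.indicator 1 x ∂μ = ∫ x in E, f x ∂μ := by
      rw [← integral_indicator hE]
      congr 1
      funext x
      by_cases hx : x ∈ E <;> simp [hx]
    have h2 : E = ⋃ k ∈ Finset.range (n + 1), E ∩ S k := by
      rw [← Set.inter_iUnion₂, hSU n, Set.inter_eq_left.2 hEs]
    rw [h1]
    have hdis : (Finset.range (n + 1) : Set ℕ).PairwiseDisjoint fun k => E ∩ S k :=
      fun i _ j _ hij => (hSd hij).mono Set.inter_subset_right Set.inter_subset_right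
    rw [h2, apply_indicator_biUnion hadd hΛ0 (fun k _ => hE.inter (hSm k)) hdis
        (fun k _ => Set.inter_subset_left.trans hEs),
      integral_biUnion_finset _ (fun k _ => hE.inter (hSm k)) hdis
        (fun k _ => (hfSi k).mono_set Set.inter_subset_right)]
    refine Finset.sum_congr rfl fun k _ => ?_
    have h3 := hF k (E ∩ S k) (hE.inter (hSm k))
    rw [Set.inter_assoc, Set.inter_self] at h3
    rw [h3]
    exact setIntegral_congr_fun (hE.inter (hSm k)) fun x hx => (hfS k x hx.2).symm
  have hfg : ∀ {g : X → ℂ}, IsBddBddSupp μ g → Integrable (fun x => f x * g x) μ := fun {g} hg => by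
    obtain ⟨R, hR⟩ := hg.2.subset_ball z
    obtain ⟨c, -, hc⟩ := exists_ae_norm_le hg.1
    obtain ⟨n, hn⟩ := exists_nat_ge R
    have hs : Function.support (fun x => f x * g x) ⊆ Metric.ball z ((n : ℝ) + 1) := fun x hx =>
      Metric.ball_subset_ball (by linarith) (hR (right_ne_zero_of_mul hx))
    rw [← integrableOn_iff_integrable_of_support_subset hs]
    exact (hfi n).mul_bdd (c := c) hg.1.1.restrict (ae_restrict_of_ae hc)
  have hadd' : ∀ {g k : X → ℂ}, IsBddBddSupp μ g → IsBddBddSupp μ k →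
      ∫ x, f x * (g + k) x ∂μ = ∫ x, f x * g x ∂μ + ∫ x, f x * k x ∂μ := fun {g k} hg hk => by
    rw [← integral_add (hfg hg) (hfg hk)]
    simp only [Pi.add_apply, mul_add]
  have hsimple : ∀ (n : ℕ) (s : SimpleFunc X ℂ),
      IsBddBddSupp μ ((Metric.ball z ((n : ℝ) + 1)).indicator s) ∧
      Λ ((Metric.ball z ((n : ℝ) + 1)).indicator s) =
        ∫ x, f x * (Metric.ball z ((n : ℝ) + 1)).indicator s x ∂μ := fun n s => by
    have hbdd : ∀ s : SimpleFunc X ℂ,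
        IsBddBddSupp μ ((Metric.ball z ((n : ℝ) + 1)).indicator s) := fun s =>
      isBddBddSupp_of_ball ((s.memLp_top μ).indicator Metric.isOpen_ball.measurableSet)
        Set.support_indicator_subset
    refine ⟨hbdd s, ?_⟩
    induction s using SimpleFunc.induction with
    | @const c E hE =>
      have hE' : MeasurableSet (E ∩ Metric.ball z ((n : ℝ) + 1)) :=
        hE.inter Metric.isOpen_ball.measurableSet
      have h1 : (Metric.ball z ((n : ℝ) + 1)).indicator (SimpleFunc.piecewise E hE
          (SimpleFunc.const X c) (SimpleFunc.const X 0)) =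
          c • (E ∩ Metric.ball z ((n : ℝ) + 1)).indicator (1 : X → ℂ) := by
        funext x
        by_cases hx : x ∈ E <;> by_cases hx' : x ∈ Metric.ball z ((n : ℝ) + 1) <;>
          simp [Set.indicator, hx, hx', -Metric.mem_ball]
      rw [h1, hsmul _ _ (isBddBddSupp_indicator hE' Set.inter_subset_right),
        hind n _ hE' Set.inter_subset_right, ← integral_const_mul]
      congr 1
      funext x
      rw [Pi.smul_apply, smul_eq_mul]
      ring
    | @add s t hst hs ht =>
      rw [SimpleFunc.coe_add, Set.indicator_add', hadd _ _ (hbdd s) (hbdd t), hs, ht,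
        hadd' (hbdd s) (hbdd t)]
  refine ⟨f, hfB, fun g hg => ?_⟩
  obtain ⟨R, hR⟩ := hg.2.subset_ball z
  obtain ⟨n, hn⟩ := exists_nat_ge R
  obtain ⟨C, hC⟩ := hbd ((n : ℝ) + 1) (by positivity)
  set I := ∫ x in Metric.ball z ((n : ℝ) + 1), ‖f x‖ ∂μ with hI
  have hI0 : 0 ≤ I := integral_nonneg fun _ => norm_nonneg _
  have hsg : Function.support g ⊆ Metric.ball z ((n : ℝ) + 1) :=
    hR.trans (Metric.ball_subset_ball (by linarith))
  -- Indicators are known, hence simple functions. A bounded `g` is uniformly close to a simple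
  -- function, and both `Λ` and integration against `f` are continuous for the uniform norm on
  -- functions supported in one ball.
  have hest : ∀ ε : ℝ, 0 < ε → ‖Λ g - ∫ x, f x * g x ∂μ‖ ≤ (|C| + I) * ε := fun ε hε => by
    obtain ⟨s, hs⟩ := exists_simpleFunc_ae_norm_sub_le hg.1 hε
    obtain ⟨hb, hΛs⟩ := hsimple n s
    set k := (Metric.ball z ((n : ℝ) + 1)).indicator s with hk
    have hd := hg.sub hb
    have hds : Function.support (g - k) ⊆ Metric.ball z ((n : ℝ) + 1) :=
      support_sub_subset hsg Set.support_indicator_subset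
    have hae : ∀ᵐ x ∂μ, ‖(g - k) x‖ ≤ ε := by
      filter_upwards [hs] with x hx
      by_cases hxb : x ∈ Metric.ball z ((n : ℝ) + 1)
      · rwa [Pi.sub_apply, hk, Set.indicator_of_mem hxb]
      · have : (g - k) x = 0 := by
          by_contra h0
          exact hxb (hds h0)
        rw [this, norm_zero]
        exact hε.le
    have h1 := hC _ ε hd hds hε hae
    have h2 : Λ g = Λ (g - k) + Λ k := by rw [← hadd _ _ hd hb, sub_add_cancel]
    have h3 : ∫ x, f x * g x ∂μ = ∫ x, f x * (g - k) x ∂μ + ∫ x, f x * k x ∂μ := by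
      rw [← hadd' hd hb, sub_add_cancel]
    have h4 : ‖∫ x, f x * (g - k) x ∂μ‖ ≤ I * ε := by
      have h5 : ∫ x, f x * (g - k) x ∂μ =
          ∫ x in Metric.ball z ((n : ℝ) + 1), f x * (g - k) x ∂μ :=
        (setIntegral_eq_integral_of_forall_compl_eq_zero fun x hx => by
          have : (g - k) x = 0 := by
            by_contra h0
            exact hx (hds h0)
          rw [this, mul_zero]).symm
      rw [h5, hI, ← integral_mul_const]
      refine norm_integral_le_of_norm_le ((hfi n).norm.mul_const ε) ?_
      filter_upwards [ae_restrict_of_ae hae] with x hx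
      rw [norm_mul]
      exact mul_le_mul_of_nonneg_left hx (norm_nonneg _)
    rw [h2, h3, hΛs, add_sub_add_right_eq_sub]
    refine (norm_sub_le _ _).trans ((add_le_add (h1.trans
      (mul_le_mul_of_nonneg_right (le_abs_self C) hε.le)) h4).trans_eq (by ring))
  refine sub_eq_zero.1 (norm_le_zero_iff.1 (le_of_forall_pos_le_add fun ε hε => ?_))
  have h0 : 0 < |C| + I + 1 := by positivity
  refine (hest (ε / (|C| + I + 1)) (by positivity)).trans ?_
  rw [zero_add, mul_div_assoc', div_le_iff₀ h0]
  nlinarith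

end Representation

/-! ### Calderón-Zygmund splitting of an indicator function -/

/-- At each point at most one term is nonzero. The bound on all finite remainders is what later
provides a majorant for dominated convergence. -/
theorem exists_hasSum_indicator {X : Type*} {S : ℕ → Set X}
    (hd : Pairwise (Function.onFun Disjoint S)) {c : ℕ → ℂ} {K : ℝ} (hK : 0 ≤ K)
    (hc : ∀ n, ‖c n‖ ≤ K) (x : X) :
    ∃ w, HasSum (fun n => (S n).indicator (fun _ => c n) x) w ∧ ‖w‖ ≤ K ∧
      (∀ s : Finset ℕ, ‖w - ∑ n ∈ s, (S n).indicator (fun _ => c n) x‖ ≤ K) ∧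
      ((∀ n, x ∉ S n) → w = 0) ∧ ∀ n, x ∈ S n → w = c n := by
  by_cases hx : ∃ n, x ∈ S n
  · obtain ⟨n, hn⟩ := hx
    have h0 : ∀ k, k ≠ n → (S k).indicator (fun _ => c k) x = 0 := fun k hk =>
      Set.indicator_of_notMem (fun hxk => Set.disjoint_left.1 (hd hk) hxk hn) _
    have h1 : (S n).indicator (fun _ => c n) x = c n := Set.indicator_of_mem hn _
    refine ⟨c n, ?_, hc n, fun s => ?_, fun h => absurd hn (h n), fun k hk => ?_⟩
    · have := hasSum_single n h0
      rwa [h1] at this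
    · by_cases hs : n ∈ s
      · rw [Finset.sum_eq_single_of_mem n hs fun k _ hk => h0 k hk, h1, sub_self, norm_zero]
        exact hK
      · rw [Finset.sum_eq_zero fun k hk => h0 k fun hkn => hs (hkn ▸ hk), sub_zero]
        exact hc n
    · by_contra hne
      have hkn : k ≠ n := fun hkn => hne (hkn ▸ rfl)
      exact Set.disjoint_left.1 (hd hkn) hk hn
  · push Not at hx
    have h0 : ∀ k, (S k).indicator (fun _ => c k) x = 0 := fun k =>
      Set.indicator_of_notMem (hx k) _
    refine ⟨0, ?_, by simpa using hK, fun s => ?_, fun _ => rfl, fun n hn => absurd hn (hx n)⟩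
    · simp only [h0]; exact hasSum_zero
    · simpa [h0] using hK

section Split

variable {X : Type*} [MetricSpace X] [MeasurableSpace X] [BorelSpace X] {μ : Measure X} {A : ℝ}

/-- A Calderón-Zygmund decomposition of the indicator function of a small set `E`, into a series of
functions with cancellation on balls of small total measure, and a uniformly small remainder. -/
theorem IsDoublingWith.exists_atomic_split (h : IsDoublingWith μ A) {z : X} {R : ℝ}
    (hR : 0 < R) {E : Set X} (hE : MeasurableSet E) (hEs : E ⊆ Metric.ball z R) {lam : ℝ}
    (hl0 : 0 < lam) (hl1 : lam < 1) (hsmall : A * μ.real E ≤ lam * μ.real (Metric.ball z R)) :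
    ∃ (a : ℕ → X → ℂ) (F : X → ℂ) (m : ℕ → ℝ),
      (∀ n, 0 ≤ m n) ∧ Summable m ∧ ∑' n, m n ≤ A ^ 3 / lam * μ.real E ∧
      (∀ n, m n = 0 → a n = 0) ∧
      (∀ n, m n ≠ 0 → ∃ B : Ball X, m n = μ.real B.set ∧ Function.support (a n) ⊆ B.set) ∧
      (∀ n, AEStronglyMeasurable (a n) μ ∧ Function.support (a n) ⊆ Metric.ball z (2 * R) ∧
        (∀ x, ‖a n x‖ ≤ 1 + A ^ 3) ∧ ∫ x, a n x ∂μ = 0) ∧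
      AEStronglyMeasurable F μ ∧ Function.support F ⊆ Metric.ball z (2 * R) ∧
      (∀ (s : Finset ℕ) x, ‖F x - ∑ n ∈ s, a n x‖ ≤ 1 + A ^ 3) ∧
      (∀ x, HasSum (fun n => a n x) (F x)) ∧
      ∀ᵐ x ∂μ, ‖E.indicator 1 x - F x‖ ≤ A ^ 3 * lam := by
  classical
  have : Nonempty X := ⟨z⟩
  have hA := h.pos'
  have hEt : μ E ≠ ∞ := (h.measure_lt_top_of_subset hEs).ne
  let w : X → ℝ := E.indicator 1
  have hw0 : ∀ x, 0 ≤ w x := fun x => Set.indicator_nonneg (fun _ _ => zero_le_one) x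
  have hw : ∀ (x : X) (r : ℝ), 0 < r → IntegrableOn w (Metric.ball x r) μ := fun x r _ =>
    (integrableOn_const (h.lt_top x r).ne).indicator hE
  have hwi : ∀ (x : X) (r : ℝ), ∫ y in Metric.ball x r, w y ∂μ = μ.real (E ∩ Metric.ball x r) :=
    fun x r => by
      rw [integral_indicator_one hE, measureReal_restrict_apply hE]
  have hS : ∀ x ∈ Metric.ball z R, ∫ y in Metric.ball x R, w y ∂μ ≤
      lam * μ.real (Metric.ball x R) := fun x hx => by
    rw [hwi]
    have h1 : μ.real (E ∩ Metric.ball x R) ≤ μ.real E := measureReal_mono Set.inter_subset_left hEt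
    have h2 : μ.real (Metric.ball z R) ≤ A ^ 1 * μ.real (Metric.ball x R) :=
      h.real_le hR 1 (Metric.ball_subset_ball' (by
        have := Metric.mem_ball'.1 hx
        linarith))
    have h3 : A * μ.real E ≤ A * (lam * μ.real (Metric.ball x R)) := by
      refine hsmall.trans ((mul_le_mul_of_nonneg_left h2 hl0.le).trans_eq (by ring))
    exact h1.trans (le_of_mul_le_mul_left h3 hA)
  obtain ⟨T, c, r, hT, hdisj, hcov⟩ := h.exists_stopping_balls hw hR hS
  have hsub8 : ∀ n ∈ T, Metric.ball (c n) (8 * r n) ⊆ Metric.ball z (2 * R) := fun n hn =>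
    Metric.ball_subset_ball' (by
      have h1 := Metric.mem_ball.1 (hT n hn).1
      have h2 := (hT n hn).2.2.1
      linarith)
  have hsub1 : ∀ n ∈ T, Metric.ball (c n) (r n) ⊆ Metric.ball (c n) (8 * r n) := fun n hn =>
    Metric.ball_subset_ball (by linarith [(hT n hn).2.1])
  -- The dilates overlap, so `E` is distributed over them through the disjoint sets `S n`; indices
  -- outside `T` carry the empty set.
  let G : ℕ → Set X := fun n => if n ∈ T then E ∩ Metric.ball (c n) (8 * r n) else ∅
  have hGm : ∀ n, MeasurableSet (G n) := fun n => by
    simp only [G]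
    split_ifs
    exacts [hE.inter Metric.isOpen_ball.measurableSet, MeasurableSet.empty]
  let S : ℕ → Set X := disjointed G
  have hSm : ∀ n, MeasurableSet (S n) := MeasurableSet.disjointed hGm
  have hSd : Pairwise (Function.onFun Disjoint S) := disjoint_disjointed G
  have hSG : ∀ n, S n ⊆ G n := disjointed_subset G
  have hST : ∀ n ∈ T, S n ⊆ E ∩ Metric.ball (c n) (8 * r n) := fun n hn => by
    have := hSG n
    simpa only [G, if_pos hn] using this
  have hST' : ∀ n, n ∉ T → S n = ∅ := fun n hn => by
    have := hSG n
    simp only [G, if_neg hn] at this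
    exact Set.subset_empty_iff.1 this
  -- The mass of `S n` is compensated on the stopping ball, not on its dilate: stopping balls are
  -- disjoint, so the compensations do not pile up.
  let Q : ℕ → Set X := fun n => if n ∈ T then Metric.ball (c n) (r n) else ∅
  have hQT : ∀ n ∈ T, Q n = Metric.ball (c n) (r n) := fun n hn => if_pos hn
  have hQT' : ∀ n, n ∉ T → Q n = ∅ := fun n hn => if_neg hn
  have hQm : ∀ n, MeasurableSet (Q n) := fun n => by
    simp only [Q]
    split_ifs
    exacts [Metric.isOpen_ball.measurableSet, MeasurableSet.empty]
  have hQd : Pairwise (Function.onFun Disjoint Q) := fun i j hij => by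
    simp only [Function.onFun, Q]
    split_ifs with hi hj
    · exact hdisj hi hj hij
    all_goals simp
  have hQt : ∀ n, μ (Q n) ≠ ∞ := fun n => by
    simp only [Q]
    split_ifs
    exacts [(h.lt_top _ _).ne, by simp]
  let η : ℕ → ℝ := fun n => μ.real (S n) / μ.real (Q n)
  have hη0 : ∀ n, 0 ≤ η n := fun n => by positivity
  -- The average of the indicator of `E` over the dilate is at most `lam`; shrinking to the stopping
  -- ball costs `A ^ 3`.
  have hη : ∀ n, η n ≤ A ^ 3 * lam := fun n => by
    by_cases hn : n ∈ T
    · simp only [η, hQT n hn]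
      have hr := (hT n hn).2.1
      rw [div_le_iff₀ (h.pos _ _ hr)]
      have h1 : μ.real (S n) ≤ μ.real (E ∩ Metric.ball (c n) (8 * r n)) :=
        measureReal_mono (hST n hn) (measure_ne_top_of_subset Set.inter_subset_left hEt)
      have h2 := (hT n hn).2.2.2.2
      rw [hwi] at h2
      have h3 : μ.real (Metric.ball (c n) (8 * r n)) ≤ A ^ 3 * μ.real (Metric.ball (c n) (r n)) :=
        h.real_le hr 3 (by norm_num)
      exact h1.trans (h2.trans ((mul_le_mul_of_nonneg_left h3 hl0.le).trans_eq (by ring)))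
    · simp only [η, hST' n hn]
      simp only [measureReal_empty, zero_div]
      positivity
  have hAl : A ^ 3 * lam ≤ A ^ 3 := by nlinarith [pow_pos hA 3]
  have hηn : ∀ n, ‖(η n : ℂ)‖ ≤ A ^ 3 * lam := fun n => by
    rw [Complex.norm_real, Real.norm_of_nonneg (hη0 n)]
    exact hη n
  -- `F₁` will be the indicator of `E` almost everywhere, and `F₂` the sum of the compensations,
  -- uniformly at most `A ^ 3 * lam`. Their difference is the sum of the mean-zero pieces, so `F₂`
  -- is the remainder.
  choose F₁ hF₁s hF₁n hF₁b hF₁0 hF₁1 using fun x => exists_hasSum_indicator hSd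
    (c := fun _ => 1) zero_le_one (fun n => by simp) x
  choose F₂ hF₂s hF₂n hF₂b hF₂0 hF₂1 using fun x => exists_hasSum_indicator hQd
    (c := fun n => (η n : ℂ)) (by positivity) hηn x
  let a : ℕ → X → ℂ := fun n x =>
    (S n).indicator (fun _ => (1 : ℂ)) x - (Q n).indicator (fun _ => (η n : ℂ)) x
  let m : ℕ → ℝ := fun n => if n ∈ T then μ.real (Metric.ball (c n) (8 * r n)) else 0
  have hmT : ∀ n ∈ T, m n = μ.real (Metric.ball (c n) (8 * r n)) := fun n hn => if_pos hn
  have hmT' : ∀ n, n ∉ T → m n = 0 := fun n hn => if_neg hn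
  have haT' : ∀ n, n ∉ T → a n = 0 := fun n hn => by
    funext x
    simp [a, hST' n hn, hQT' n hn]
  have hasT : ∀ n ∈ T, Function.support (a n) ⊆ Metric.ball (c n) (8 * r n) := fun n hn x hx => by
    by_contra hx8
    have h1 : x ∉ S n := fun hxS => hx8 (hST n hn hxS).2
    have h2 : x ∉ Q n := fun hxQ => hx8 (hsub1 n hn (by rwa [hQT n hn] at hxQ))
    exact hx (by simp [a, h1, h2])
  have has : ∀ n, Function.support (a n) ⊆ Metric.ball z (2 * R) := fun n => by
    by_cases hn : n ∈ T
    · exact (hasT n hn).trans (hsub8 n hn)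
    · rw [haT' n hn]; simp
  have ham : ∀ n, Measurable (a n) := fun n =>
    (measurable_const.indicator (hSm n)).sub (measurable_const.indicator (hQm n))
  have hFs : ∀ x, HasSum (fun n => a n x) (F₁ x - F₂ x) := fun x => (hF₁s x).sub (hF₂s x)
  have hmsum : ∑' n : T, μ (Metric.ball (c n) (8 * r n)) ≤
      ENNReal.ofReal (A ^ 3 / lam * μ.real E) := by
    have h1 := h.tsum_measure_dilate_le (U := Metric.ball z (2 * R)) (hw z (2 * R) (by positivity))
      hw0 hl0 (fun n hn => (hT n hn).2.1) (fun n hn => (hsub1 n hn).trans (hsub8 n hn))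
      (fun n hn => (hT n hn).2.2.2.1.le) hdisj
    rw [hwi] at h1
    refine h1.trans (ENNReal.ofReal_le_ofReal (mul_le_mul_of_nonneg_left ?_ (by positivity)))
    exact measureReal_mono Set.inter_subset_left hEt
  have hmE : ∑' n, ENNReal.ofReal (m n) ≤ ENNReal.ofReal (A ^ 3 / lam * μ.real E) := by
    refine le_trans (le_of_eq ?_) hmsum
    rw [tsum_subtype T (fun n => μ (Metric.ball (c n) (8 * r n)))]
    congr 1
    funext n
    by_cases hn : n ∈ T
    · rw [Set.indicator_of_mem hn, hmT n hn]
      exact ENNReal.ofReal_toReal (h.lt_top _ _).ne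
    · rw [Set.indicator_of_notMem hn, hmT' n hn, ENNReal.ofReal_zero]
  have hm0 : ∀ n, 0 ≤ m n := fun n => by
    simp only [m]
    split_ifs
    exacts [measureReal_nonneg, le_rfl]
  have hmne : ∑' n, ENNReal.ofReal (m n) ≠ ∞ := ne_top_of_le_ne_top ENNReal.ofReal_ne_top hmE
  have hms : Summable m := by
    have := ENNReal.summable_toReal hmne
    simpa only [ENNReal.toReal_ofReal (hm0 _)] using this
  refine ⟨a, fun x => F₁ x - F₂ x, m, hm0, hms, ?_, fun n hn => ?_, fun n hn => ?_,
    fun n => ⟨(ham n).aestronglyMeasurable, has n, fun x => ?_, ?_⟩, ?_, fun x hx => ?_,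
    fun s x => ?_, hFs, ?_⟩
  · rw [← ENNReal.ofReal_tsum_of_nonneg hm0 hms, ENNReal.ofReal_le_ofReal_iff (by positivity)]
      at hmE
    exact hmE
  · refine haT' n fun hnT => ?_
    rw [hmT n hnT] at hn
    exact (h.pos (c n) (8 * r n) (by linarith [(hT n hnT).2.1])).ne' hn
  · have hnT : n ∈ T := by
      by_contra hnT
      exact hn (hmT' n hnT)
    exact ⟨⟨c n, 8 * r n, by linarith [(hT n hnT).2.1]⟩, hmT n hnT, hasT n hnT⟩
  · refine (norm_sub_le _ _).trans (add_le_add ?_ ?_)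
    · refine (norm_indicator_le_norm_self _ _).trans (by simp)
    · exact (norm_indicator_le_norm_self _ _).trans ((hηn n).trans hAl)
  · have h1 : Integrable ((S n).indicator fun _ => (1 : ℂ)) μ := by
      refine (integrable_indicator_iff (hSm n)).2 (integrableOn_const ?_)
      by_cases hn : n ∈ T
      · exact measure_ne_top_of_subset ((hST n hn).trans Set.inter_subset_left) hEt
      · simp [hST' n hn]
    have h2 : Integrable ((Q n).indicator fun _ => (η n : ℂ)) μ :=
      (integrable_indicator_iff (hQm n)).2 (integrableOn_const (hQt n))
    simp only [a]
    rw [integral_sub h1 h2, integral_indicator (hSm n), integral_indicator (hQm n),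
      setIntegral_const, setIntegral_const, Complex.real_smul, Complex.real_smul, mul_one]
    by_cases hn : n ∈ T
    · have hq : μ.real (Q n) ≠ 0 := by
        rw [hQT n hn]; exact (h.pos _ _ (hT n hn).2.1).ne'
      have : μ.real (Q n) * η n = μ.real (S n) := mul_div_cancel₀ _ hq
      rw [← Complex.ofReal_mul, this, sub_self]
    · simp [hST' n hn, hQT' n hn]
  · exact aestronglyMeasurable_of_tendsto_ae atTop
      (f := fun (k : ℕ) x => ∑ n ∈ Finset.range k, a n x)
      (fun k => (Finset.measurable_fun_sum _ fun n _ => ham n).aestronglyMeasurable)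
      (ae_of_all _ fun x => (hFs x).tendsto_sum_nat)
  · by_contra hxb
    have h0 : ∀ n, a n x = 0 := fun n => by
      by_contra hne
      exact hxb (has n hne)
    have := hFs x
    simp only [h0] at this
    exact hx (this.unique hasSum_zero)
  · have h1 : F₁ x - F₂ x - ∑ n ∈ s, a n x =
        (F₁ x - ∑ n ∈ s, (S n).indicator (fun _ => (1 : ℂ)) x) -
        (F₂ x - ∑ n ∈ s, (Q n).indicator (fun _ => (η n : ℂ)) x) := by
      simp only [a, Finset.sum_sub_distrib]
      ring
    rw [h1]
    exact (norm_sub_le _ _).trans (add_le_add (hF₁b x s) ((hF₂b x s).trans hAl))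
  · filter_upwards [hcov] with x hx
    have h1 : E.indicator 1 x = F₁ x := by
      by_cases hxE : x ∈ E
      · have hxw : w x = 1 := Set.indicator_of_mem hxE _
        -- The condition `lam < 1` puts all of `E` in the set where `w` exceeds `lam`.
        obtain ⟨n, hn, hxn⟩ := hx (hEs hxE) (by rw [hxw]; exact hl1)
        have hxG : x ∈ ⋃ n, S n := by
          rw [iUnion_disjointed]
          refine Set.mem_iUnion.2 ⟨n, ?_⟩
          simp only [G, if_pos hn]
          exact ⟨hxE, hxn⟩
        obtain ⟨k, hk⟩ := Set.mem_iUnion.1 hxG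
        rw [Set.indicator_of_mem hxE, hF₁1 x k hk]
        rfl
      · rw [Set.indicator_of_notMem hxE, hF₁0 x fun n hn => ?_]
        by_cases hnT : n ∈ T
        · exact hxE (hST n hnT hn).1
        · rw [hST' n hnT] at hn
          exact hn
    rw [h1, sub_sub_cancel]
    exact hF₂n x

end Split

/-! ### Bounded functionals on the Hardy space are order continuous -/

section OrderContinuity

variable {X : Type*} [MetricSpace X] [MeasurableSpace X] [BorelSpace X]
variable {μ : Measure X} {A : ℝ} {D : Set (Ball X)} {p : ℝ} {q : ℝ≥0∞}
variable {V : Type*} [NormedAddCommGroup V] [NormedSpace ℂ V] {rep : V → (X → ℂ) → Prop}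

/-- A uniformly bounded, almost everywhere convergent series of functions with vanishing integral,
all supported in one ball, also converges in the ambient space. -/
theorem IsAmbient.hasSum_of_bounded (h : IsDoublingWith μ A) (hV : IsAmbient μ D p rep)
    {B : Ball X} {a : ℕ → X → ℂ} {F : X → ℂ} {K : ℝ} (ha : ∀ n, Integrable (a n) μ)
    (hs : ∀ n, Function.support (a n) ⊆ B.set) (h0 : ∀ n, ∫ x, a n x ∂μ = 0)
    (hF : AEStronglyMeasurable F μ) (hFs : Function.support F ⊆ B.set)
    (hb : ∀ (s : Finset ℕ) x, ‖F x - ∑ n ∈ s, a n x‖ ≤ K)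
    (hlim : ∀ᵐ x ∂μ, HasSum (fun n => a n x) (F x)) :
    Integrable F μ ∧ ∫ x, F x ∂μ = 0 ∧
      ∀ (v : ℕ → V) (w : V), (∀ n, rep (v n) (a n)) → rep w F → HasSum v w := by
  have : Nonempty X := ⟨B.center⟩
  have hBm : MeasurableSet B.set := Metric.isOpen_ball.measurableSet
  have hBt : μ B.set ≠ ∞ := (h.lt_top _ _).ne
  have hFb : ∀ x, ‖F x‖ ≤ K := fun x => by simpa using hb ∅ x
  have hFi : Integrable F μ := MemLp.integrable_of_support h le_top
    (memLp_top_of_bound hF K (ae_of_all _ hFb)) hFs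
  have hsumrep : ∀ (s : Finset ℕ), IsIntBdd μ (∑ n ∈ s, a n) ∧
      Function.support (∑ n ∈ s, a n) ⊆ B.set ∧ ∫ x, (∑ n ∈ s, a n) x ∂μ = 0 ∧
      ∀ v : ℕ → V, (∀ n, rep (v n) (a n)) → rep (∑ n ∈ s, v n) (∑ n ∈ s, a n) := fun s => by
    have hsup : Function.support (∑ n ∈ s, a n) ⊆ B.set := fun x hx => by
      by_contra hxB
      refine hx ?_
      rw [Finset.sum_apply]
      refine Finset.sum_eq_zero fun n _ => ?_
      by_contra hne
      exact hxB (hs n hne)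
    refine ⟨⟨integrable_finsetSum' s fun n _ => ha n, B, hsup⟩, hsup, ?_, fun v hv => ?_⟩
    · simp only [Finset.sum_apply]
      rw [integral_finsetSum s fun n _ => ha n]
      exact Finset.sum_eq_zero fun n _ => h0 n
    · classical
      clear hsup
      induction s using Finset.induction_on with
      | empty => simpa using hV.rep_zero
      | insert n s hn ih =>
        rw [Finset.sum_insert hn, Finset.sum_insert hn]
        refine hV.add ⟨ha n, B, hs n⟩ ⟨integrable_finsetSum' s fun n _ => ha n, B, fun x hx => ?_⟩
          (hv n) ih
        by_contra hxB
        refine hx ?_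
        rw [Finset.sum_apply]
        refine Finset.sum_eq_zero fun n _ => ?_
        by_contra hne
        exact hxB (hs n hne)
  -- Dominated convergence along finite sets, with the constant `K` on `B` as majorant. The `L¹`
  -- convergence becomes convergence in `V` because every remainder has mean zero on the same ball.
  have hT : Tendsto (fun s : Finset ℕ => ∫ x, ‖(F - ∑ n ∈ s, a n) x‖ ∂μ) atTop (𝓝 0) := by
    rw [← integral_zero X ℝ (μ := μ)]
    refine tendsto_integral_filter_of_dominated_convergence (B.set.indicator fun _ => K) ?_ ?_
      ((integrable_indicator_iff hBm).2 (integrableOn_const hBt)) ?_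
    · exact Eventually.of_forall fun s => (hFi.sub (hsumrep s).1.1).1.norm
    · refine Eventually.of_forall fun s => ae_of_all _ fun x => ?_
      rw [norm_norm]
      by_cases hx : x ∈ B.set
      · rw [Set.indicator_of_mem hx, Pi.sub_apply, Finset.sum_apply]
        exact hb s x
      · have : (F - ∑ n ∈ s, a n) x = 0 := by
          by_contra hne
          exact hx (support_sub_subset hFs (hsumrep s).2.1 hne)
        rw [this, norm_zero, Set.indicator_of_notMem hx]
    · filter_upwards [hlim] with x hx
      have h1 := (tendsto_const_nhds (x := F x)).sub hx
      rw [sub_self] at h1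
      simpa [Finset.sum_apply] using h1.norm
  have hFint : ∫ x, F x ∂μ = 0 := by
    refine norm_le_zero_iff.1 (ge_of_tendsto' hT fun s => ?_)
    have h1 : ∫ x, F x ∂μ = ∫ x, (F - ∑ n ∈ s, a n) x ∂μ := by
      have : ∫ x, (F - ∑ n ∈ s, a n) x ∂μ = ∫ x, F x ∂μ - ∫ x, (∑ n ∈ s, a n) x ∂μ :=
        integral_sub hFi (hsumrep s).1.1
      rw [this, (hsumrep s).2.2.1, sub_zero]
    rw [h1]
    exact norm_integral_le_integral_norm _
  refine ⟨hFi, hFint, fun v w hv hw => ?_⟩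
  rw [HasSum, tendsto_iff_norm_sub_tendsto_zero]
  have hT' := hT.mul_const (μ.real B.set ^ (1 / p - 1))
  rw [zero_mul] at hT'
  refine squeeze_zero (fun _ => norm_nonneg _) (fun s => ?_) hT'
  rw [norm_sub_rev]
  have hi : ∫ x, (F - ∑ n ∈ s, a n) x ∂μ = 0 := by
    have : ∫ x, (F - ∑ n ∈ s, a n) x ∂μ = ∫ x, F x ∂μ - ∫ x, (∑ n ∈ s, a n) x ∂μ :=
      integral_sub hFi (hsumrep s).1.1
    rw [this, (hsumrep s).2.2.1, hFint, sub_zero]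
  exact hV.norm_le (hFi.sub (hsumrep s).1.1) (support_sub_subset hFs (hsumrep s).2.1) (Or.inl hi)
    (hV.sub ⟨hFi, B, hFs⟩ (hsumrep s).1 hw ((hsumrep s).2.2.2 v hv))

variable {hp : 0 < p}

/-- Split the recentred indicator into the Calderón-Zygmund sum `F` and a bounded mean-zero
remainder. The atoms of `F` live on balls of total measure at most `A ^ 3 / lam * μ.real E`, and the
remainder is a small bounded function on one fixed ball. -/
theorem IsAmbient.norm_dual_indicator_le (h : IsDoublingWith μ A) (hq : 1 ≤ q)
    (hV : IsAmbient μ D p rep) (l : hardyDual μ D p hp q rep) {C : ℝ} (hC0 : 0 ≤ C)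
    (hC : ∀ x, ‖l.1 x‖ ≤ C * hardyNorm μ D p q rep (x : V)) {z : X} {r R : ℝ} (hr : 0 < r)
    (hrR : r ≤ R) {E : Set X} (hE : MeasurableSet E) (hEs : E ⊆ Metric.ball z R) {lam : ℝ}
    (hl0 : 0 < lam) (hl1 : lam < 1) (hsmall : A * μ.real E ≤ lam * μ.real (Metric.ball z R))
    (x : atomicHardy μ D p hp q rep)
    (hx : rep x (E.indicator 1 - (Metric.ball z r).indicator
      fun _ => ((μ.real E / μ.real (Metric.ball z r) : ℝ) : ℂ))) :
    ‖l.1 x‖ ≤ C * ((1 + A ^ 3) * (A ^ 3 / lam * μ.real E) ^ (1 / p) +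
      (A ^ 3 * lam + μ.real E / μ.real (Metric.ball z r)) *
        μ.real (Metric.ball z (2 * R)) ^ (1 / p)) := by
  have : Nonempty X := ⟨z⟩
  have hA := h.pos'
  have hR : 0 < R := hr.trans_le hrR
  have hBr := h.pos z r hr
  obtain ⟨a, F, m, hm0, hms, hmle, hma, hmB, ha, hFm, hFs, hFb, hFsum, hFE⟩ :=
    h.exists_atomic_split hR hE hEs hl0 hl1 hsmall
  let B : Ball X := ⟨z, 2 * R, by positivity⟩
  have hai : ∀ n, Integrable (a n) μ := fun n => MemLp.integrable_of_support h le_top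
    (memLp_top_of_bound (ha n).1 _ (ae_of_all _ (ha n).2.2.1)) (B := B) (ha n).2.1
  obtain ⟨hFi, hF0, hFV⟩ := hV.hasSum_of_bounded h (B := B) hai (fun n => (ha n).2.1)
    (fun n => (ha n).2.2.2) hFm hFs hFb (ae_of_all _ hFsum)
  choose v hv _ using fun n => hV.exists_rep B (a n) (hai n) (ha n).2.1 (Or.inl (ha n).2.2.2)
  obtain ⟨w, hw, -⟩ := hV.exists_rep B F hFi hFs (Or.inl hF0)
  have hK : 0 < 1 + A ^ 3 := by positivity
  -- The size of the `n`-th piece as a multiple of an atom; its `p`-th power is proportional to `m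
  -- n`, so the `ℓ^p` sum is the total measure of the balls.
  let c : ℕ → ℝ := fun n => (1 + A ^ 3) * m n ^ (1 / p)
  have hc0 : ∀ n, 0 ≤ c n := fun n => mul_nonneg hK.le (Real.rpow_nonneg (hm0 n) _)
  have hcp : ∀ n, c n ^ p = (1 + A ^ 3) ^ p * m n := fun n => by
    simp only [c]
    rw [Real.mul_rpow hK.le (Real.rpow_nonneg (hm0 n) _), ← Real.rpow_mul (hm0 n),
      one_div_mul_cancel hp.ne', Real.rpow_one]
  have hdec := hV.isAtomicDecomp_of_hasSum (q := q) hp h hq hc0 (v := v) (F := w)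
    (fun n hn => by
      have hmn : m n = 0 := by
        by_contra hne
        exact (mul_pos hK (Real.rpow_pos_of_pos (lt_of_le_of_ne (hm0 n) (Ne.symm hne)) _)).ne' hn
      have := hv n
      rw [hma n hmn] at this
      exact hV.unique this hV.rep_zero)
    (fun n hn => by
      have hmn : m n ≠ 0 := fun hmn => hn (by
        simp only [c, hmn]
        rw [Real.zero_rpow (by positivity), mul_zero])
      obtain ⟨B', hB', hsB'⟩ := hmB n hmn
      refine ⟨B', a n, ?_, (ha n).2.2.2, hv n⟩
      simp only [c, hB']
      exact hasSize_of_ae_bound h hsB' (ha n).1 (ae_of_all _ (ha n).2.2.1))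
    (hFV v w hv hw) (by simp only [hcp]; exact hms.mul_left _)
  have hwn : hardyNorm μ D p q rep w ≤ (1 + A ^ 3) * (A ^ 3 / lam * μ.real E) ^ (1 / p) := by
    refine (hardyNorm_le hdec).trans ?_
    have h1 : ∀ n, ‖(c n : ℂ)‖ ^ p = (1 + A ^ 3) ^ p * m n := fun n => by
      rw [Complex.norm_real, Real.norm_of_nonneg (hc0 n), hcp]
    simp only [h1, Pi.zero_apply, norm_zero, Real.zero_rpow hp.ne', tsum_zero, add_zero]
    rw [tsum_mul_left, Real.mul_rpow (by positivity) (tsum_nonneg hm0), ← Real.rpow_mul hK.le,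
      mul_one_div_cancel hp.ne', Real.rpow_one]
    exact mul_le_mul_of_nonneg_left (Real.rpow_le_rpow (tsum_nonneg hm0) hmle (by positivity)) hK.le
  have hwmem : w ∈ atomicHardy μ D p hp q rep := ⟨_, _, hdec⟩
  set e : X → ℂ := E.indicator 1 with he
  set k : X → ℂ := (Metric.ball z r).indicator
    fun _ => ((μ.real E / μ.real (Metric.ball z r) : ℝ) : ℂ) with hk
  have hrsub : Metric.ball z r ⊆ Metric.ball z (2 * R) := Metric.ball_subset_ball (by linarith)
  have hkm : MemLp k ∞ μ := (memLp_top_const _).indicator Metric.isOpen_ball.measurableSet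
  have hEm : MemLp e ∞ μ := (memLp_top_const (1 : ℂ)).indicator hE
  have hEsup : Function.support e ⊆ B.set :=
    Set.support_indicator_subset.trans (hEs.trans (Metric.ball_subset_ball (by linarith)))
  have hksup : Function.support k ⊆ B.set := Set.support_indicator_subset.trans hrsub
  have hEi := MemLp.integrable_of_support h le_top hEm hEsup
  have hki := MemLp.integrable_of_support h le_top hkm hksup
  have hgi : IsIntBdd μ (e - k) := ⟨hEi.sub hki, B, support_sub_subset hEsup hksup⟩
  have hg0 : ∫ x, (e - k) x ∂μ = 0 := by
    have : ∫ x, (e - k) x ∂μ = ∫ x, e x ∂μ - ∫ x, k x ∂μ :=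
      integral_sub hEi hki
    rw [this, he, integral_indicator hE, hk, integral_indicator Metric.isOpen_ball.measurableSet,
      setIntegral_const, Complex.real_smul, ← Complex.ofReal_mul, mul_div_cancel₀ _ hBr.ne']
    simp
  have hrepb := hV.sub hgi ⟨hFi, B, hFs⟩ hx hw
  have hb0 : ∫ x, (e - k - F) x ∂μ = 0 := by
    have : ∫ x, (e - k - F) x ∂μ =
        ∫ x, (e - k) x ∂μ - ∫ x, F x ∂μ := integral_sub hgi.1 hFi
    rw [this, hg0, hF0, sub_zero]
  have hδ : 0 < A ^ 3 * lam + μ.real E / μ.real (Metric.ball z r) := by positivity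
  -- The pointwise bound adds the compensations, at most `A ^ 3 * lam`, to the constant subtracted
  -- on the reference ball.
  have hbsz : HasSize μ p q B ((A ^ 3 * lam + μ.real E / μ.real (Metric.ball z r)) *
      μ.real B.set ^ (1 / p)) (e - k - F) := by
    refine hasSize_of_ae_bound h (support_sub_subset (support_sub_subset hEsup hksup) hFs)
      ((hEm.1.sub hkm.1).sub hFm) ?_
    filter_upwards [hFE] with y hy
    have h1 : (e - k - F) y = (e y - F y) - k y := by
      simp only [Pi.sub_apply]; ring
    rw [h1]
    refine (norm_sub_le _ _).trans (add_le_add hy ((norm_indicator_le_norm_self _ _).trans ?_))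
    rw [Complex.norm_real, Real.norm_of_nonneg (by positivity)]
  have hBpos : 0 < μ.real B.set := h.pos z _ B.radius_pos
  have hcpos := mul_pos hδ (Real.rpow_pos_of_pos hBpos (1 / p))
  have hbmem := hV.mem_atomicHardy hp h hq hcpos hbsz (Or.inl hb0) hrepb
  have hbn := hV.hardyNorm_le_of_hasSize hp h hq hcpos hbsz (Or.inl hb0) hrepb
  have hsplit : x = ⟨w, hwmem⟩ + ⟨x - w, hbmem⟩ := Subtype.ext (by simp)
  have hl : l.1 x = l.1 ⟨w, hwmem⟩ + l.1 ⟨x - w, hbmem⟩ := by rw [← map_add, ← hsplit]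
  rw [hl]
  refine (norm_add_le _ _).trans ?_
  rw [mul_add]
  exact add_le_add ((hC _).trans (mul_le_mul_of_nonneg_left hwn hC0))
    ((hC _).trans (mul_le_mul_of_nonneg_left hbn hC0))

/-- Bounded functionals on the Hardy space are order continuous. -/
theorem IsAmbient.exists_norm_dual_indicator_le (h : IsDoublingWith μ A) (hq : 1 ≤ q)
    (hV : IsAmbient μ D p rep) (l : hardyDual μ D p hp q rep) (z : X) {r R : ℝ} (hr : 0 < r)
    (hrR : r ≤ R) {ε : ℝ} (hε : 0 < ε) :
    ∃ δ : ℝ, 0 < δ ∧ ∀ E : Set X, MeasurableSet E → E ⊆ Metric.ball z R → μ.real E < δ →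
      ∀ x : atomicHardy μ D p hp q rep, rep x (E.indicator 1 - (Metric.ball z r).indicator
        fun _ => ((μ.real E / μ.real (Metric.ball z r) : ℝ) : ℂ)) → ‖l.1 x‖ ≤ ε := by
  have hA := h.pos'
  have hR : 0 < R := hr.trans_le hrR
  obtain ⟨C, hC0, hC⟩ : ∃ C : ℝ, 0 ≤ C ∧ ∀ x, ‖l.1 x‖ ≤ C * hardyNorm μ D p q rep (x : V) := by
    obtain ⟨C, hC⟩ := l.2
    exact ⟨|C|, abs_nonneg C, fun x => (hC x).trans (mul_le_mul_of_nonneg_right (le_abs_self C)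
      (hardyNorm_nonneg _ _ _ _ _ _))⟩
  set K := μ.real (Metric.ball z (2 * R)) ^ (1 / p) with hK
  have hK0 : 0 ≤ K := by positivity
  -- The height is fixed first, to make the term independent of `E` small; only then is `μ(E)` taken
  -- small depending on it.
  obtain ⟨lam, hl0, hl1, hlε⟩ : ∃ lam : ℝ, 0 < lam ∧ lam < 1 ∧ C * (A ^ 3 * lam * K) < ε := by
    have hQ : 0 ≤ C * A ^ 3 * K := by positivity
    refine ⟨min (1 / 2) (ε / (2 * (C * A ^ 3 * K + 1))), by positivity,
      (min_le_left _ _).trans_lt (by norm_num), ?_⟩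
    have h1 : min (1 / 2) (ε / (2 * (C * A ^ 3 * K + 1))) ≤ ε / (2 * (C * A ^ 3 * K + 1)) :=
      min_le_right _ _
    rw [le_div_iff₀ (by positivity)] at h1
    have h2 : 0 < min (1 / 2) (ε / (2 * (C * A ^ 3 * K + 1))) := by positivity
    nlinarith
  let Ψ : ℝ → ℝ := fun t => C * ((1 + A ^ 3) * (A ^ 3 / lam * t) ^ (1 / p) +
      (A ^ 3 * lam + t / μ.real (Metric.ball z r)) * K)
  have hΨ : ContinuousAt Ψ 0 := by
    refine ContinuousAt.mul continuousAt_const (ContinuousAt.add (ContinuousAt.mul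
      continuousAt_const (ContinuousAt.rpow_const (by fun_prop) (Or.inr (by positivity)))) ?_)
    fun_prop
  have hΨ0 : Ψ 0 < ε := by
    simp only [Ψ, mul_zero, zero_div, add_zero]
    rw [Real.zero_rpow (by positivity), mul_zero, zero_add]
    exact hlε
  obtain ⟨δ, hδ, hδΨ⟩ := Metric.eventually_nhds_iff.1 (hΨ.eventually_lt_const hΨ0)
  have hBR := h.pos z R hR
  -- The second entry is the smallness that the stopping time at height `lam` requires.
  refine ⟨min δ (lam * μ.real (Metric.ball z R) / A), by positivity, fun E hE hEs hEδ x hx => ?_⟩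
  have h1 := hδΨ (y := μ.real E) (by
    rw [Real.dist_eq, sub_zero, abs_of_nonneg measureReal_nonneg]
    exact hEδ.trans_le (min_le_left _ _))
  have h2 : A * μ.real E ≤ lam * μ.real (Metric.ball z R) := by
    have := hEδ.le.trans (min_le_right _ _)
    rwa [le_div_iff₀ hA, mul_comm] at this
  exact (hV.norm_dual_indicator_le h hq l hC0 hC hr hrR hE hEs hl0 hl1 h2 x hx).trans h1.le

end OrderContinuity

/-! ### Construction of the function representing a functional -/

theorem IsBddBddSupp.exists_ball {X : Type*} [MetricSpace X] [MeasurableSpace X]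
    {μ : Measure X} [Nonempty X] {g : X → ℂ} (hg : IsBddBddSupp μ g) :
    ∃ B : Ball X, Function.support g ⊆ B.set := by
  obtain ⟨R, hR⟩ := hg.2.subset_ball (Classical.arbitrary X)
  exact ⟨⟨Classical.arbitrary X, max R 1, by positivity⟩,
    hR.trans (Metric.ball_subset_ball (le_max_left R 1))⟩

theorem norm_integral_le_of_ball {X : Type*} [MetricSpace X] [MeasurableSpace X]
    {μ : Measure X} {A : ℝ} (h : IsDoublingWith μ A) {B : Ball X} {g : X → ℂ} {c : ℝ}
    (hs : Function.support g ⊆ B.set) (hc : ∀ᵐ x ∂μ, ‖g x‖ ≤ c) :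
    ‖∫ x, g x ∂μ‖ ≤ c * μ.real B.set := by
  have h1 : ∫ x, g x ∂μ = ∫ x in B.set, g x ∂μ :=
    (setIntegral_eq_integral_of_forall_compl_eq_zero fun x hx => by
      by_contra h0
      exact hx (hs h0)).symm
  rw [h1]
  exact norm_setIntegral_le_of_norm_le_const_ae (h.lt_top _ _) (ae_restrict_of_ae hc)

section DualFunction

variable {X : Type*} [MetricSpace X] [MeasurableSpace X] [BorelSpace X]
variable {μ : Measure X} {A : ℝ} {D : Set (Ball X)} {p : ℝ} {q : ℝ≥0∞}

theorem IsBddBddSupp.isIntBdd [Nonempty X] (h : IsDoublingWith μ A) {g : X → ℂ}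
    (hg : IsBddBddSupp μ g) : IsIntBdd μ g := by
  obtain ⟨B, hB⟩ := hg.exists_ball
  exact ⟨MemLp.integrable_of_support h le_top hg.1 hB, B, hB⟩

/-- Subtraction of a multiple of the indicator of `B`, to make the integral vanish. -/
noncomputable def recenter (μ : Measure X) (B : Ball X) (g : X → ℂ) : X → ℂ :=
  g - B.set.indicator fun _ => (∫ y, g y ∂μ) / (μ.real B.set : ℂ)

theorem isBddBddSupp_const_indicator (B : Ball X) (c : ℂ) :
    IsBddBddSupp μ (B.set.indicator fun _ => c) :=
  isBddBddSupp_of_ball ((memLp_top_const c).indicator Metric.isOpen_ball.measurableSet)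
    Set.support_indicator_subset

theorem IsBddBddSupp.recenter (B : Ball X) {g : X → ℂ} (hg : IsBddBddSupp μ g) :
    IsBddBddSupp μ (recenter μ B g) :=
  hg.sub (isBddBddSupp_const_indicator B _)

theorem integral_const_indicator (B : Ball X) (c : ℂ) :
    ∫ x, B.set.indicator (fun _ => c) x ∂μ = (μ.real B.set : ℂ) * c := by
  rw [integral_indicator (show MeasurableSet B.set from Metric.isOpen_ball.measurableSet),
    setIntegral_const, Complex.real_smul]

theorem integral_recenter (h : IsDoublingWith μ A) (B : Ball X) {g : X → ℂ}
    (hg : IsBddBddSupp μ g) : ∫ x, recenter μ B g x ∂μ = 0 := by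
  have : Nonempty X := ⟨B.center⟩
  have hB : μ.real B.set ≠ 0 := (h.pos B.center _ B.radius_pos).ne'
  have h1 : ∫ x, recenter μ B g x ∂μ = ∫ x, g x ∂μ -
      ∫ x, B.set.indicator (fun _ => (∫ y, g y ∂μ) / (μ.real B.set : ℂ)) x ∂μ :=
    integral_sub (hg.isIntBdd h).1 ((isBddBddSupp_const_indicator B _).isIntBdd h).1
  rw [h1, integral_const_indicator, mul_div_cancel₀ _ (by exact_mod_cast hB), sub_self]

variable {V : Type*} [NormedAddCommGroup V] [NormedSpace ℂ V] {rep : V → (X → ℂ) → Prop}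
variable {hp : 0 < p}

theorem IsAmbient.norm_dual_le (h : IsDoublingWith μ A) (hq : 1 ≤ q)
    (hV : IsAmbient μ D p rep) (l : hardyDual μ D p hp q rep) {C : ℝ} (hC0 : 0 ≤ C)
    (hC : ∀ x, ‖l.1 x‖ ≤ C * hardyNorm μ D p q rep (x : V)) {B : Ball X} {g : X → ℂ} {c : ℝ}
    (hc : 0 < c) (hs : Function.support g ⊆ B.set) (hg : AEStronglyMeasurable g μ)
    (hb : ∀ᵐ x ∂μ, ‖g x‖ ≤ c) (hcan : Cancels μ D B g) (x : atomicHardy μ D p hp q rep)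
    (hx : rep x g) : ‖l.1 x‖ ≤ C * (c * μ.real B.set ^ (1 / p)) := by
  have hBpos : 0 < μ.real B.set := h.pos B.center _ B.radius_pos
  exact (hC x).trans (mul_le_mul_of_nonneg_left (hV.hardyNorm_le_of_hasSize hp h hq (by positivity)
    (hasSize_of_ae_bound h hs hg hb) hcan hx) hC0)

theorem IsAmbient.exists_mem_rep (h : IsDoublingWith μ A) (hq : 1 ≤ q)
    (hV : IsAmbient μ D p rep) {B : Ball X} {g : X → ℂ} (hs : Function.support g ⊆ B.set)
    (hg : MemLp g ∞ μ) (hcan : Cancels μ D B g) :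
    ∃ x : atomicHardy μ D p hp q rep, rep x g := by
  have hBpos : 0 < μ.real B.set := h.pos B.center _ B.radius_pos
  obtain ⟨c, hc, hgc⟩ := exists_ae_norm_le hg
  obtain ⟨v, hv, -⟩ := hV.exists_rep B g (MemLp.integrable_of_support h le_top hg hs) hs hcan
  exact ⟨⟨v, hV.mem_atomicHardy hp h hq (by positivity)
    (hasSize_of_ae_bound h hs hg.1 hgc) hcan hv⟩, hv⟩

/-- Every bounded functional on the Hardy space is given by a function on bounded elements. -/
theorem IsAmbient.exists_function [Nonempty X] (h : IsDoublingWith μ A) (hq : 1 ≤ q)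
    (hV : IsAmbient μ D p rep) (l : hardyDual μ D p hp q rep) :
    ∃ f : X → ℂ, (∀ B : Ball X, IntegrableOn f B.set μ) ∧
      ∀ (x : atomicHardy μ D p hp q rep) (B : Ball X) (g : X → ℂ),
        Function.support g ⊆ B.set → MemLp g ∞ μ → Cancels μ D B g → rep x g →
        l.1 x = ∫ y, f y * g y ∂μ := by
  classical
  obtain ⟨C, hC0, hC⟩ : ∃ C : ℝ, 0 ≤ C ∧ ∀ x, ‖l.1 x‖ ≤ C * hardyNorm μ D p q rep (x : V) := by
    obtain ⟨C, hC⟩ := l.2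
    exact ⟨|C|, abs_nonneg C, fun x => (hC x).trans (mul_le_mul_of_nonneg_right (le_abs_self C)
      (hardyNorm_nonneg _ _ _ _ _ _))⟩
  -- A reference ball, taken from `D` when possible, with `κ` the value of `l` on its indicator. If
  -- `D` is empty, only mean-zero functions are to be tested and `f` matters only up to a constant,
  -- so `κ = 0` serves as well as any other value.
  obtain ⟨B₀, κ, hκ⟩ : ∃ (B₀ : Ball X) (κ : ℂ), D = ∅ ∨
      ∃ x₀ : atomicHardy μ D p hp q rep, rep x₀ (B₀.set.indicator fun _ => 1) ∧ l.1 x₀ = κ := by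
    rcases D.eq_empty_or_nonempty with hD | ⟨B₀, hB₀⟩
    · exact ⟨⟨Classical.arbitrary X, 1, one_pos⟩, 0, Or.inl hD⟩
    · obtain ⟨x₀, hx₀⟩ := hV.exists_mem_rep (hp := hp) h hq (B := B₀)
        (g := B₀.set.indicator fun _ => 1) Set.support_indicator_subset
        (isBddBddSupp_const_indicator B₀ 1).1 (Or.inr hB₀)
      exact ⟨B₀, l.1 x₀, Or.inr ⟨x₀, hx₀, rfl⟩⟩
  set β := μ.real B₀.set with hβ
  have hβ0 : 0 < β := h.pos B₀.center _ B₀.radius_pos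
  have hJex : ∀ g, IsBddBddSupp μ g → ∃ x : atomicHardy μ D p hp q rep, rep x (recenter μ B₀ g) :=
    fun g hg => by
      obtain ⟨B, hB⟩ := (hg.recenter B₀).exists_ball
      exact hV.exists_mem_rep h hq hB (hg.recenter B₀).1 (Or.inl (integral_recenter h B₀ hg))
  choose J hJ using hJex
  -- Not every bounded function need lie in the Hardy space. `Λ` extends `l` to all of them: the
  -- recentred part is given to `l`, and the multiple of the reference indicator receives the value
  -- `κ`.
  let Λ : (X → ℂ) → ℂ := fun g =>
    if hg : IsBddBddSupp μ g then l.1 (J g hg) + κ * ((∫ y, g y ∂μ) / (β : ℂ)) else 0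
  have hΛ : ∀ (g : X → ℂ), IsBddBddSupp μ g → ∀ x : atomicHardy μ D p hp q rep,
      rep x (recenter μ B₀ g) → Λ g = l.1 x + κ * ((∫ y, g y ∂μ) / (β : ℂ)) := fun g hg x hx => by
    have h1 : J g hg = x := Subtype.ext (hV.unique (hJ g hg) hx)
    simp only [Λ, dif_pos hg, h1]
  have hadd : ∀ f g, IsBddBddSupp μ f → IsBddBddSupp μ g → Λ (f + g) = Λ f + Λ g :=
    fun f g hf hg => by
      have hi : ∫ y, (f + g) y ∂μ = ∫ y, f y ∂μ + ∫ y, g y ∂μ :=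
        integral_add (hf.isIntBdd h).1 (hg.isIntBdd h).1
      have h1 : recenter μ B₀ (f + g) = recenter μ B₀ f + recenter μ B₀ g := by
        funext y
        simp only [recenter, hi]
        by_cases hy : y ∈ B₀.set
        · simp [hy]; ring
        · simp [hy]
      have h2 := hV.add ((hf.recenter B₀).isIntBdd h) ((hg.recenter B₀).isIntBdd h)
        (hJ f hf) (hJ g hg)
      rw [← h1] at h2
      rw [hΛ (f + g) (hf.add hg) (J f hf + J g hg) h2, hΛ f hf _ (hJ f hf), hΛ g hg _ (hJ g hg),
        map_add, hi]
      ring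
  have hsmul : ∀ (c : ℂ) f, IsBddBddSupp μ f → Λ (c • f) = c * Λ f := fun c f hf => by
    have hi : ∫ y, (c • f) y ∂μ = c * ∫ y, f y ∂μ := by
      simp only [Pi.smul_apply, smul_eq_mul]
      exact integral_const_mul c f
    have h1 : recenter μ B₀ (c • f) = c • recenter μ B₀ f := by
      funext y
      simp only [recenter, hi]
      by_cases hy : y ∈ B₀.set
      · simp [hy]; ring
      · simp [hy]
    have h2 := hV.smul c ((hf.recenter B₀).isIntBdd h) (hJ f hf)
    rw [← h1] at h2
    rw [hΛ (c • f) (hf.smul c) (c • J f hf) h2, hΛ f hf _ (hJ f hf), map_smul, hi, smul_eq_mul]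
    ring
  obtain ⟨f, hf, hfΛ⟩ := exists_density h B₀.center hadd hsmul (fun R hR => by
    -- The ball must contain the support of `g` and also `B₀`, where the correction lives.
    let B : Ball X := ⟨B₀.center, max R B₀.radius, by positivity⟩
    have hB₀B : B₀.set ⊆ B.set := Metric.ball_subset_ball (le_max_right _ _)
    have hk0 : 0 ≤ μ.real B.set / β := by positivity
    refine ⟨C * ((1 + μ.real B.set / β) * μ.real B.set ^ (1 / p)) + ‖κ‖ * (μ.real B.set / β),
      fun g c hg hs hc hgc => ?_⟩
    have hgB : Function.support g ⊆ B.set := hs.trans (Metric.ball_subset_ball (le_max_left _ _))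
    have hint : ‖(∫ y, g y ∂μ) / (β : ℂ)‖ ≤ c * (μ.real B.set / β) := by
      rw [norm_div, Complex.norm_real, Real.norm_of_nonneg hβ0.le, ← mul_div_assoc]
      exact div_le_div_of_nonneg_right (norm_integral_le_of_ball h hgB hgc) hβ0.le
    rw [hΛ g hg _ (hJ g hg)]
    refine (norm_add_le _ _).trans ?_
    have h1 : ‖l.1 (J g hg)‖ ≤ C * ((c * (1 + μ.real B.set / β)) * μ.real B.set ^ (1 / p)) := by
      refine hV.norm_dual_le h hq l hC0 hC (by positivity) (g := recenter μ B₀ g)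
        (support_sub_subset hgB (Set.support_indicator_subset.trans hB₀B)) (hg.recenter B₀).1.1
        ?_ (Or.inl (integral_recenter h B₀ hg)) _ (hJ g hg)
      filter_upwards [hgc] with y hy
      refine (norm_sub_le _ _).trans ((add_le_add hy ((norm_indicator_le_norm_self
        (fun _ : X => (∫ y, g y ∂μ) / (β : ℂ)) y).trans hint)).trans_eq ?_)
      ring
    have h2 : ‖κ * ((∫ y, g y ∂μ) / (β : ℂ))‖ ≤ ‖κ‖ * (c * (μ.real B.set / β)) := by
      rw [norm_mul]
      exact mul_le_mul_of_nonneg_left hint (norm_nonneg κ)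
    exact (add_le_add h1 h2).trans_eq (by ring)) (fun R hR ε hε => by
    obtain ⟨δ, hδ, hδE⟩ := hV.exists_norm_dual_indicator_le h hq l B₀.center B₀.radius_pos
      (le_max_right R B₀.radius) (half_pos hε)
    -- The first entry controls the recentred part, the second the term with `κ`; each contributes
    -- at most `ε / 2`.
    refine ⟨min δ (ε * β / (2 * (‖κ‖ + 1))), by positivity, fun E hE hEs hEδ => ?_⟩
    have hEb : IsBddBddSupp μ (E.indicator 1 : X → ℂ) := isBddBddSupp_indicator hE hEs
    have hEi : ∫ y, E.indicator (1 : X → ℂ) y ∂μ = (μ.real E : ℂ) := by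
      rw [integral_indicator hE]
      simp
    rw [hΛ _ hEb _ (hJ _ hEb)]
    refine (norm_add_le _ _).trans ?_
    have h1 : ‖l.1 (J _ hEb)‖ ≤ ε / 2 := by
      refine hδE E hE (hEs.trans (Metric.ball_subset_ball (le_max_left _ _)))
        (hEδ.trans_le (min_le_left _ _)) _ ?_
      have := hJ _ hEb
      simp only [recenter, hEi] at this
      push_cast
      exact this
    have h2 : ‖κ * ((∫ y, E.indicator (1 : X → ℂ) y ∂μ) / (β : ℂ))‖ ≤ ε / 2 := by
      rw [hEi, norm_mul, norm_div, Complex.norm_real, Complex.norm_real,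
        Real.norm_of_nonneg hβ0.le, Real.norm_of_nonneg measureReal_nonneg, ← mul_div_assoc,
        div_le_iff₀ hβ0]
      have h3 := hEδ.le.trans (min_le_right _ _)
      rw [le_div_iff₀ (by positivity)] at h3
      nlinarith [norm_nonneg κ, measureReal_nonneg (μ := μ) (s := E)]
    linarith)
  refine ⟨f, hf, fun x B g hs hg hcan hx => ?_⟩
  have hgb : IsBddBddSupp μ g := isBddBddSupp_of_ball hg hs
  rw [← hfΛ g hgb]
  by_cases hg0 : ∫ y, g y ∂μ = 0
  · have h1 : recenter μ B₀ g = g := by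
      funext y
      simp [recenter, hg0]
    rw [hΛ g hgb x (by rwa [h1]), hg0, zero_div, mul_zero, add_zero]
  -- A nonzero integral forces `B ∈ D`, so `D` is nonempty and the reference indicator does
  -- represent an element with value `κ`; subtracting its multiple leaves the recentred function.
  · have hBD : B ∈ D := hcan.resolve_left hg0
    obtain ⟨x₀, hx₀, hlx₀⟩ := hκ.resolve_left fun hD => by simp [hD] at hBD
    set c : ℂ := (∫ y, g y ∂μ) / (β : ℂ) with hc
    have hib := (isBddBddSupp_const_indicator (μ := μ) B₀ 1).isIntBdd h
    have h1 := hV.sub (hgb.isIntBdd h) (hib.smul c) hx (hV.smul c hib hx₀)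
    have h2 : g - c • B₀.set.indicator (fun _ => (1 : ℂ)) = recenter μ B₀ g := by
      funext y
      by_cases hy : y ∈ B₀.set <;> simp [recenter, hy, hc, hβ]
    rw [h2] at h1
    rw [hΛ g hgb (x - c • x₀) h1, map_sub, map_smul, hlx₀, smul_eq_mul, ← hc]
    ring

end DualFunction

/-! ### Recovering the Morrey-Campanato norm by testing -/

section Testing

variable {X : Type*} [MetricSpace X] [MeasurableSpace X]
variable {μ : Measure X} {A : ℝ} {D : Set (Ball X)} {p : ℝ} {q : ℝ≥0∞} {α : ℝ} {f : X → ℂ}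

theorem lintegral_div_le_ofReal_iff (h : IsDoublingWith μ A) {B : Ball X} {F : X → ℂ} {s M : ℝ}
    (hF : IntegrableOn F B.set μ) (hM : 0 ≤ M) :
    (∫⁻ y in B.set, ‖F y‖ₑ ∂μ) / μ B.set ^ s ≤ ENNReal.ofReal M ↔
      ∫ y in B.set, ‖F y‖ ∂μ ≤ M * μ.real B.set ^ s := by
  have hB0 : μ B.set ≠ 0 := (h.measure_pos _ B.radius_pos).ne'
  have hBt : μ B.set ≠ ∞ := (h.lt_top _ _).ne
  have h1 : μ B.set ^ s ≠ ∞ := ENNReal.rpow_ne_top_of_ne_zero hB0 hBt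
  have h2 : μ B.set ^ s ≠ 0 := by simp [ENNReal.rpow_eq_zero_iff, hB0, hBt]
  rw [ENNReal.div_le_iff h2 h1, ← ofReal_integral_norm_eq_lintegral_enorm hF,
    ← ENNReal.ofReal_toReal h1, ← ENNReal.ofReal_mul hM,
    ENNReal.ofReal_le_ofReal_iff (by positivity), ← ENNReal.toReal_rpow]
  rfl

theorem setIntegral_norm_sub_average_le (h : IsDoublingWith μ A) {B : Ball X}
    (hf : IntegrableOn f B.set μ) :
    ∫ y in B.set, ‖f y - ⨍ z in B.set, f z ∂μ‖ ∂μ ≤ 2 * ∫ y in B.set, ‖f y‖ ∂μ := by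
  have hBt : μ B.set < ∞ := h.lt_top _ _
  have h0 := norm_setAverage_sub_mul_le subset_rfl hf hBt 0
  simp only [sub_zero] at h0
  have h1 : ∫ y in B.set, ‖f y - ⨍ z in B.set, f z ∂μ‖ ∂μ ≤
      ∫ y in B.set, (‖f y‖ + ‖⨍ z in B.set, f z ∂μ‖) ∂μ :=
    integral_mono (hf.sub (integrableOn_const hBt.ne)).norm
      (hf.norm.add (integrableOn_const hBt.ne)) fun y => norm_sub_le _ _
  rw [integral_add hf.norm (integrableOn_const hBt.ne), setIntegral_const, smul_eq_mul] at h1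
  linarith

/-- The norm of `ℰ^{α,1}_D` controls the oscillation over all balls. -/
theorem isMCBound_of_mcENorm_lt_top (h : IsDoublingWith μ A)
    (hf : ∀ B : Ball X, IntegrableOn f B.set μ) (hfin : mcENorm μ D α f < ∞) {M : ℝ}
    (hM : 2 * mcNorm μ D α f ≤ M) : IsMCBound μ D α f M := by
  have hN0 : 0 ≤ mcNorm μ D α f := ENNReal.toReal_nonneg
  have hN : ENNReal.ofReal (mcNorm μ D α f) = mcENorm μ D α f := ENNReal.ofReal_toReal hfin.ne
  have hsize : ∀ B ∈ D, ∫ y in B.set, ‖f y‖ ∂μ ≤ mcNorm μ D α f * μ.real B.set ^ (1 + α) :=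
    fun B hB => by
      rw [← lintegral_div_le_ofReal_iff h (hf B) hN0, hN]
      exact (le_iSup₂ (f := fun (B : Ball X) (_ : B ∈ D) =>
        (∫⁻ y in B.set, ‖f y‖ₑ ∂μ) / μ B.set ^ (1 + α)) B hB).trans le_add_self
  have hpow : ∀ B : Ball X, 0 ≤ μ.real B.set ^ (1 + α) := fun B => by positivity
  refine ⟨by linarith, fun x r hr => hf ⟨x, r, hr⟩, fun x r hr => ?_, fun B hB => ?_⟩
  · let B : Ball X := ⟨x, r, hr⟩
    change ∫ y in B.set, ‖f y - ⨍ z in B.set, f z ∂μ‖ ∂μ ≤ M * μ.real B.set ^ (1 + α)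
    refine le_trans ?_ (mul_le_mul_of_nonneg_right hM (hpow B))
    -- Balls of `D` enter the norm through their mean size; this bounds the oscillation up to the
    -- factor `2`, which is why `M` is at least twice the norm.
    by_cases hB : B ∈ D
    · have h1 := setIntegral_norm_sub_average_le h (hf B)
      have h2 := hsize B hB
      linarith
    · have h1 : ∫ y in B.set, ‖f y - ⨍ z in B.set, f z ∂μ‖ ∂μ ≤
          mcNorm μ D α f * μ.real B.set ^ (1 + α) := by
        have hfb : IntegrableOn (fun y => f y - ⨍ z in B.set, f z ∂μ) B.set μ :=
          (hf B).sub (integrableOn_const (h.lt_top _ _).ne)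
        rw [← lintegral_div_le_ofReal_iff h hfb hN0, hN]
        exact (le_iSup₂ (f := fun (B : Ball X) (_ : B ∈ Dᶜ) =>
          (∫⁻ y in B.set, ‖f y - ⨍ z in B.set, f z ∂μ‖ₑ ∂μ) / μ B.set ^ (1 + α)) B hB).trans
            le_self_add
      have h2 := mul_nonneg hN0 (hpow B)
      linarith
  · refine (hsize B hB).trans (mul_le_mul_of_nonneg_right (by linarith) (hpow B))

theorem integrable_mul_of_isBddBddSupp (hf : ∀ B : Ball X, IntegrableOn f B.set μ) {g : X → ℂ}
    (hg : IsBddBddSupp μ g) : Integrable (fun y => f y * g y) μ := by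
  rcases isEmpty_or_nonempty X with hX | hX
  · rw [μ.eq_zero_of_isEmpty]
    exact integrable_zero_measure
  · obtain ⟨B, hB⟩ := hg.exists_ball
    obtain ⟨c, -, hc⟩ := exists_ae_norm_le hg.1
    rw [← integrableOn_iff_integrable_of_support_subset
      ((Function.support_mul_subset_right f g).trans hB)]
    exact (hf B).mul_bdd hg.1.1.restrict (ae_restrict_of_ae hc)

variable [BorelSpace X]

theorem exists_sign {B : Ball X} {F : X → ℂ} (hF : IntegrableOn F B.set μ) :
    ∃ s : X → ℂ, Function.support s ⊆ B.set ∧ AEStronglyMeasurable s μ ∧ (∀ x, ‖s x‖ ≤ 1) ∧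
      ∀ x ∈ B.set, F x * s x = ‖F x‖ := by
  have hB : MeasurableSet B.set := Metric.isOpen_ball.measurableSet
  have hσ : Measurable fun z : ℂ => (starRingEnd ℂ) z / (‖z‖ : ℂ) := by fun_prop
  refine ⟨B.set.indicator fun x => (starRingEnd ℂ) (F x) / (‖F x‖ : ℂ),
    Set.support_indicator_subset, ?_, fun x => ?_, fun x hx => ?_⟩
  · rw [aestronglyMeasurable_indicator_iff hB]
    exact (hσ.comp_aemeasurable hF.aestronglyMeasurable.aemeasurable).aestronglyMeasurable
  · refine (norm_indicator_le_norm_self _ _).trans ?_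
    rw [norm_div, RCLike.norm_conj, Complex.norm_real, norm_norm]
    exact div_self_le_one _
  · rw [Set.indicator_of_mem hx]
    by_cases h0 : F x = 0
    · simp [h0]
    · have : (‖F x‖ : ℂ) ≠ 0 := by simpa using h0
      rw [← mul_div_assoc, Complex.mul_conj, Complex.normSq_eq_norm_sq, div_eq_iff this]
      push_cast
      ring

/-- Test with the conjugate sign `s`. On balls outside `D` it is recentred, which at most doubles
its sup norm and does not change its pairing with `f - f_B`; on balls of `D` it is used as it
stands. The two suprema contribute `2 * C` and `C`. -/
theorem mcENorm_le_of_testing (h : IsDoublingWith μ A)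
    (hf : ∀ B : Ball X, IntegrableOn f B.set μ) {C : ℝ} (hC : 0 ≤ C)
    (htest : ∀ (B : Ball X) (g : X → ℂ) (c : ℝ), Function.support g ⊆ B.set → MemLp g ∞ μ →
      Cancels μ D B g → 0 < c → (∀ᵐ x ∂μ, ‖g x‖ ≤ c) →
      ‖∫ y, f y * g y ∂μ‖ ≤ C * (c * μ.real B.set ^ (1 / p))) :
    mcENorm μ D (1 / p - 1) f ≤ ENNReal.ofReal (3 * C) := by
  have hexp : 1 + (1 / p - 1) = 1 / p := by ring
  have hset : ∀ {B : Ball X} {g : X → ℂ}, Function.support g ⊆ B.set →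
      ∫ y, g y ∂μ = ∫ y in B.set, g y ∂μ := fun {B g} hs =>
    (setIntegral_eq_integral_of_forall_compl_eq_zero fun x hx => by
      by_contra h0
      exact hx (hs h0)).symm
  have hsupp : ∀ {B : Ball X} {g : X → ℂ}, Function.support g ⊆ B.set →
      Function.support (fun y => f y * g y) ⊆ B.set := fun hs =>
    (Function.support_mul_subset_right f _).trans hs
  rw [show 3 * C = 2 * C + C by ring, ENNReal.ofReal_add (by positivity) hC]
  refine add_le_add (iSup₂_le fun B hB => ?_) (iSup₂_le fun B hB => ?_)
  · have : Nonempty X := ⟨B.center⟩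
    have hBt : μ B.set < ∞ := h.lt_top _ _
    have hB0 : 0 < μ.real B.set := h.pos B.center _ B.radius_pos
    set b := ⨍ z in B.set, f z ∂μ with hb
    have hfb : IntegrableOn (fun y => f y - b) B.set μ := (hf B).sub (integrableOn_const hBt.ne)
    rw [lintegral_div_le_ofReal_iff h hfb (by positivity), hexp]
    obtain ⟨s, hs, hsm, hs1, hfs⟩ := exists_sign hfb
    have hsb : IsBddBddSupp μ s :=
      isBddBddSupp_of_ball (memLp_top_of_bound hsm 1 (ae_of_all _ hs1)) hs
    set c := (∫ y, s y ∂μ) / (μ.real B.set : ℂ) with hc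
    have hc1 : ‖c‖ ≤ 1 := by
      rw [hc, norm_div, Complex.norm_real, Real.norm_of_nonneg hB0.le, div_le_one hB0]
      simpa using norm_integral_le_of_ball h hs (ae_of_all μ hs1)
    have hgs : Function.support (recenter μ B s) ⊆ B.set :=
      support_sub_subset hs Set.support_indicator_subset
    have hg0 := integral_recenter h B hsb
    have hgi : IntegrableOn (recenter μ B s) B.set μ :=
      ((hsb.recenter B).isIntBdd h).1.integrableOn
    have hgon : ∀ y ∈ B.set, recenter μ B s y = s y - c := fun y hy => by
      simp [recenter, hy, hc]
    have h0 : ∫ y in B.set, (f y - b) ∂μ = 0 := by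
      rw [integral_sub (hf B) (integrableOn_const hBt.ne), ← measure_smul_setAverage f hBt.ne,
        setIntegral_const, ← hb, sub_self]
    have h1 : ∫ y, f y * recenter μ B s y ∂μ =
        ((∫ y in B.set, ‖f y - b‖ ∂μ : ℝ) : ℂ) := by
      -- Only the first term survives integration: `f - b` and the recentred sign both have integral
      -- zero over `B`.
      have h2 : ∫ y in B.set, f y * recenter μ B s y ∂μ = ∫ y in B.set,
          (((‖f y - b‖ : ℂ) - c * (f y - b)) + b * recenter μ B s y) ∂μ := by
        refine setIntegral_congr_fun Metric.isOpen_ball.measurableSet fun y hy => ?_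
        rw [← hfs y hy, hgon y hy]
        ring
      have h3 : IntegrableOn (fun y => (‖f y - b‖ : ℂ) - c * (f y - b)) B.set μ :=
        hfb.norm.ofReal.sub (hfb.const_mul c)
      have h4 : IntegrableOn (fun y => (‖f y - b‖ : ℂ)) B.set μ := hfb.norm.ofReal
      rw [hset (hsupp hgs), h2, integral_add h3 (hgi.const_mul b), integral_sub h4
        (hfb.const_mul c), integral_const_mul,
        integral_const_mul, h0, ← hset hgs, hg0, integral_complex_ofReal]
      simp
    have h2 := htest B (recenter μ B s) 2 hgs (hsb.recenter B).1 (Or.inl hg0) two_pos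
      (ae_of_all _ fun y => by
        refine (norm_sub_le _ _).trans ?_
        have := (norm_indicator_le_norm_self (s := B.set) (fun _ : X => c) y).trans hc1
        linarith [hs1 y])
    rw [h1, Complex.norm_real, Real.norm_of_nonneg (integral_nonneg fun y => norm_nonneg _)] at h2
    exact h2.trans_eq (by ring)
  · rw [lintegral_div_le_ofReal_iff h (hf B) hC, hexp]
    obtain ⟨s, hs, hsm, hs1, hfs⟩ := exists_sign (hf B)
    have h1 := htest B s 1 hs (memLp_top_of_bound hsm 1 (ae_of_all _ hs1)) (Or.inr hB) one_pos
      (ae_of_all _ hs1)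
    have h2 : ∫ y, f y * s y ∂μ = ((∫ y in B.set, ‖f y‖ ∂μ : ℝ) : ℂ) := by
      rw [hset (hsupp hs), ← integral_complex_ofReal]
      exact setIntegral_congr_fun Metric.isOpen_ball.measurableSet hfs
    rw [h2, Complex.norm_real, Real.norm_of_nonneg (integral_nonneg fun y => norm_nonneg _)] at h1
    exact h1.trans_eq (by ring)

end Testing

/-! ### The duality in an abstract ambient space -/

theorem hardyDualNorm_le {X : Type*} [MetricSpace X] [MeasurableSpace X] {μ : Measure X}
    {D : Set (Ball X)}
    {p : ℝ} {q : ℝ≥0∞} {hp : 0 < p} {V : Type*} [NormedAddCommGroup V] [NormedSpace ℂ V]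
    {rep : V → (X → ℂ) → Prop} {l : hardyDual μ D p hp q rep} {C : ℝ} (hC : 0 ≤ C)
    (hl : ∀ x, ‖l.1 x‖ ≤ C * hardyNorm μ D p q rep (x : V)) : hardyDualNorm l ≤ C :=
  csInf_le ⟨0, fun _ hc => hc.1⟩ ⟨hC, hl⟩

section Duality

variable {X : Type*} [MetricSpace X] [MeasurableSpace X] [BorelSpace X]
variable {μ : Measure X} {A : ℝ} {D : Set (Ball X)} {p : ℝ} {q : ℝ≥0∞} {hp : 0 < p}
variable {V : Type*} [NormedAddCommGroup V] [NormedSpace ℂ V] {rep : V → (X → ℂ) → Prop}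

/-- The functional `l` on the Hardy space is given by integration against `f`. -/
def IsPairing (f : X → ℂ) (l : hardyDual μ D p hp q rep) : Prop :=
  ∀ (x : atomicHardy μ D p hp q rep) (g : X → ℂ), IsBddBddSupp μ g → rep x g →
    l.1 x = ∫ y, f y * g y ∂μ

theorem IsAmbient.isPairing_unique (h : IsDoublingWith μ A) (hq : 1 ≤ q)
    (hV : IsAmbient μ D p rep) {f : X → ℂ} {l m : hardyDual μ D p hp q rep}
    (hl : IsPairing f l) (hm : IsPairing f m) : l = m := by
  rw [← sub_eq_zero]
  refine hV.dual_eq_zero h hq _ fun x B g hs hg _ hx => ?_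
  have hgb := isBddBddSupp_of_ball hg hs
  change l.1 x - m.1 x = 0
  rw [hl x g hgb hx, hm x g hgb hx, sub_self]

theorem IsAmbient.mcENorm_le (h : IsDoublingWith μ A) (hq : 1 ≤ q) (hV : IsAmbient μ D p rep)
    {f : X → ℂ} (hf : ∀ B : Ball X, IntegrableOn f B.set μ) {l : hardyDual μ D p hp q rep}
    (hl : ∀ (x : atomicHardy μ D p hp q rep) (B : Ball X) (g : X → ℂ),
        Function.support g ⊆ B.set → MemLp g ∞ μ → Cancels μ D B g → rep x g →
        l.1 x = ∫ y, f y * g y ∂μ)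
    {C : ℝ} (hC0 : 0 ≤ C) (hC : ∀ x, ‖l.1 x‖ ≤ C * hardyNorm μ D p q rep (x : V)) :
    mcENorm μ D (1 / p - 1) f ≤ ENNReal.ofReal (3 * C) := by
  refine mcENorm_le_of_testing h hf hC0 fun B g c hs hg hcan hc hgc => ?_
  obtain ⟨x, hx⟩ := hV.exists_mem_rep (hp := hp) h hq hs hg hcan
  rw [← hl x B g hs hg hcan hx]
  exact hV.norm_dual_le h hq l hC0 hC hc hs hg.1 hgc hcan x hx

/-- If every function in `ℰ^{1/p-1,1}_D` is the limit of functionals on the ambient space which are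
bounded on atoms, then `ℰ^{1/p-1,1}_D` is the dual of the Hardy space. -/
theorem IsAmbient.exists_duality (h : IsDoublingWith μ A) (hp1 : p ≤ 1) (hq : 1 ≤ q)
    (hV : IsAmbient μ D p rep) {K : ℝ} (hK : 0 ≤ K)
    (happ : ∀ (f : X → ℂ) (M : ℝ), 0 < M → IsMCBound μ D (1 / p - 1) f M →
      ∃ L : ℕ → V →L[ℂ] ℂ,
        (∀ (v : V) (a : X → ℂ), IsAtom μ p q a ∨ IsLocAtom μ D p q a → rep v a →
          ∀ N, ‖L N v‖ ≤ K * M) ∧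
        ∀ (v : V) (a : X → ℂ), IsAtom μ p q a ∨ IsLocAtom μ D p q a ∨ IsBddBddSupp μ a →
          rep v a → Tendsto (fun N => L N v) atTop (𝓝 (∫ y, f y * a y ∂μ))) {C : ℝ}
    (hC3 : 3 ≤ C) (hCK : 2 * K ≤ C) :
    ∃ Φ : morreyCampanato μ D (1 / p - 1) →ₗ[ℂ] hardyDual μ D p hp q rep,
      (∀ f l, l = Φ f ↔
        ∀ (x : atomicHardy μ D p hp q rep) (g : X → ℂ), IsBddBddSupp μ g → rep x g →
          l.1 x = ∫ y, f.1 y * g y ∂μ) ∧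
      Function.Surjective Φ ∧
      ∀ f, mcNorm μ D (1 / p - 1) f.1 ≤ C * hardyDualNorm (Φ f) ∧
        hardyDualNorm (Φ f) ≤ C * mcNorm μ D (1 / p - 1) f.1 := by
  -- The approximation hypothesis needs a positive `M`, while the seminorm of `f` may vanish. Any
  -- `ε` will do, since uniqueness shows that the functional does not depend on it.
  have hex : ∀ (f : morreyCampanato μ D (1 / p - 1)) (ε : ℝ), 0 < ε →
      ∃ l : hardyDual μ D p hp q rep, IsPairing f.1 l ∧ ∀ x, ‖l.1 x‖ ≤
        K * (2 * mcNorm μ D (1 / p - 1) f.1 + ε) * hardyNorm μ D p q rep (x : V) :=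
    fun f ε hε => by
      have hN : 0 ≤ mcNorm μ D (1 / p - 1) f.1 := ENNReal.toReal_nonneg
      have hM : 0 < 2 * mcNorm μ D (1 / p - 1) f.1 + ε := by positivity
      obtain ⟨L, hL1, hL2⟩ := happ f.1 _ hM
        (isMCBound_of_mcENorm_lt_top h f.2.1 f.2.2 (by linarith))
      obtain ⟨l, hl1, hl2⟩ := exists_dual_of_tendsto (hp := hp) hp1 L (by positivity)
        (fun a => ∫ y, f.1 y * a y ∂μ) hL1 hL2
      exact ⟨l, hl2, hl1⟩
  choose Ψ hΨ _ using fun f => hex f 1 one_pos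
  have huniq : ∀ (f : morreyCampanato μ D (1 / p - 1)) (l : hardyDual μ D p hp q rep),
      IsPairing f.1 l → l = Ψ f := fun f l hl => hV.isPairing_unique h hq hl (hΨ f)
  let Φ : morreyCampanato μ D (1 / p - 1) →ₗ[ℂ] hardyDual μ D p hp q rep :=
    { toFun := Ψ
      map_add' := fun f f' => by
        refine (huniq _ _ fun x g hg hx => ?_).symm
        change (Ψ f).1 x + (Ψ f').1 x = ∫ y, (f.1 y + f'.1 y) * g y ∂μ
        simp only [add_mul]
        rw [integral_add (integrable_mul_of_isBddBddSupp f.2.1 hg)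
          (integrable_mul_of_isBddBddSupp f'.2.1 hg), hΨ f x g hg hx, hΨ f' x g hg hx]
      map_smul' := fun c f => by
        refine (huniq _ _ fun x g hg hx => ?_).symm
        change c * (Ψ f).1 x = ∫ y, (c * f.1 y) * g y ∂μ
        simp only [mul_assoc]
        rw [integral_const_mul, hΨ f x g hg hx] }
  refine ⟨Φ, fun f l => ⟨fun hl => hl ▸ hΨ f, huniq f l⟩, fun l => ?_, fun f => ⟨?_, ?_⟩⟩
  · rcases isEmpty_or_nonempty X with hX | hX
    · have hz : ∀ l : hardyDual μ D p hp q rep, l = 0 := fun l =>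
        hV.dual_eq_zero h hq l fun x B => (hX.false B.center).elim
      exact ⟨0, (hz _).trans (hz l).symm⟩
    · obtain ⟨f, hf, hfl⟩ := hV.exists_function h hq l
      obtain ⟨C', hC'⟩ := l.2
      have hfin := (hV.mcENorm_le h hq hf hfl (abs_nonneg C') fun x => (hC' x).trans
        (mul_le_mul_of_nonneg_right (le_abs_self C') (hardyNorm_nonneg _ _ _ _ _ _))).trans_lt
          ENNReal.ofReal_lt_top
      refine ⟨⟨f, hf, hfin⟩, ?_⟩
      rw [← sub_eq_zero]
      -- The representing function is known to pair correctly only with `g` satisfying `Cancels`,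
      -- and those suffice to identify a functional.
      refine hV.dual_eq_zero h hq _ fun x B g hs hg hcan hx => ?_
      change (Ψ ⟨f, hf, hfin⟩).1 x - l.1 x = 0
      rw [hΨ _ x g (isBddBddSupp_of_ball hg hs) hx, hfl x B g hs hg hcan hx, sub_self]
  · have h1 : mcNorm μ D (1 / p - 1) f.1 / 3 ≤ hardyDualNorm (Φ f) := by
      obtain ⟨l, hl, hlb⟩ := hex f 1 one_pos
      have hlf : l = Φ f := huniq f l hl
      have hN : 0 ≤ mcNorm μ D (1 / p - 1) f.1 := ENNReal.toReal_nonneg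
      refine le_csInf ⟨_, by positivity, hlf ▸ hlb⟩ ?_
      rintro c ⟨hc0, hc⟩
      have h2 := hV.mcENorm_le h hq f.2.1 (l := Φ f) (fun x B g hs hg _ hx =>
        hΨ f x g (isBddBddSupp_of_ball hg hs) hx) hc0 hc
      have h3 := ENNReal.toReal_mono ENNReal.ofReal_ne_top h2
      rw [ENNReal.toReal_ofReal (by positivity)] at h3
      rw [div_le_iff₀ three_pos, mul_comm]
      exact h3
    have h2 : 0 ≤ hardyDualNorm (Φ f) := Real.sInf_nonneg fun _ hc => hc.1
    nlinarith
  · have hN : 0 ≤ mcNorm μ D (1 / p - 1) f.1 := ENNReal.toReal_nonneg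
    refine le_trans ?_ (mul_le_mul_of_nonneg_right hCK hN)
    refine le_of_forall_pos_le_add fun ε hε => ?_
    -- By uniqueness this is again `Φ f`, now with a bound arbitrarily close to `2 * K` times the
    -- norm of `f`.
    obtain ⟨l, hl, hlb⟩ := hex f (ε / (K + 1)) (by positivity)
    have hlf : l = Φ f := huniq f l hl
    rw [← hlf]
    refine (hardyDualNorm_le (by positivity) hlb).trans ?_
    have h3 : K * (ε / (K + 1)) ≤ ε := by
      rw [← mul_div_assoc, div_le_iff₀ (by positivity)]
      nlinarith
    linarith

end Duality

theorem IsAmbient.norm_le_one_of_atom {X : Type*} [MetricSpace X] [MeasurableSpace X]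
    [BorelSpace X] {μ : Measure X} {A : ℝ} {D : Set (Ball X)} {p : ℝ} {q : ℝ≥0∞} {V : Type*}
    [NormedAddCommGroup V] [NormedSpace ℂ V] {rep : V → (X → ℂ) → Prop} (h : IsDoublingWith μ A)
    (hq : 1 ≤ q) (hV : IsAmbient μ D p rep) {v : V} {a : X → ℂ}
    (ha : IsAtom μ p q a ∨ IsLocAtom μ D p q a) (hv : rep v a) : ‖v‖ ≤ 1 := by
  obtain ⟨B, hB, hcan⟩ : ∃ B, IsSizedOn μ p q B a ∧ Cancels μ D B a := by
    rcases ha with ⟨B, hB, h0⟩ | ⟨B, hBD, hB⟩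
    · exact ⟨B, hB, Or.inl h0⟩
    · exact ⟨B, hB, Or.inr hBD⟩
  exact (hV.norm_le (hB.hasSize.integrable h hq) hB.supp hcan hv).trans
    (hB.hasSize.integral_norm_mul_le h hq zero_le_one)

/-! ### The ambient space for `p < 1`: the dual of the Lipschitz space -/

section LipschitzAmbient

variable {X : Type*} [MetricSpace X] [MeasurableSpace X]
variable {μ : Measure X} {A : ℝ} {D : Set (Ball X)} {p α : ℝ} {q : ℝ≥0∞} {φ a : X → ℂ} {C : ℝ}

theorem IsLipBound.exists_ae_bound (hφ : IsLipBound μ D α φ C) (B : Ball X) :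
    ∃ c : ℝ, ∀ᵐ x ∂μ, x ∈ B.set → ‖φ x‖ ≤ c := by
  by_cases hB : B ∈ D
  · exact ⟨_, ae_imp_of_ae_restrict (hφ.size B hB)⟩
  · refine ⟨‖φ B.center‖ + C * μ.real B.set ^ α, ae_of_all _ fun x hx => ?_⟩
    have h1 := hφ.osc B hB x hx B.center (Metric.mem_ball_self B.radius_pos)
    have h2 := norm_le_norm_add_norm_sub' (φ x) (φ B.center)
    linarith

theorem IsLipBound.integrable_mul (hφ : IsLipBound μ D α φ C) (hm : AEStronglyMeasurable φ μ)
    (ha : IsIntBdd μ a) : Integrable (fun x => φ x * a x) μ := by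
  obtain ⟨ha, B, hB⟩ := ha
  obtain ⟨c, hc⟩ := hφ.exists_ae_bound B
  refine (ha.norm.const_mul c).mono' (hm.mul ha.1) ?_
  filter_upwards [hc] with x hx
  rw [norm_mul]
  by_cases hxB : x ∈ B.set
  · exact mul_le_mul_of_nonneg_right (hx hxB) (norm_nonneg _)
  · have : a x = 0 := by
      by_contra h0
      exact hxB (hB h0)
    simp [this]

theorem IsLipBound.norm_integral_mul_le (hφ : IsLipBound μ D α φ C)
    (hm : AEStronglyMeasurable φ μ) (ha : Integrable a μ) {B : Ball X}
    (hs : Function.support a ⊆ B.set) (hcan : Cancels μ D B a) :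
    ‖∫ x, φ x * a x ∂μ‖ ≤ C * ((∫ x, ‖a x‖ ∂μ) * μ.real B.set ^ α) := by
  -- Used with `z = 0` when `B ∈ D`, by the size bound, and with the value of `φ` at the centre
  -- otherwise, where cancellation of `a` allows a constant to be subtracted.
  have key : ∀ z : ℂ, (∀ᵐ x ∂μ, x ∈ B.set → ‖φ x - z‖ ≤ C * μ.real B.set ^ α) →
      ‖∫ x, (φ x - z) * a x ∂μ‖ ≤ C * ((∫ x, ‖a x‖ ∂μ) * μ.real B.set ^ α) := fun z hz => by
    refine (norm_integral_le_of_norm_le (ha.norm.const_mul (C * μ.real B.set ^ α)) ?_).trans_eq ?_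
    · filter_upwards [hz] with x hx
      rw [norm_mul]
      by_cases hxB : x ∈ B.set
      · exact mul_le_mul_of_nonneg_right (hx hxB) (norm_nonneg _)
      · have : a x = 0 := by
          by_contra h0
          exact hxB (hs h0)
        simp [this]
    · rw [integral_const_mul]
      ring
  by_cases hB : B ∈ D
  · have := key 0 (by simpa using ae_imp_of_ae_restrict (hφ.size B hB))
    simpa using this
  · have h0 := hcan.resolve_right hB
    have h1 := key (φ B.center) (ae_of_all _ fun x hx =>
      hφ.osc B hB x hx B.center (Metric.mem_ball_self B.radius_pos))
    have h2 : ∫ x, (φ x - φ B.center) * a x ∂μ = ∫ x, φ x * a x ∂μ := by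
      simp only [sub_mul]
      rw [integral_sub (hφ.integrable_mul hm ⟨ha, B, hs⟩) (ha.const_mul _), integral_const_mul, h0,
        mul_zero, sub_zero]
    rwa [h2] at h1

theorem LipD.norm_integral_mul_le (φ : LipD μ D α) (ha : Integrable a μ) {B : Ball X}
    (hs : Function.support a ⊆ B.set) (hcan : Cancels μ D B a) :
    ‖∫ x, φ.fn x * a x ∂μ‖ ≤ ((∫ x, ‖a x‖ ∂μ) * μ.real B.set ^ α) * ‖φ‖ := by
  set T := (∫ x, ‖a x‖ ∂μ) * μ.real B.set ^ α with hT
  have hT0 : 0 ≤ T := mul_nonneg (integral_nonneg fun x => norm_nonneg _) (by positivity)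
  refine le_of_forall_pos_le_add fun ε hε => ?_
  obtain ⟨C, hC, hlt⟩ := φ.exists_lt (show 0 < ε / (T + 1) by positivity)
  refine (hC.norm_integral_mul_le φ.2.1 ha hs hcan).trans ?_
  have h1 : C * T ≤ (‖φ‖ + ε / (T + 1)) * T := mul_le_mul_of_nonneg_right hlt.le hT0
  have h2 : ε / (T + 1) * T ≤ ε := by
    rw [div_mul_eq_mul_div, div_le_iff₀ (by positivity)]
    nlinarith
  linarith

theorem LipD.integrable_mul (φ : LipD μ D α) (ha : IsIntBdd μ a) :
    Integrable (fun x => φ.fn x * a x) μ := by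
  obtain ⟨hm, C, hC⟩ := φ.2
  exact hC.integrable_mul hm ha

/-- `LipD` is only seminormed (constants have norm zero when `D` is empty), but its dual is
separated, since a functional of norm zero vanishes on every element. -/
noncomputable instance : NormedAddCommGroup (StrongDual ℂ (LipD μ D α)) :=
  NormedAddCommGroup.ofSeparation fun v hv => ContinuousLinearMap.ext fun φ =>
    norm_le_zero_iff.1 (by simpa [hv] using v.le_opNorm φ)

theorem isAmbient_repLip (μ : Measure X) (D : Set (Ball X)) (p : ℝ) :
    IsAmbient μ D p (repLip μ D (1 / p - 1)) where
  add {v w a b} ha hb hv hw φ := by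
    simp only [Pi.add_apply, mul_add]
    rw [integral_add (φ.integrable_mul ha) (φ.integrable_mul hb), ← hv φ, ← hw φ]
    rfl
  smul c v a _ hv φ := by
    simp only [Pi.smul_apply, smul_eq_mul, mul_left_comm _ c]
    rw [integral_const_mul, ← hv φ]
    rfl
  unique {v w a} hv hw := ContinuousLinearMap.ext fun φ => (hv φ).trans (hw φ).symm
  exists_rep B a ha hs hcan := by
    let F : LipD μ D (1 / p - 1) →ₗ[ℂ] ℂ :=
      { toFun := fun φ => ∫ x, φ.fn x * a x ∂μ
        map_add' := fun φ ψ => by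
          change ∫ x, (φ.fn x + ψ.fn x) * a x ∂μ = _
          simp only [add_mul]
          exact integral_add (φ.integrable_mul ⟨ha, B, hs⟩) (ψ.integrable_mul ⟨ha, B, hs⟩)
        map_smul' := fun c φ => by
          change ∫ x, (c * φ.fn x) * a x ∂μ = c * _
          simp only [mul_assoc]
          exact integral_const_mul c _ }
    have hF := fun φ : LipD μ D (1 / p - 1) => φ.norm_integral_mul_le ha hs hcan
    exact ⟨F.mkContinuous _ hF, fun φ => rfl, LinearMap.mkContinuous_norm_le _
      (mul_nonneg (integral_nonneg fun x => norm_nonneg _) (by positivity)) hF⟩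

variable [BorelSpace X]

/-- The Lipschitz representative of `f` belongs to the predual of the ambient space, so evaluation
at it is already a continuous functional and the approximating sequence is constant. It is bounded
on atoms because atoms have norm at most one. -/
theorem IsDoublingWith.exists_approx_repLip (h : IsDoublingWith μ A) (hp : 0 < p) (hp1 : p < 1)
    (hq : 1 ≤ q) :
    ∃ K : ℝ, 0 ≤ K ∧ ∀ (D : Set (Ball X)) (f : X → ℂ) (M : ℝ), 0 < M →
      IsMCBound μ D (1 / p - 1) f M →
      ∃ L : ℕ → StrongDual ℂ (LipD μ D (1 / p - 1)) →L[ℂ] ℂ,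
        (∀ v a, IsAtom μ p q a ∨ IsLocAtom μ D p q a → repLip μ D (1 / p - 1) v a →
          ∀ N, ‖L N v‖ ≤ K * M) ∧
        ∀ v a, IsAtom μ p q a ∨ IsLocAtom μ D p q a ∨ IsBddBddSupp μ a →
          repLip μ D (1 / p - 1) v a →
          Tendsto (fun N => L N v) atTop (𝓝 (∫ y, f y * a y ∂μ)) := by
  have hα : 0 < 1 / p - 1 := sub_pos.2 ((one_lt_div hp).2 hp1)
  obtain ⟨K, hK, hKf⟩ := h.exists_isLipBound hα
  refine ⟨K, hK, fun D f M hM hf => ?_⟩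
  obtain ⟨g, hfg, hg⟩ := hKf D f M hf
  have := h.secondCountableTopology
  have hfm : AEStronglyMeasurable f μ :=
    (locallyIntegrable_of_integrableOn_ball hf.integrableOn).aestronglyMeasurable
  let φ : LipD μ D (1 / p - 1) := ⟨g, hfm.congr hfg, _, hg⟩
  refine ⟨fun _ => ContinuousLinearMap.apply ℂ ℂ φ, fun v a ha hv _ => ?_, fun v a _ hv => ?_⟩
  · change ‖v φ‖ ≤ _
    refine (v.le_opNorm φ).trans ?_
    have h1 := (isAmbient_repLip μ D p).norm_le_one_of_atom h hq ha hv
    have h2 : ‖φ‖ ≤ K * M := LipD.norm_le hg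
    exact (mul_le_mul h1 h2 (norm_nonneg _) zero_le_one).trans_eq (one_mul _)
  · have h1 : v φ = ∫ y, f y * a y ∂μ := by
      rw [hv φ]
      refine integral_congr_ae ?_
      filter_upwards [hfg] with y hy
      rw [hy]
      rfl
    change Tendsto (fun _ => v φ) atTop _
    rw [h1]
    exact tendsto_const_nhds

end LipschitzAmbient

/-! ### Truncation of functions of bounded mean oscillation -/

section Truncation

/-- Truncation of the real and the imaginary part at height `N`. -/
noncomputable def clamp (N : ℕ) (z : ℂ) : ℂ :=
  ⟨max (-N) (min N z.re), max (-N) (min N z.im)⟩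

theorem abs_clamp_sub_le (N : ℕ) (s t : ℝ) :
    |max (-(N : ℝ)) (min N s) - max (-(N : ℝ)) (min N t)| ≤ |s - t| :=
  (abs_max_sub_max_le_max _ _ _ _).trans (max_le (by simp)
    ((abs_min_sub_min_le_max _ _ _ _).trans (by simp)))

theorem norm_clamp_sub_le (N : ℕ) (z w : ℂ) : ‖clamp N z - clamp N w‖ ≤ 2 * ‖z - w‖ := by
  have h1 := Complex.norm_le_abs_re_add_abs_im (clamp N z - clamp N w)
  have h2 := (abs_clamp_sub_le N z.re w.re).trans (Complex.abs_re_le_norm (z - w))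
  have h3 := (abs_clamp_sub_le N z.im w.im).trans (Complex.abs_im_le_norm (z - w))
  simp only [Complex.sub_re, Complex.sub_im, clamp] at h1
  simp only [clamp] at h1 ⊢
  linarith

theorem clamp_zero (N : ℕ) : clamp N 0 = 0 := by
  simp [clamp, Complex.ext_iff]

theorem norm_clamp_le (N : ℕ) (z : ℂ) : ‖clamp N z‖ ≤ 2 * ‖z‖ := by
  simpa [clamp_zero] using norm_clamp_sub_le N z 0

theorem norm_clamp_le_const (N : ℕ) (z : ℂ) : ‖clamp N z‖ ≤ 2 * N := by
  have h1 : ∀ t : ℝ, |max (-(N : ℝ)) (min N t)| ≤ N := fun t =>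
    abs_le.2 ⟨le_max_left _ _, max_le (by linarith [N.cast_nonneg (α := ℝ)]) (min_le_left _ _)⟩
  have h2 := Complex.norm_le_abs_re_add_abs_im (clamp N z)
  have h3 := h1 z.re
  have h4 := h1 z.im
  simp only [clamp] at h2 ⊢
  linarith

theorem clamp_eq_self {N : ℕ} {z : ℂ} (hz : ‖z‖ ≤ N) : clamp N z = z := by
  have h1 := abs_le.1 ((Complex.abs_re_le_norm z).trans hz)
  have h2 := abs_le.1 ((Complex.abs_im_le_norm z).trans hz)
  apply Complex.ext
  · simp only [clamp]
    rw [min_eq_right h1.2, max_eq_right h1.1]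
  · simp only [clamp]
    rw [min_eq_right h2.2, max_eq_right h2.1]

theorem continuous_clamp (N : ℕ) : Continuous (clamp N) :=
  (LipschitzWith.of_dist_le_mul (K := 2) fun z w => by
    simpa [dist_eq_norm] using norm_clamp_sub_le N z w).continuous

variable {X : Type*} [MetricSpace X] [MeasurableSpace X]
variable {μ : Measure X} {A : ℝ} {D : Set (Ball X)} {α : ℝ} {f : X → ℂ} {M : ℝ}

/-- Truncation is `2`-Lipschitz, and replacing the truncated mean by the mean of the truncation
costs another factor `2`; hence `4`, independently of `N`. -/
theorem IsMCBound.clamp (h : IsDoublingWith μ A) (hf : IsMCBound μ D α f M) (N : ℕ) :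
    IsMCBound μ D α (fun x => clamp N (f x)) (4 * M) := by
  have hint : ∀ (x : X) (r : ℝ), 0 < r →
      IntegrableOn (fun x => LocHardy.clamp N (f x)) (Metric.ball x r) μ := fun x r hr =>
    ((hf.integrableOn x r hr).norm.const_mul 2).mono'
      ((continuous_clamp N).comp_aestronglyMeasurable (hf.integrableOn x r hr).1)
      (ae_of_all _ fun y => norm_clamp_le N _)
  have hM := hf.nonneg
  refine ⟨by positivity, hint, fun x r hr => ?_, fun B hB => ?_⟩
  · let B : Ball X := ⟨x, r, hr⟩
    have hc : ∀ c : ℂ, IntegrableOn (fun _ => c) B.set μ := fun c =>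
      integrableOn_const (h.lt_top _ _).ne
    set b := ⨍ z in B.set, f z ∂μ with hb
    have hi : IntegrableOn (fun y => LocHardy.clamp N (f y)) B.set μ := hint x r hr
    have hf' : IntegrableOn f B.set μ := hf.integrableOn x r hr
    have hfb : IntegrableOn (fun y => LocHardy.clamp N (f y) - LocHardy.clamp N b) B.set μ :=
      hi.sub (hc _)
    have h1 := setIntegral_norm_sub_average_le h hfb
    have h2 : ⨍ z in B.set, (LocHardy.clamp N (f z) - LocHardy.clamp N b) ∂μ =
        (⨍ z in B.set, LocHardy.clamp N (f z) ∂μ) - LocHardy.clamp N b := by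
      have hB : μ.real B.set ≠ 0 := (h.pos x r hr).ne'
      simp only [setAverage_eq]
      rw [integral_sub hi (hc _), smul_sub, setIntegral_const, inv_smul_smul₀ hB]
    have h3 : ∫ y in B.set, ‖LocHardy.clamp N (f y) - LocHardy.clamp N b‖ ∂μ ≤
        ∫ y in B.set, 2 * ‖f y - b‖ ∂μ :=
      integral_mono hfb.norm ((hf'.sub (hc b)).norm.const_mul 2) fun y => norm_clamp_sub_le N _ _
    rw [integral_const_mul] at h3
    simp only [h2, sub_sub_sub_cancel_right] at h1
    have h4 := hf.osc x r hr
    change ∫ y in B.set, ‖f y - b‖ ∂μ ≤ _ at h4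
    change ∫ y in B.set, ‖LocHardy.clamp N (f y) - ⨍ z in B.set, LocHardy.clamp N (f z) ∂μ‖ ∂μ ≤ _
    linarith
  · have hf' : IntegrableOn f B.set μ := hf.integrableOn _ _ B.radius_pos
    have h3 : ∫ y in B.set, ‖LocHardy.clamp N (f y)‖ ∂μ ≤ ∫ y in B.set, 2 * ‖f y‖ ∂μ :=
      integral_mono (hint _ _ B.radius_pos).norm (hf'.norm.const_mul 2) fun y => norm_clamp_le N _
    rw [integral_const_mul] at h3
    have h4 := hf.size B hB
    have h5 : 0 ≤ M * μ.real B.set ^ (1 + α) := by positivity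
    linarith

end Truncation

/-! ### The ambient space for `p = 1`: integrable functions -/

/-- Integration against a bounded function, as a functional on `L¹`. -/
noncomputable def pairingL1 {X : Type*} [MeasurableSpace X] {μ : Measure X}
    (g : X → ℂ) (c : ℝ) (hg : AEStronglyMeasurable g μ)
    (hc : ∀ x, ‖g x‖ ≤ c) : Lp ℂ 1 μ →L[ℂ] ℂ :=
  have hi : ∀ v : Lp ℂ 1 μ, Integrable (fun x => g x * v x) μ := fun v =>
    (L1.integrable_coeFn v).bdd_mul hg (ae_of_all _ hc)
  LinearMap.mkContinuous
    { toFun := fun v => ∫ x, g x * v x ∂μ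
      map_add' := fun v w => by
        rw [← integral_add (hi v) (hi w)]
        refine integral_congr_ae ?_
        filter_upwards [Lp.coeFn_add v w] with x hx
        rw [hx, Pi.add_apply, mul_add]
      map_smul' := fun z v => by
        rw [RingHom.id_apply, smul_eq_mul, ← integral_const_mul]
        refine integral_congr_ae ?_
        filter_upwards [Lp.coeFn_smul z v] with x hx
        rw [hx, Pi.smul_apply, smul_eq_mul, mul_left_comm] } c fun v => by
    change ‖∫ x, g x * v x ∂μ‖ ≤ _
    rw [L1.norm_eq_integral_norm, ← integral_const_mul]
    refine norm_integral_le_of_norm_le ((L1.integrable_coeFn v).norm.const_mul c)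
      (ae_of_all _ fun x => ?_)
    rw [norm_mul]
    exact mul_le_mul_of_nonneg_right (hc x) (norm_nonneg _)

theorem pairingL1_apply {X : Type*} [MeasurableSpace X] {μ : Measure X}
    {g : X → ℂ} {c : ℝ} (hg : AEStronglyMeasurable g μ)
    (hc : ∀ x, ‖g x‖ ≤ c) {v : Lp ℂ 1 μ} {a : X → ℂ} (hv : repL1 μ v a) :
    pairingL1 g c hg hc v = ∫ x, g x * a x ∂μ := by
  change ∫ x, g x * v x ∂μ = _
  refine integral_congr_ae ?_
  filter_upwards [hv] with x hx
  rw [hx]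

section LebesgueAmbient

variable {X : Type*} [MetricSpace X] [MeasurableSpace X] {μ : Measure X}

theorem isAmbient_repL1 (μ : Measure X) (D : Set (Ball X)) : IsAmbient μ D 1 (repL1 μ) where
  add {v w a b} _ _ hv hw := (Lp.coeFn_add v w).trans (hv.add hw)
  smul c v a _ hv := (Lp.coeFn_smul c v).trans (hv.const_smul c)
  unique hv hw := Lp.ext (hv.trans hw.symm)
  exists_rep B a ha _ _ := ⟨ha.toL1 a, ha.coeFn_toL1, by simp [L1.norm_of_fun_eq_integral_norm]⟩

variable [BorelSpace X] {A : ℝ} {D : Set (Ball X)} {q : ℝ≥0∞}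

/-- A function of bounded mean oscillation pairs with atoms. -/
theorem IsDoublingWith.exists_norm_integral_mul_atom_le (h : IsDoublingWith μ A) (hq : 1 < q) :
    ∃ K : ℝ, 0 ≤ K ∧ ∀ (D : Set (Ball X)) (f : X → ℂ) (M : ℝ), 0 < M → IsMCBound μ D 0 f M →
      ∀ a, IsAtom μ 1 q a ∨ IsLocAtom μ D 1 q a →
        Integrable (fun y => f y * a y) μ ∧ ‖∫ y, f y * a y ∂μ‖ ≤ K * M := by
  obtain ⟨K, hK, hKf⟩ := h.exists_lintegral_osc_mul_le hq
  refine ⟨K + 1, by positivity, fun D f M hM hf a ha => ?_⟩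
  obtain ⟨B, hB, hcan⟩ : ∃ B, IsSizedOn μ 1 q B a ∧ Cancels μ D B a := by
    rcases ha with ⟨B, hB, h0⟩ | ⟨B, hBD, hB⟩
    · exact ⟨B, hB, Or.inl h0⟩
    · exact ⟨B, hB, Or.inr hBD⟩
  have hai : Integrable a μ := hB.hasSize.integrable h hq.le
  have hBpos : 0 < μ.real B.set := h.pos _ _ B.radius_pos
  have hfB : IntegrableOn f B.set μ := hf.integrableOn _ _ B.radius_pos
  set b := ⨍ z in B.set, f z ∂μ with hb
  have h1 := hKf D f M hM hf B a hB
  have hm : AEStronglyMeasurable (fun y => (f y - b) * a y) (μ.restrict B.set) :=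
    (hfB.1.sub aestronglyMeasurable_const).mul hai.1.restrict
  have hsupp : Function.support (fun y => (f y - b) * a y) ⊆ B.set :=
    (Function.support_mul_subset_right _ a).trans hB.supp
  have h2 : IntegrableOn (fun y => (f y - b) * a y) B.set μ := ⟨hm, by
    refine lt_of_le_of_lt (le_of_eq_of_le ?_ h1) ENNReal.ofReal_lt_top
    exact lintegral_congr fun y => enorm_mul _ _⟩
  have h3 : Integrable (fun y => (f y - b) * a y) μ :=
    (integrableOn_iff_integrable_of_support_subset hsupp).1 h2
  -- The oscillating part is handled by the John-Nirenberg estimate. The constant part vanishes for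
  -- atoms with cancellation, and for local atoms it is at most `M`, since the mean of `f` is
  -- bounded on balls of `D`; this accounts for `K + 1`.
  have h4 : (fun y => f y * a y) = fun y => (f y - b) * a y + b * a y := by
    funext y
    ring
  rw [h4]
  refine ⟨h3.add (hai.const_mul b), ?_⟩
  rw [integral_add h3 (hai.const_mul b), integral_const_mul, add_mul, one_mul]
  refine (norm_add_le _ _).trans (add_le_add ?_ ?_)
  · have h5 : ∫ y, (f y - b) * a y ∂μ = ∫ y in B.set, (f y - b) * a y ∂μ :=
      (setIntegral_eq_integral_of_forall_compl_eq_zero fun x hx => by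
        by_contra h0
        exact hx (hsupp h0)).symm
    rw [h5]
    refine (norm_integral_le_lintegral_norm _).trans (ENNReal.toReal_le_of_le_ofReal
      (by positivity) (le_of_eq_of_le ?_ h1))
    refine lintegral_congr fun y => ?_
    rw [ofReal_norm, enorm_mul]
  · rcases hcan with h0 | hBD
    · simp [h0, hM.le]
    · have h6 : ‖∫ y, a y ∂μ‖ ≤ 1 := by
        refine (norm_integral_le_integral_norm _).trans ?_
        simpa using hB.hasSize.integral_norm_mul_le h hq.le zero_le_one
      have h7 : ‖b‖ ≤ M := by
        have h8 := norm_setAverage_sub_mul_le subset_rfl hfB (h.lt_top _ _) 0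
        have h9 := hf.size B hBD
        simp only [sub_zero, ← hb, add_zero, Real.rpow_one] at h8 h9
        exact le_of_mul_le_mul_right (h8.trans h9) hBpos
      rw [norm_mul]
      exact (mul_le_mul h7 h6 (norm_nonneg _) hM.le).trans_eq (mul_one M)

/-- An unbounded `f` does not act on `L¹`, but its truncations do. Their oscillation is bounded
uniformly in `N`, hence so are their pairings with atoms, and dominated convergence gives the limit
on every function whose product with `f` is integrable. -/
theorem IsDoublingWith.exists_approx_repL1 (h : IsDoublingWith μ A) (hq : 1 < q) :
    ∃ K : ℝ, 0 ≤ K ∧ ∀ (D : Set (Ball X)) (f : X → ℂ) (M : ℝ), 0 < M → IsMCBound μ D 0 f M →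
      ∃ L : ℕ → Lp ℂ 1 μ →L[ℂ] ℂ,
        (∀ v a, IsAtom μ 1 q a ∨ IsLocAtom μ D 1 q a → repL1 μ v a → ∀ N, ‖L N v‖ ≤ K * M) ∧
        ∀ v a, IsAtom μ 1 q a ∨ IsLocAtom μ D 1 q a ∨ IsBddBddSupp μ a → repL1 μ v a →
          Tendsto (fun N => L N v) atTop (𝓝 (∫ y, f y * a y ∂μ)) := by
  obtain ⟨K, hK, hKf⟩ := h.exists_norm_integral_mul_atom_le hq
  refine ⟨K * 4, by positivity, fun D f M hM hf => ?_⟩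
  have := h.secondCountableTopology
  have hfm : AEStronglyMeasurable f μ :=
    (locallyIntegrable_of_integrableOn_ball hf.integrableOn).aestronglyMeasurable
  have hcm : ∀ N, AEStronglyMeasurable (fun x => clamp N (f x)) μ := fun N =>
    (continuous_clamp N).comp_aestronglyMeasurable hfm
  refine ⟨fun N => pairingL1 (fun x => clamp N (f x)) (2 * N) (hcm N) fun x =>
    norm_clamp_le_const N _, fun v a ha hv N => ?_, fun v a ha hv => ?_⟩
  · rw [pairingL1_apply _ _ hv, mul_assoc]
    exact (hKf D _ _ (by positivity) (hf.clamp h N) a ha).2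
  · simp only [pairingL1_apply _ _ hv]
    have hfa : Integrable (fun y => f y * a y) μ := by
      rcases ha with ha | ha | ha
      · exact (hKf D f M hM hf a (Or.inl ha)).1
      · exact (hKf D f M hM hf a (Or.inr ha)).1
      · exact integrable_mul_of_isBddBddSupp (fun B => hf.integrableOn _ _ B.radius_pos) ha
    have ham : AEStronglyMeasurable a μ := (Lp.aestronglyMeasurable v).congr hv
    refine tendsto_integral_of_dominated_convergence (fun y => 2 * ‖f y * a y‖)
      (fun N => (hcm N).mul ham) (hfa.norm.const_mul 2) (fun N => ae_of_all _ fun y => ?_)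
      (ae_of_all _ fun y => ?_)
    · rw [norm_mul, norm_mul, ← mul_assoc]
      exact mul_le_mul_of_nonneg_right (norm_clamp_le N _) (norm_nonneg _)
    · refine tendsto_const_nhds.congr' ?_
      filter_upwards [eventually_ge_atTop ⌈‖f y‖⌉₊] with N hN
      rw [clamp_eq_self (Nat.ceil_le.1 hN)]

end LebesgueAmbient

end LocHardy

/-! ### The duality theorem -/

theorem theorem2p1 {X : Type*} [MetricSpace X] [MeasurableSpace X] [BorelSpace X]
    (μ : Measure X) (hμ : LocHardy.IsHomogeneousType μ)
    (p : ℝ) (hp : 0 < p) (hp1 : p ≤ 1)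
    (q : ℝ≥0∞) (hq1 : 1 ≤ q) (hpq : ENNReal.ofReal p < q) :
    ∃ C : ℝ, 0 < C ∧ ∀ D : Set (LocHardy.Ball X),
      -- `p = 1`: the Hardy space is a subspace of `L¹(X)`
      (p = 1 →
        ∃ Φ : LocHardy.morreyCampanato μ D (1 / p - 1) →ₗ[ℂ]
            LocHardy.hardyDual μ D p hp q (LocHardy.repL1 μ),
          (∀ f l, l = Φ f ↔
            ∀ (h : LocHardy.atomicHardy μ D p hp q (LocHardy.repL1 μ)) (g : X → ℂ),
              LocHardy.IsBddBddSupp μ g → LocHardy.repL1 μ h g →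
                l.1 h = ∫ x, f.1 x * g x ∂μ) ∧
          Function.Surjective Φ ∧
          ∀ f, LocHardy.mcNorm μ D (1 / p - 1) f.1 ≤ C * LocHardy.hardyDualNorm (Φ f) ∧
            LocHardy.hardyDualNorm (Φ f) ≤ C * LocHardy.mcNorm μ D (1 / p - 1) f.1) ∧
      -- `p < 1`: the Hardy space is a subspace of `(Lip_D(1/p-1; X))*`
      (p < 1 →
        ∃ Φ : LocHardy.morreyCampanato μ D (1 / p - 1) →ₗ[ℂ]
            LocHardy.hardyDual μ D p hp q (LocHardy.repLip μ D (1 / p - 1)),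
          (∀ f l, l = Φ f ↔
            ∀ (h : LocHardy.atomicHardy μ D p hp q (LocHardy.repLip μ D (1 / p - 1)))
              (g : X → ℂ),
              LocHardy.IsBddBddSupp μ g → LocHardy.repLip μ D (1 / p - 1) h g →
                l.1 h = ∫ x, f.1 x * g x ∂μ) ∧
          Function.Surjective Φ ∧
          ∀ f, LocHardy.mcNorm μ D (1 / p - 1) f.1 ≤ C * LocHardy.hardyDualNorm (Φ f) ∧
            LocHardy.hardyDualNorm (Φ f) ≤ C * LocHardy.mcNorm μ D (1 / p - 1) f.1) := by
  obtain ⟨A, h⟩ := hμ.exists_isDoublingWith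
  -- Each constant has to be produced before `D` is chosen, so both ranges of `p` are treated at
  -- once, with the value `0` in the range that does not occur. For `p = 1` the condition `p < q`
  -- becomes `q > 1`.
  have h1 : ∃ K : ℝ, 0 ≤ K ∧ (p = 1 → ∀ (D : Set (LocHardy.Ball X)) (f : X → ℂ) (M : ℝ), 0 < M →
      LocHardy.IsMCBound μ D (1 / p - 1) f M → ∃ L : ℕ → Lp ℂ 1 μ →L[ℂ] ℂ,
        (∀ v a, LocHardy.IsAtom μ p q a ∨ LocHardy.IsLocAtom μ D p q a → LocHardy.repL1 μ v a →
          ∀ N, ‖L N v‖ ≤ K * M) ∧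
        ∀ v a, LocHardy.IsAtom μ p q a ∨ LocHardy.IsLocAtom μ D p q a ∨
          LocHardy.IsBddBddSupp μ a → LocHardy.repL1 μ v a →
          Tendsto (fun N => L N v) atTop (𝓝 (∫ y, f y * a y ∂μ))) := by
    by_cases hp' : p = 1
    · subst hp'
      obtain ⟨K, hK, hKf⟩ := h.exists_approx_repL1 (by simpa using hpq)
      exact ⟨K, hK, fun _ D f M hM hf => hKf D f M hM (by simpa using hf)⟩
    · exact ⟨0, le_rfl, fun h' => absurd h' hp'⟩
  have h2 : ∃ K : ℝ, 0 ≤ K ∧ (p < 1 → ∀ (D : Set (LocHardy.Ball X)) (f : X → ℂ) (M : ℝ), 0 < M →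
      LocHardy.IsMCBound μ D (1 / p - 1) f M →
      ∃ L : ℕ → StrongDual ℂ (LocHardy.LipD μ D (1 / p - 1)) →L[ℂ] ℂ,
        (∀ v a, LocHardy.IsAtom μ p q a ∨ LocHardy.IsLocAtom μ D p q a →
          LocHardy.repLip μ D (1 / p - 1) v a → ∀ N, ‖L N v‖ ≤ K * M) ∧
        ∀ v a, LocHardy.IsAtom μ p q a ∨ LocHardy.IsLocAtom μ D p q a ∨
          LocHardy.IsBddBddSupp μ a → LocHardy.repLip μ D (1 / p - 1) v a →
          Tendsto (fun N => L N v) atTop (𝓝 (∫ y, f y * a y ∂μ))) := by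
    by_cases hp' : p < 1
    · obtain ⟨K, hK, hKf⟩ := h.exists_approx_repLip hp hp' hq1
      exact ⟨K, hK, fun _ => hKf⟩
    · exact ⟨0, le_rfl, fun h' => absurd h' hp'⟩
  obtain ⟨K, hK, hKf⟩ := h1
  obtain ⟨K', hK', hKf'⟩ := h2
  refine ⟨3 + 2 * K + 2 * K', by positivity, fun D => ⟨fun hp' => ?_, fun hp' => ?_⟩⟩
  · have hV : LocHardy.IsAmbient μ D p (LocHardy.repL1 μ) := hp' ▸ LocHardy.isAmbient_repL1 μ D
    exact hV.exists_duality h hp1 hq1 hK (hKf hp' D) (by linarith) (by linarith)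
  · exact (LocHardy.isAmbient_repLip μ D p).exists_duality h hp1 hq1 hK' (hKf' hp' D)
      (by linarith) (by linarith)
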